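/- Let $\mathcal H$ be a finitely generated nilpotent group of nilpotency class $\mathfrak n$ and let $\alpha:\mathcal H\to GL(N,\mathbb Z)$ be a homomorphism; write $\bar x=\alpha(x)$, which acts on $\mathbb R^N$ linearly and on $\mathbb T^N=\mathbb R^N/\mathbb Z^N$ by automorphisms. Let $a,b\in\mathcal H$ be such that $\bar a^{k_1}\bar b^{k_2}$ is ergodic on $\mathbb T^N$ (for Lebesgue measure) for every $(k_1,k_2)\in\mathbb Z^2\setminus\{0\}$. For $l\in\mathbb N$ put $g_1=a^l$, $\mathcal A=\bar g_1$, $d_0=b$ and $d_{i+1}=g_1^{-1}d_i^{-1}g_1d_i$ for $i\ge 0$. For $M\in GL(N,\mathbb Z)$ and $F:\mathbb T^N\to\mathbb R^N$ put $\Delta_MF=MF-F\circ M$. For a family of maps $R_x:\mathbb T^N\to\mathbb R^N$, $x\in\mathcal H$, put $$\mathcal L(x,y)=R_x\circ\bar y+\bar xR_y-R_y\circ\overline{xz}-\bar yR_x\circ\bar z-\overline{yx}R_z,\qquad z=x^{-1}y^{-1}xy .$$ For real $r\ge 0$ let $\|F\|_{C^r}$ be the maximum of the $C^r$ (Hölder,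 if $r\notin\mathbb N$) norms of the coordinate functions of $F$, and let $\|F_1,\dots,F_k\|_{C^r}=\max_j\|F_j\|_{C^r}$. Then for every sufficiently large $l$ there are constants $\kappa>0$, $\sigma'\ge 0$, $\delta>0$ and $C_r>0$ ($r\ge0$), depending only on $\alpha,a,b,l$ (and $C_r$ also on $r$), such that with $\sigma=N+3+\kappa$ the following holds. If $R_{g_1}$, $R_{d_0},\dots,R_{d_{\mathfrak n}}$ are $C^\infty$ and $\|R_{g_1},R_{d_0},\dots,R_{d_{\mathfrak n}}\|_{C^\sigma}<\delta$, then there is a $C^\infty$ map $\Omega:\mathbb T^N\to\mathbb R^N$ such that one can write $$R_{g_1}=\Delta_{\mathcal A}\Omega+\mathcal RR_{g_1},\qquad R_{d_i}=\Delta_{\bar d_i}\Omega+\mathcal RR_{d_i}\quad(0\le i\le\mathfrak n),$$ with, for all $r\ge 0$, $$\|\Omega\|_{C^r}\le C_r\,\|R_{g_1},R_{d_0},\dots,R_{d_{\mathfrak n}}\|_{C^{r+\sigma}},$$ $$\|\mathcal RR_{g_1},\mathcal RR_{d_0},\dots,\mathcal RR_{d_{\mathfrak n}}\|_{C^r}\le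 C_r\,\|\mathcal L(g_1,d_0),\dots,\mathcal L(g_1,d_{\mathfrak n})\|_{C^{r+\sigma+\sigma'}} .$$ -/

import Mathlib

open MeasureTheory Matrix
open scoped ENNReal NNReal ContDiff MatrixGroups

/-- Maps from the torus `𝕋^N = ℝ^N / ℤ^N` to `ℝ^N` (perturbation terms, displacement fields). -/
abbrev TorusMap (N : ℕ) : Type := UnitAddTorus (Fin N) → (Fin N → ℝ)

/-- The covering projection `ℝ^N → 𝕋^N`. -/
def torusProj {N : ℕ} (x : Fin N → ℝ) : UnitAddTorus (Fin N) :=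
  fun i => ((x i : ℝ) : UnitAddCircle)

/-- The automorphism of `𝕋^N` induced by a matrix of `GL(N, ℤ)`. -/
def toralAut {N : ℕ} (M : GL (Fin N) ℤ) (x : UnitAddTorus (Fin N)) : UnitAddTorus (Fin N) :=
  fun i => ∑ j, M.val i j • x j

/-- The linear action of a matrix of `GL(N, ℤ)` on `ℝ^N`. -/
def linAct {N : ℕ} (M : GL (Fin N) ℤ) (v : Fin N → ℝ) : Fin N → ℝ :=
  fun i => ∑ j, (M.val i j : ℝ) * v j

/-- `F` is of class `C^∞`: its pull-back to the universal cover `ℝ^N` is. -/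
def IsSmoothTorusMap {N : ℕ} (F : TorusMap N) : Prop :=
  ContDiff ℝ ∞ (fun x : Fin N → ℝ => F (torusProj x))

/-- The `C^r` norm of a function on `ℝ^N`, for real `r ≥ 0`: the supremum of the derivatives of
order at most `⌊r⌋` and, when `r` is not an integer, the Hölder seminorm of exponent `r - ⌊r⌋` of
the derivative of order `⌊r⌋`. -/
noncomputable def crNormCover {N : ℕ} (r : ℝ) (f : (Fin N → ℝ) → ℝ) : ℝ≥0∞ :=
  max (⨆ (k : ℕ) (_ : k ≤ ⌊r⌋₊) (x : Fin N → ℝ), ‖iteratedFDeriv ℝ k f x‖ₑ)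
    (⨆ (_ : Int.fract r ≠ 0) (x : Fin N → ℝ) (y : Fin N → ℝ) (_ : x ≠ y),
      ‖iteratedFDeriv ℝ ⌊r⌋₊ f x - iteratedFDeriv ℝ ⌊r⌋₊ f y‖ₑ / (edist x y) ^ Int.fract r)

/-- The `C^r` norm of a map `𝕋^N → ℝ^N`: the maximum of the `C^r` norms of its coordinate
functions. -/
noncomputable def crNorm {N : ℕ} (r : ℝ) (F : TorusMap N) : ℝ≥0∞ :=
  ⨆ i : Fin N, crNormCover r (fun x => F (torusProj x) i)

/-- The operator `Δ_M F = M F - F ∘ M`. -/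
def twistedDelta {N : ℕ} (M : GL (Fin N) ℤ) (F : TorusMap N) : TorusMap N :=
  fun x => linAct M (F x) - F (toralAut M x)

/-- `iterComm x y i` is `y` for `i = 0` and the iterated commutator `D_i(x, y)` for `i ≥ 1`:
`D_1(x, y) = x⁻¹ y⁻¹ x y` and `D_{i+1}(x, y) = x⁻¹ D_i(x, y)⁻¹ x D_i(x, y)`. -/
def iterComm {H : Type*} [Group H] (x y : H) : ℕ → H
  | 0 => y
  | i + 1 => x⁻¹ * (iterComm x y i)⁻¹ * x * iterComm x y i

/-- The cocycle difference
`L(x, y) = R_x ∘ y + x R_y - R_y ∘ (x z) - y R_x ∘ z - (y x) R_z`, where `z = x⁻¹ y⁻¹ x y`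
and group elements act through `ρ`. -/
def cocycleDiff {N : ℕ} {H : Type*} [Group H] (ρ : H →* GL (Fin N) ℤ) (R : H → TorusMap N)
    (x y : H) : TorusMap N :=
  fun p =>
    R x (toralAut (ρ y) p) + linAct (ρ x) (R y p)
      - R y (toralAut (ρ (x * (x⁻¹ * y⁻¹ * x * y))) p)
      - linAct (ρ y) (R x (toralAut (ρ (x⁻¹ * y⁻¹ * x * y)) p))
      - linAct (ρ (y * x)) (R (x⁻¹ * y⁻¹ * x * y) p)

/-- `α(a)^{k₁} α(b)^{k₂}` is ergodic for Lebesgue measure, for all `(k₁, k₂) ∈ ℤ² \ {0}`. -/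
def IsHigherRankErgodicPair {N : ℕ} {H : Type*} [Group H] (ρ : H →* GL (Fin N) ℤ)
    (a b : H) : Prop :=
  ∀ k₁ k₂ : ℤ, (k₁, k₂) ≠ (0, 0) →
    Ergodic (toralAut (ρ a ^ k₁ * ρ b ^ k₂)) (volume : Measure (UnitAddTorus (Fin N)))

/-- The joint norm `‖R_g, R_{d_0}, …, R_{d_n}‖_{C^r}`. -/
noncomputable def familyNorm {N : ℕ} {H : Type*} (R : H → TorusMap N) (g : H) (d : ℕ → H)
    (n : ℕ) (r : ℝ) : ℝ≥0∞ :=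
  max (crNorm r (R g)) (⨆ (i : ℕ) (_ : i ≤ n), crNorm r (R (d i)))

/-- The joint norm `‖L(g, d_0), …, L(g, d_n)‖_{C^r}`. -/
noncomputable def cocycleDiffNorm {N : ℕ} {H : Type*} [Group H] (ρ : H →* GL (Fin N) ℤ)
    (R : H → TorusMap N) (g : H) (d : ℕ → H) (n : ℕ) (r : ℝ) : ℝ≥0∞ :=
  ⨆ (i : ℕ) (_ : i ≤ n), crNorm r (cocycleDiff ρ R g (d i))

/-! On Fourier coefficients the equation for `h` reads `ρ(h) W(k) - W(h·k) = R_h(k)`, where `h·k` is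
the dual action on `ℤ^N`. For `g = a ^ l` it has two formal solutions at `k ≠ 0`: a sum over the
forward `g`-orbit of `k` and a sum over the backward orbit. The task is to make them converge with a
loss of decay independent of the order of decay, and to control their mismatch by the cocycle
differences.

Weights. In a representation of a nilpotent group, the sum of the generalised eigenspaces of one
element with eigenvalues of a given modulus is invariant under the whole group, and moduli multiply
(`modulusCompatible_of_isNilpotent`). So `ℂ^N` splits into invariant pieces on which `g ^ j * b ^ m`
has eigenvalues of modulus `exp (j α_i + m β_i)` (`exists_weightSystem`). A nonzero component of an
integer vector `k` has norm at least a constant times `‖k‖ ^ (-N)` (`exists_component_lower_bound`).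
Together with ergodicity this shows that the weights `(α_i, β_i)` of the components present in `k`
lie in no closed half-plane bounded by a line through the origin (`exists_positive_weight`). Hence
nonnegative combinations of them with bounded coefficients fill a whole square (`exists_exponents`).

Majorants. Sizes are measured by `Q_r(k) = ∏ ‖k_i‖ ^ (-r_i)` with `r ≥ 0`. Applying `g ^ n` to `k`
multiplies `Q_r` by about `exp (-n ∑ r_i α_i)`, so exponents with enough drift overcome the growth
of the twist `ρ`. Exponents `t θ + s₀ ν` do two jobs: `θ`, supported on components comparable with
`‖k‖`, gives decay of order `t`, while the bounded correction `s₀ ν` adjusts the drift. This is why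
the loss does not grow with `t` (`exists_concentrated_exponents`).

Solution. The forward sum is used where a dominant component of `k` has `α_i ≥ 0`, the backward sum
elsewhere. The equation for `g` then fails only where `k` and `g·k` lie in different regions, and
the error is the difference `D` of the two sums at a frequency with large components of both kinds.
`D` solves a twisted equation over `b` whose right side is a difference of two residuals. By
`coefCocycle_eq`, the residual of `d_i` solves an equation over a conjugate of `g` with the cocycle
difference, the residual of `g` and the residual of `d_{i+1}` on the right; descending from the
trivial last commutator bounds it by cocycle differences. Choosing `θ` with zero drift along `g`,
one gets exponents suitable for each of the two sums and both suitable for one of `b`, `b⁻¹`, and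
this bounds `D` (`exists_transition_bound`). The same descent then bounds every residual
(`exists_solution_family`). The zero mode is solved exactly, since `ρ(g) - 1` is invertible.
Smoothness and decay of coefficients are exchanged at a fixed cost in derivatives. -/

/-! ### Generalised eigenspaces grouped by the modulus of the eigenvalue. -/

section ModulusSpaces

variable {V : Type*} [AddCommGroup V] [Module ℂ V]

/-- The sum of the generalised eigenspaces of `f` for the eigenvalues of modulus `r`. -/
def modulusSpace (f : Module.End ℂ V) (r : ℝ) : Submodule ℂ V :=
  ⨆ (μ : ℂ) (_ : ‖μ‖ = r), f.maxGenEigenspace μ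

theorem maxGenEigenspace_le_modulusSpace (f : Module.End ℂ V) (μ : ℂ) :
    f.maxGenEigenspace μ ≤ modulusSpace f ‖μ‖ :=
  le_iSup₂_of_le μ rfl le_rfl

theorem mem_modulusSpace_of_eigenvector {f : Module.End ℂ V} {μ : ℂ} {v : V} (h : f v = μ • v) :
    v ∈ modulusSpace f ‖μ‖ :=
  maxGenEigenspace_le_modulusSpace f μ
    (Module.End.eigenspace_le_maxGenEigenspace (Module.End.mem_eigenspace_iff.2 h))

/-- A linear map intertwining `f` and `f'` maps modulus spaces to modulus spaces. -/
theorem map_modulusSpace_le {f f' e : Module.End ℂ V} (h : e * f = f' * e) (r : ℝ) :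
    (modulusSpace f r).map e ≤ modulusSpace f' r := by
  unfold modulusSpace
  simp only [Submodule.map_iSup]
  refine iSup₂_mono fun μ _ => ?_
  rintro _ ⟨v, hv, rfl⟩
  rw [SetLike.mem_coe, Module.End.mem_maxGenEigenspace] at hv
  obtain ⟨k, hk⟩ := hv
  rw [Module.End.mem_maxGenEigenspace]
  refine ⟨k, ?_⟩
  have h1 : SemiconjBy e (f - μ • 1) (f' - μ • 1) := by
    rw [SemiconjBy, mul_sub, sub_mul, h]; simp
  have h2 := congrArg (fun T : Module.End ℂ V => T v) (h1.pow_right k)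
  simp only [Module.End.mul_apply] at h2
  rw [← h2, hk, map_zero]

theorem disjoint_modulusSpace_maxGenEigenspace (f : Module.End ℂ V) {r : ℝ} {μ : ℂ}
    (h : ‖μ‖ ≠ r) : Disjoint (f.maxGenEigenspace μ) (modulusSpace f r) := by
  have := f.independent_maxGenEigenspace μ
  refine this.mono_right ?_
  unfold modulusSpace
  refine iSup₂_le fun ν hν => le_iSup₂_of_le ν ?_ le_rfl
  rintro rfl
  exact h hν

theorem norm_eq_of_mem_modulusSpace {f : Module.End ℂ V} {r : ℝ} {μ : ℂ} {v : V} (hv : v ≠ 0)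
    (hvr : v ∈ modulusSpace f r) (h : f v = μ • v) : ‖μ‖ = r := by
  by_contra hne
  refine hv ?_
  have := disjoint_modulusSpace_maxGenEigenspace f hne
  rw [Submodule.disjoint_def] at this
  exact this v (Module.End.eigenspace_le_maxGenEigenspace (Module.End.mem_eigenspace_iff.2 h)) hvr

variable [FiniteDimensional ℂ V]

/-- An invariant nonzero subspace contains an eigenvector. -/
theorem exists_eigenvector_of_invariant {f : Module.End ℂ V} {U : Submodule ℂ V}
    (hU : ∀ v ∈ U, f v ∈ U) (hne : U ≠ ⊥) : ∃ v ∈ U, v ≠ 0 ∧ ∃ μ : ℂ, f v = μ • v := by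
  have : Nontrivial U := Submodule.nontrivial_iff_ne_bot.2 hne
  obtain ⟨μ, hμ⟩ := Module.End.exists_eigenvalue (f.restrict hU)
  obtain ⟨v, hv⟩ := hμ.exists_hasEigenvector
  refine ⟨v, v.2, fun h => hv.2 (Subtype.ext h), μ, ?_⟩
  have := congrArg Subtype.val hv.apply_eq_smul
  simpa using this

/-- An invariant subspace all of whose eigenvectors have eigenvalue of modulus `r` lies in the
modulus space of `r`. -/
theorem le_modulusSpace {f : Module.End ℂ V} {r : ℝ} {U : Submodule ℂ V}
    (hU : ∀ v ∈ U, f v ∈ U)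
    (h : ∀ v ∈ U, v ≠ 0 → ∀ μ : ℂ, f v = μ • v → ‖μ‖ = r) : U ≤ modulusSpace f r := by
  have h1 : U = ⨆ μ, U ⊓ f.maxGenEigenspace μ :=
    Submodule.eq_iSup_inf_genEigenspace ⊤ hU f.iSup_maxGenEigenspace_eq_top
  rw [h1]
  refine iSup_le fun μ => ?_
  by_cases hb : U ⊓ f.maxGenEigenspace μ = ⊥
  · rw [hb]; exact bot_le
  · have hinv : ∀ v ∈ U ⊓ f.maxGenEigenspace μ, f v ∈ U ⊓ f.maxGenEigenspace μ := fun v hv =>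
      ⟨hU v hv.1, Module.End.mapsTo_maxGenEigenspace_of_comm (Commute.refl f) μ hv.2⟩
    obtain ⟨v, hv, hv0, ν, hν⟩ := exists_eigenvector_of_invariant hinv hb
    have hνμ : ν = μ := by
      by_contra hne
      have := (f.independent_maxGenEigenspace).pairwiseDisjoint hne
      rw [Function.onFun, Submodule.disjoint_def] at this
      exact hv0 (this v (Module.End.eigenspace_le_maxGenEigenspace
        (Module.End.mem_eigenspace_iff.2 hν)) hv.2)
    have := h v hv.1 hv0 ν hν
    rw [← this, hνμ]
    exact inf_le_right.trans (maxGenEigenspace_le_modulusSpace f μ)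

/-- An endomorphism all of whose eigenvalues have modulus `r` has determinant of modulus
`r ^ dim`. -/
theorem norm_det_eq_pow {f : Module.End ℂ V} {r : ℝ}
    (h : ∀ μ : ℂ, f.HasEigenvalue μ → ‖μ‖ = r) :
    ‖LinearMap.det f‖ = r ^ Module.finrank ℂ V := by
  rw [Module.End.det_eq_prod_roots_charpoly_of_splits (IsAlgClosed.splits _)]
  have hcard : Multiset.card f.charpoly.roots = Module.finrank ℂ V := by
    rw [← f.charpoly_natDegree]
    exact (IsAlgClosed.splits f.charpoly).natDegree_eq_card_roots.symm
  have h1 : ∀ μ ∈ f.charpoly.roots, ‖μ‖ = r := fun μ hμ => by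
    refine h μ ?_
    rw [Module.End.hasEigenvalue_iff_isRoot_charpoly]
    exact Polynomial.isRoot_of_mem_roots hμ
  rw [← hcard]
  generalize f.charpoly.roots = s at h1
  induction s using Multiset.induction_on with
  | empty => simp
  | cons a s ih =>
    rw [Multiset.prod_cons, norm_mul, Multiset.card_cons, pow_succ',
      h1 a (Multiset.mem_cons_self _ _), ih fun μ hμ => h1 μ (Multiset.mem_cons_of_mem hμ)]

theorem finite_modulus (f : Module.End ℂ V) : {r : ℝ | modulusSpace f r ≠ ⊥}.Finite := by
  have h1 : {μ : ℂ | f.HasEigenvalue μ}.Finite := by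
    have := (Module.End.finite_hasEigenvalue f)
    exact this
  refine (h1.image fun μ => ‖μ‖).subset fun r hr => ?_
  by_contra hn
  refine hr ?_
  unfold modulusSpace
  simp only [iSup_eq_bot]
  intro μ hμ
  by_contra hb
  refine hn ⟨μ, ?_, hμ⟩
  have hinv : ∀ v ∈ f.maxGenEigenspace μ, f v ∈ f.maxGenEigenspace μ := fun v hv =>
    Module.End.mapsTo_maxGenEigenspace_of_comm (Commute.refl f) μ hv
  have : f.HasUnifEigenvalue μ ⊤ := hb
  exact Module.End.hasUnifEigenvalue_iff_hasUnifEigenvalue_one (by simp) |>.1 this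

end ModulusSpaces

/-! ### Invariance and multiplicativity of moduli in representations of nilpotent groups. -/

section NilpotentModulus

variable {V : Type*} [AddCommGroup V] [Module ℂ V] {H : Type*} [Group H]

theorem rep_inv_apply (T : H →* Module.End ℂ V) (x : H) (v : V) : T x⁻¹ (T x v) = v := by
  rw [← Module.End.mul_apply, ← map_mul]; simp

theorem rep_apply_inv (T : H →* Module.End ℂ V) (x : H) (v : V) : T x (T x⁻¹ v) = v := by
  rw [← Module.End.mul_apply, ← map_mul]; simp

theorem rep_apply_ne_zero (T : H →* Module.End ℂ V) (x : H) {v : V} (hv : v ≠ 0) : T x v ≠ 0 :=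
  fun h => hv (by rw [← rep_inv_apply T x v, h, map_zero])

/-- The modulus spaces of `x` and `c` are mutually invariant and moduli multiply on them,
for every `x`. -/
def ModulusCompatible (T : H →* Module.End ℂ V) (c : H) : Prop :=
  ∀ x, (∀ r, ∀ v ∈ modulusSpace (T x) r, T c v ∈ modulusSpace (T x) r) ∧
    (∀ s, ∀ v ∈ modulusSpace (T c) s, T x v ∈ modulusSpace (T c) s) ∧
    ∀ r s, modulusSpace (T x) r ⊓ modulusSpace (T c) s ≤ modulusSpace (T (x * c)) (r * s)

theorem conj_mem_modulusSpace (T : H →* Module.End ℂ V) {x y z : H} (h : x * y * x⁻¹ = z) {r : ℝ}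
    {v : V} (hv : v ∈ modulusSpace (T y) r) : T x v ∈ modulusSpace (T z) r := by
  have h1 : T x * T y = T z * T x := by
    rw [← map_mul, ← map_mul, ← h]; simp
  exact map_modulusSpace_le h1 r (Submodule.mem_map_of_mem hv)

variable [FiniteDimensional ℂ V]

theorem modulus_pos (T : H →* Module.End ℂ V) (x : H) {r : ℝ} (h : modulusSpace (T x) r ≠ ⊥) :
    0 < r := by
  have hinv : ∀ v ∈ modulusSpace (T x) r, T x v ∈ modulusSpace (T x) r := fun v hv =>
    conj_mem_modulusSpace T (by group) hv
  obtain ⟨v, hv, hv0, μ, hμ⟩ := exists_eigenvector_of_invariant hinv h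
  rw [← norm_eq_of_mem_modulusSpace hv0 hv hμ, norm_pos_iff]
  rintro rfl
  exact rep_apply_ne_zero T x hv0 (by simpa using hμ)

theorem modulusSpace_inv (T : H →* Module.End ℂ V) (x : H) (r : ℝ) :
    modulusSpace (T x) r ≤ modulusSpace (T x⁻¹) r⁻¹ := by
  refine le_modulusSpace (fun v hv => conj_mem_modulusSpace T (by group) hv) ?_
  intro v hv hv0 μ hμ
  have hμ0 : μ ≠ 0 := by
    rintro rfl
    exact rep_apply_ne_zero T x⁻¹ hv0 (by simpa using hμ)
  have h1 : T x v = μ⁻¹ • v := by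
    have := congrArg (T x) hμ
    rw [rep_apply_inv, map_smul] at this
    rw [this, smul_smul, ← this, inv_mul_cancel₀ hμ0, one_smul]
  have := norm_eq_of_mem_modulusSpace hv0 hv h1
  rw [← this, norm_inv, inv_inv]

/-- Suppose `z` had a modulus `μ ≠ 1`, meeting the modulus space of `ν` for `y`. There `y * z` has
modulus `ν μ`, and `x⁻¹` conjugates `y * z` back to `y` while preserving the modulus spaces of `z`.
Iterating produces infinitely many moduli `ν μ ^ t` of `y`. -/
theorem modulusSpace_one_eq_top_of_conj (T : H →* Module.End ℂ V) {x y z : H}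
    (hz : ModulusCompatible T z) (h : x * y * x⁻¹ = y * z) : modulusSpace (T z) 1 = ⊤ := by
  have key : ∀ μ ν : ℝ, μ ≠ 1 → modulusSpace (T y) ν ⊓ modulusSpace (T z) μ = ⊥ := by
    intro μ ν hμ
    by_contra hne
    have step : ∀ t : ℕ, modulusSpace (T y) (ν * μ ^ t) ⊓ modulusSpace (T z) μ ≠ ⊥ := by
      intro t
      induction t with
      | zero => simpa using hne
      | succ t ih =>
        obtain ⟨v, hv, hv0⟩ := Submodule.exists_mem_ne_zero_of_ne_bot ih
        have h1 : T x⁻¹ v ∈ modulusSpace (T y) (ν * μ ^ (t + 1)) := by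
          have h2 := (hz y).2.2 _ _ hv
          rw [pow_succ, ← mul_assoc]
          refine conj_mem_modulusSpace T ?_ h2
          rw [← h]; group
        have h3 : T x⁻¹ v ∈ modulusSpace (T z) μ := (hz x⁻¹).2.1 _ v hv.2
        intro hb
        have : T x⁻¹ v ∈ (⊥ : Submodule ℂ V) := hb ▸ ⟨h1, h3⟩
        exact rep_apply_ne_zero T x⁻¹ hv0 (by simpa using this)
    have hpos : 0 < ν := modulus_pos T y fun hb => hne (by rw [hb, bot_inf_eq])
    have hposμ : 0 < μ := modulus_pos T z fun hb => hne (by rw [hb, inf_bot_eq])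
    have hinj : Function.Injective fun t : ℕ => ν * μ ^ t := by
      intro a b hab
      have : μ ^ a = μ ^ b := mul_left_cancel₀ hpos.ne' hab
      exact (pow_right_injective₀ hposμ hμ) this
    refine Set.infinite_of_injective_forall_mem hinj (fun t => ?_) (finite_modulus (T y))
    intro hb
    exact step t (by rw [hb, bot_inf_eq])
  have hbot : ∀ μ : ℝ, μ ≠ 1 → modulusSpace (T z) μ = ⊥ := by
    intro μ hμ
    by_contra hne
    obtain ⟨v, hv, hv0, ν, hν⟩ := exists_eigenvector_of_invariant
      (fun v hv => (hz y).2.1 μ v hv) hne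
    have : v ∈ modulusSpace (T y) ‖ν‖ ⊓ modulusSpace (T z) μ :=
      ⟨mem_modulusSpace_of_eigenvector hν, hv⟩
    rw [key μ _ hμ] at this
    exact hv0 (by simpa using this)
  refine top_le_iff.1 (le_modulusSpace (fun _ _ => trivial) ?_)
  intro v _ hv0 μ hμ
  by_contra hne
  have := mem_modulusSpace_of_eigenvector hμ
  rw [hbot _ hne] at this
  exact hv0 (by simpa using this)

/-- Conjugation sends the modulus space of `y` to that of `y * z`, and multiplying by `z⁻¹`, all of
whose eigenvalues have modulus one, changes no modulus. -/
theorem modulusSpace_invariant_of_conj (T : H →* Module.End ℂ V) {x y z : H}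
    (hz : ModulusCompatible T z) (hz' : ModulusCompatible T z⁻¹) (h : x * y * x⁻¹ = y * z)
    {r : ℝ} {v : V} (hv : v ∈ modulusSpace (T y) r) : T x v ∈ modulusSpace (T y) r := by
  have h1 : modulusSpace (T z⁻¹) 1 = ⊤ := by
    have := modulusSpace_inv T z 1
    rw [modulusSpace_one_eq_top_of_conj T hz h, inv_one] at this
    exact top_le_iff.1 this
  have h2 := conj_mem_modulusSpace T h hv
  have h3 := (hz' (y * z)).2.2 r 1 (show T x v ∈ _ from ⟨h2, by rw [h1]; trivial⟩)
  simpa using h3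

/-- `x` and `c` need not commute, so eigenvalues cannot simply be multiplied. On the part `U` where
`x * c` has modulus `‖μ‖`, each of `x`, `c`, `x * c` has a single modulus, and multiplicativity of
the determinant gives `r ^ d * s ^ d = ‖μ‖ ^ d` with `d = dim U`. -/
theorem modulusSpace_mul_le (T : H →* Module.End ℂ V) {x c : H}
    (h1 : ∀ y r, ∀ v ∈ modulusSpace (T y) r, T c v ∈ modulusSpace (T y) r)
    (h1' : ∀ y r, ∀ v ∈ modulusSpace (T y) r, T c⁻¹ v ∈ modulusSpace (T y) r)
    (h2 : ∀ y s, ∀ v ∈ modulusSpace (T c) s, T y v ∈ modulusSpace (T c) s) (r s : ℝ) :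
    modulusSpace (T x) r ⊓ modulusSpace (T c) s ≤ modulusSpace (T (x * c)) (r * s) := by
  have hxx : ∀ y r, ∀ v ∈ modulusSpace (T y) r, T y v ∈ modulusSpace (T y) r :=
    fun y r v hv => conj_mem_modulusSpace T (by group) hv
  refine le_modulusSpace ?_ ?_
  · rintro v ⟨hv1, hv2⟩
    rw [map_mul, Module.End.mul_apply]
    exact ⟨hxx x r _ (h1 x r v hv1), h2 x s _ (hxx c s v hv2)⟩
  intro v hv hv0 μ hμ
  set U : Submodule ℂ V := (modulusSpace (T x) r ⊓ modulusSpace (T c) s) ⊓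
    modulusSpace (T (x * c)) ‖μ‖ with hU
  have hvU : v ∈ U := ⟨hv, mem_modulusSpace_of_eigenvector hμ⟩
  have hcU : ∀ w ∈ U, T c w ∈ U := fun w hw =>
    ⟨⟨h1 x r w hw.1.1, hxx c s w hw.1.2⟩, h1 _ _ w hw.2⟩
  -- Invariance of the third factor comes from writing `x = (x * c) * c⁻¹`.
  have hxU : ∀ w ∈ U, T x w ∈ U := by
    intro w hw
    refine ⟨⟨hxx x r w hw.1.1, h2 x s w hw.1.2⟩, ?_⟩
    have h3 := hxx (x * c) _ _ (h1' (x * c) _ w hw.2)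
    rw [map_mul, Module.End.mul_apply, rep_apply_inv] at h3
    rwa [map_mul]
  have hxcU : ∀ w ∈ U, T (x * c) w ∈ U := fun w hw => by
    rw [map_mul, Module.End.mul_apply]; exact hxU _ (hcU w hw)
  have hdet : ∀ (y : H) (t : ℝ) (hy : ∀ w ∈ U, T y w ∈ U), U ≤ modulusSpace (T y) t →
      ‖LinearMap.det ((T y).restrict hy)‖ = t ^ Module.finrank ℂ U := by
    intro y t hy ht
    refine norm_det_eq_pow fun ν hν => ?_
    obtain ⟨w, hw⟩ := hν.exists_hasEigenvector
    have := congrArg Subtype.val hw.apply_eq_smul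
    exact norm_eq_of_mem_modulusSpace (fun h => hw.2 (Subtype.ext h)) (ht w.2)
      (by simpa using this)
  have e1 := hdet x r hxU (fun w hw => hw.1.1)
  have e2 := hdet c s hcU (fun w hw => hw.1.2)
  have e3 := hdet (x * c) ‖μ‖ hxcU (fun w hw => hw.2)
  have e4 : (T (x * c)).restrict hxcU = (T x).restrict hxU * (T c).restrict hcU := by
    ext w
    simp
  rw [e4, map_mul, norm_mul, e1, e2, ← mul_pow] at e3
  have hd : Module.finrank ℂ U ≠ 0 := by
    rw [Ne, Submodule.finrank_eq_zero]
    rintro hb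
    rw [hb] at hvU
    exact hv0 (by simpa using hvU)
  have hr : 0 < r := modulus_pos T x fun hb => hv0 (by have := hv.1; rw [hb] at this; simpa using this)
  have hs : 0 < s := modulus_pos T c fun hb => hv0 (by have := hv.2; rw [hb] at this; simpa using this)
  exact ((pow_left_inj₀ (mul_pos hr hs).le (norm_nonneg _) hd).1 e3).symm

theorem modulusCompatible_one (T : H →* Module.End ℂ V) : ModulusCompatible T 1 := by
  intro x
  refine ⟨fun r v hv => by simpa using hv, fun s v hv => ?_, fun r s => ?_⟩
  · exact conj_mem_modulusSpace T (by group) hv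
  · exact modulusSpace_mul_le T (fun y r v hv => by simpa using hv)
      (fun y r v hv => by simpa using hv)
      (fun y s v hv => conj_mem_modulusSpace T (by group) hv) r s

/-- Commutators of `c` with any `y` lie one step lower in the series, so conjugation of `y` by `c`,
or of `c` by `y`, is multiplication by an element already known to be compatible. -/
theorem modulusCompatible_of_mem_upperCentralSeries (T : H →* Module.End ℂ V) (n : ℕ) :
    ∀ c ∈ Subgroup.upperCentralSeries H n, ModulusCompatible T c := by
  induction n with
  | zero =>
    intro c hc
    rw [Subgroup.upperCentralSeries_zero, Subgroup.mem_bot] at hc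
    rw [hc]; exact modulusCompatible_one T
  | succ n ih =>
    have aux : ∀ c ∈ Subgroup.upperCentralSeries H (n + 1), ∀ y,
        (∀ r, ∀ v ∈ modulusSpace (T y) r, T c v ∈ modulusSpace (T y) r) ∧
        (∀ r, ∀ v ∈ modulusSpace (T c) r, T y v ∈ modulusSpace (T c) r) := by
      intro c hc y
      rw [Subgroup.mem_upperCentralSeries_succ_iff] at hc
      have hn := (inferInstance : (Subgroup.upperCentralSeries H n).Normal)
      have m1 : y⁻¹ * c * y * c⁻¹ ∈ Subgroup.upperCentralSeries H n := by
        have := inv_mem (hc y⁻¹)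
        simpa [commutatorElement_def, mul_assoc] using this
      have m2 : c⁻¹ * y * c * y⁻¹ ∈ Subgroup.upperCentralSeries H n := by
        have := hn.conj_mem _ (inv_mem (hc y)) c⁻¹
        simpa [commutatorElement_def, mul_assoc] using this
      refine ⟨fun r v hv => ?_, fun r v hv => ?_⟩
      · exact modulusSpace_invariant_of_conj T (ih _ m1) (ih _ (inv_mem m1)) (by group) hv
      · exact modulusSpace_invariant_of_conj T (ih _ m2) (ih _ (inv_mem m2)) (by group) hv
    intro c hc x
    exact ⟨(aux c hc x).1, (aux c hc x).2, modulusSpace_mul_le T (fun y => (aux c hc y).1)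
      (fun y => (aux c⁻¹ (inv_mem hc) y).1) (fun y => (aux c hc y).2)⟩

theorem modulusCompatible_of_isNilpotent [Group.IsNilpotent H] (T : H →* Module.End ℂ V) (c : H) :
    ModulusCompatible T c := by
  obtain ⟨n, hn⟩ := Group.IsNilpotent.nilpotent H
  exact modulusCompatible_of_mem_upperCentralSeries T n c (by rw [hn]; trivial)

end NilpotentModulus

/-! ### Polynomial projections onto the modulus spaces. -/

section WeightDecomposition

variable {V : Type*} [AddCommGroup V] [Module ℂ V]

theorem aeval_mem_of_invariant {f : Module.End ℂ V} {U : Submodule ℂ V} (hU : ∀ v ∈ U, f v ∈ U)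
    (p : Polynomial ℂ) : ∀ v ∈ U, Polynomial.aeval f p v ∈ U := by
  intro v hv
  induction p using Polynomial.induction_on' with
  | add p q hp hq => rw [map_add, LinearMap.add_apply]; exact U.add_mem hp hq
  | monomial n a =>
    rw [Polynomial.aeval_monomial, Module.End.mul_apply, Module.algebraMap_end_apply]
    refine U.smul_mem _ ?_
    induction n with
    | zero => simpa using hv
    | succ n ih => rw [pow_succ', Module.End.mul_apply]; exact hU _ ih

theorem modulusSpace_invariant (f : Module.End ℂ V) (r : ℝ) :
    ∀ v ∈ modulusSpace f r, f v ∈ modulusSpace f r :=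
  fun _ hv => map_modulusSpace_le (rfl : f * f = f * f) r (Submodule.mem_map_of_mem hv)

theorem aeval_apply_eigenvector {f : Module.End ℂ V} {μ : ℂ} {v : V} (h : f v = μ • v)
    (p : Polynomial ℂ) : Polynomial.aeval f p v = p.eval μ • v := by
  by_cases hv : v = 0
  · simp [hv]
  · exact Module.End.aeval_apply_of_hasEigenvector ⟨Module.End.mem_eigenspace_iff.2 h, hv⟩

variable [FiniteDimensional ℂ V]

theorem modulusSpace_inf_eq_bot (f : Module.End ℂ V) {r s : ℝ} (h : r ≠ s) :
    modulusSpace f r ⊓ modulusSpace f s = ⊥ := by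
  by_contra hne
  have hinv : ∀ v ∈ modulusSpace f r ⊓ modulusSpace f s,
      f v ∈ modulusSpace f r ⊓ modulusSpace f s := fun v hv =>
    ⟨modulusSpace_invariant f r v hv.1, modulusSpace_invariant f s v hv.2⟩
  obtain ⟨v, hv, hv0, μ, hμ⟩ := exists_eigenvector_of_invariant hinv hne
  exact h ((norm_eq_of_mem_modulusSpace hv0 hv.1 hμ).symm.trans
    (norm_eq_of_mem_modulusSpace hv0 hv.2 hμ))

/-- The projection onto a modulus space is a polynomial in the endomorphism. -/
theorem exists_modulus_projection (f : Module.End ℂ V) (r : ℝ) :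
    ∃ P : Polynomial ℂ,
      (∀ v, Polynomial.aeval f P v ∈ modulusSpace f r) ∧
      (∀ v ∈ modulusSpace f r, Polynomial.aeval f P v = v) ∧
      ∀ r', r' ≠ r → ∀ v ∈ modulusSpace f r', Polynomial.aeval f P v = 0 := by
  classical
  -- The characteristic polynomial factors as `R * S`, with the roots of modulus `r` in `R` and the
  -- others in `S`. With the Bézout relation `a R + b S = 1`, the projection is `b S` evaluated at
  -- `f`.
  set m := f.charpoly.roots with hm
  set R : Polynomial ℂ :=
    ((m.filter fun μ => ‖μ‖ = r).map fun μ => Polynomial.X - Polynomial.C μ).prod with hR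
  set S : Polynomial ℂ :=
    ((m.filter fun μ => ¬ ‖μ‖ = r).map fun μ => Polynomial.X - Polynomial.C μ).prod with hS
  have hroot : ∀ (p : ℂ → Prop) [DecidablePred p] (μ : ℂ),
      (((m.filter p).map fun μ => Polynomial.X - Polynomial.C μ).prod).eval μ = 0 → p μ := by
    intro p _ μ h
    rw [Polynomial.eval_multiset_prod, Multiset.prod_eq_zero_iff] at h
    simp only [Multiset.map_map, Multiset.mem_map, Multiset.mem_filter, Function.comp_apply,
      Polynomial.eval_sub, Polynomial.eval_X, Polynomial.eval_C, sub_eq_zero] at h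
    obtain ⟨ν, ⟨_, hν⟩, h⟩ := h
    rwa [h]
  have hprod : f.charpoly = R * S := by
    have h1 := (IsAlgClosed.splits f.charpoly).eq_prod_roots_of_monic f.charpoly_monic
    rw [h1, ← hm, hR, hS, ← Multiset.prod_add, ← Multiset.map_add, Multiset.filter_add_not]
  have hcop : IsCoprime R S := by
    rw [Polynomial.isCoprime_iff_aeval_ne_zero_of_isAlgClosed ℂ ℂ]
    intro a
    by_contra hcon
    push Not at hcon
    simp only [Polynomial.coe_aeval_eq_eval] at hcon
    exact (hroot (fun μ => ¬ ‖μ‖ = r) a hcon.2) (hroot (fun μ => ‖μ‖ = r) a hcon.1)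
  obtain ⟨a, b, hab⟩ := hcop
  have hsub : ∀ (A B : Polynomial ℂ), f.charpoly ∣ A * B → ∀ v,
      Polynomial.aeval f A (Polynomial.aeval f B v) = 0 := by
    rintro A B ⟨c, hc⟩ v
    rw [← Module.End.mul_apply, ← map_mul, hc, map_mul, f.aeval_self_charpoly, zero_mul,
      LinearMap.zero_apply]
  have hrange : ∀ (B : Polynomial ℂ), ∀ v ∈ LinearMap.range (Polynomial.aeval f B),
      f v ∈ LinearMap.range (Polynomial.aeval f B) := by
    rintro B _ ⟨v, rfl⟩
    refine ⟨f v, ?_⟩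
    have : Commute (Polynomial.aeval f B) f := by
      have := Polynomial.aeval_X (R := ℂ) f
      conv_rhs => rw [← this]
      rw [commute_iff_eq, ← map_mul, ← map_mul, mul_comm]
    exact congrArg (fun T : Module.End ℂ V => T v) this.eq
  -- By Cayley–Hamilton `R` kills the range of `b S`, so the eigenvalues on that range are roots of
  -- `R`.
  have hmem : ∀ v, Polynomial.aeval f (b * S) v ∈ modulusSpace f r := by
    intro v
    refine (le_modulusSpace (hrange (b * S)) ?_) ⟨v, rfl⟩
    rintro _ ⟨w, rfl⟩ hw μ hμ
    have h1 := hsub R (b * S) (by rw [hprod]; exact ⟨b, by ring⟩) w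
    rw [aeval_apply_eigenvector hμ] at h1
    exact hroot _ μ ((smul_eq_zero.1 h1).resolve_right hw)
  refine ⟨b * S, hmem, ?_, ?_⟩
  · intro v hv
    have h0 : v - Polynomial.aeval f (b * S) v = Polynomial.aeval f (a * R) v := by
      have := congrArg (fun p => Polynomial.aeval f p v) hab
      simp only [map_add, map_one, LinearMap.add_apply, Module.End.one_apply] at this
      exact (eq_sub_of_add_eq this).symm
    by_contra hne
    -- The defect `a R v` lies in a range killed by `S`, whose eigenvalues have modulus other than
    -- `r`; a nonzero defect would give an eigenvector with both properties.
    have hU : modulusSpace f r ⊓ LinearMap.range (Polynomial.aeval f (a * R)) ≠ ⊥ := by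
      intro hb
      have : v - Polynomial.aeval f (b * S) v ∈
          modulusSpace f r ⊓ LinearMap.range (Polynomial.aeval f (a * R)) :=
        ⟨Submodule.sub_mem _ hv (hmem v), ⟨v, h0.symm⟩⟩
      rw [hb, Submodule.mem_bot, sub_eq_zero] at this
      exact hne this.symm
    have hinv : ∀ v ∈ modulusSpace f r ⊓ LinearMap.range (Polynomial.aeval f (a * R)),
        f v ∈ modulusSpace f r ⊓ LinearMap.range (Polynomial.aeval f (a * R)) := fun v hv =>
      ⟨modulusSpace_invariant f r v hv.1, hrange _ v hv.2⟩
    obtain ⟨w, ⟨hw1, u, rfl⟩, hw0, μ, hμ⟩ := exists_eigenvector_of_invariant hinv hU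
    have h1 := hsub S (a * R) (by rw [hprod]; exact ⟨a, by ring⟩) u
    rw [aeval_apply_eigenvector hμ] at h1
    exact hroot _ μ ((smul_eq_zero.1 h1).resolve_right hw0)
      (norm_eq_of_mem_modulusSpace hw0 hw1 hμ)
  · intro r' hr' v hv
    have : Polynomial.aeval f (b * S) v ∈ modulusSpace f r' ⊓ modulusSpace f r :=
      ⟨aeval_mem_of_invariant (modulusSpace_invariant f r') _ v hv, hmem v⟩
    rw [modulusSpace_inf_eq_bot f hr'] at this
    simpa using this

/-- The polynomial projecting onto the modulus space of `r`. -/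
noncomputable def modulusPoly (f : Module.End ℂ V) (r : ℝ) : Polynomial ℂ :=
  (exists_modulus_projection f r).choose

/-- The projection onto the modulus space of `r`. -/
noncomputable def modulusProj (f : Module.End ℂ V) (r : ℝ) : Module.End ℂ V :=
  Polynomial.aeval f (modulusPoly f r)

theorem modulusProj_mem (f : Module.End ℂ V) (r : ℝ) (v : V) :
    modulusProj f r v ∈ modulusSpace f r :=
  (exists_modulus_projection f r).choose_spec.1 v

theorem modulusProj_of_mem (f : Module.End ℂ V) {r : ℝ} {v : V} (hv : v ∈ modulusSpace f r) :
    modulusProj f r v = v :=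
  (exists_modulus_projection f r).choose_spec.2.1 v hv

theorem modulusProj_of_mem_ne (f : Module.End ℂ V) {r r' : ℝ} (h : r' ≠ r) {v : V}
    (hv : v ∈ modulusSpace f r') : modulusProj f r v = 0 :=
  (exists_modulus_projection f r).choose_spec.2.2 r' h v hv

/-- Two linear maps which agree on all modulus spaces are equal. -/
theorem ext_modulusSpace (f : Module.End ℂ V) {A B : Module.End ℂ V}
    (h : ∀ r, modulusSpace f r ≠ ⊥ → ∀ v ∈ modulusSpace f r, A v = B v) : A = B := by
  have h1 : (⊤ : Submodule ℂ V) ≤ LinearMap.eqLocus A B := by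
    rw [← f.iSup_maxGenEigenspace_eq_top]
    refine iSup_le fun μ v hv => ?_
    by_cases hb : modulusSpace f ‖μ‖ = ⊥
    · have := maxGenEigenspace_le_modulusSpace f μ hv
      rw [hb, Submodule.mem_bot] at this
      rw [this]; exact Submodule.zero_mem _
    · exact h ‖μ‖ hb v (maxGenEigenspace_le_modulusSpace f μ hv)
  ext v
  exact h1 (Submodule.mem_top (x := v))

theorem sum_modulusProj (f : Module.End ℂ V) :
    ∑ r ∈ (finite_modulus f).toFinset, modulusProj f r = 1 := by
  refine ext_modulusSpace f fun r hr v hv => ?_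
  rw [LinearMap.sum_apply, Finset.sum_eq_single r]
  · rw [modulusProj_of_mem f hv]; rfl
  · intro r' _ hne
    exact modulusProj_of_mem_ne f hne.symm hv
  · intro hn
    simp at hn
    exact absurd hn hr

theorem modulusProj_commute {f A : Module.End ℂ V}
    (h : ∀ r, ∀ v ∈ modulusSpace f r, A v ∈ modulusSpace f r) (r : ℝ) :
    Commute (modulusProj f r) A := by
  refine ext_modulusSpace f fun r' _ v hv => ?_
  rw [Module.End.mul_apply, Module.End.mul_apply]
  by_cases hr : r' = r
  · subst hr
    rw [modulusProj_of_mem f hv, modulusProj_of_mem f (h _ v hv)]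
  · rw [modulusProj_of_mem_ne f hr hv, modulusProj_of_mem_ne f hr (h _ v hv), map_zero]

end WeightDecomposition

/-! ### Joint weight decompositions for a pair of elements. -/

section WeightSystems

variable {V : Type*} [AddCommGroup V] [Module ℂ V] {H : Type*} [Group H]

/-- A decomposition of a representation into invariant pieces, on each of which the elements
`g ^ j * b ^ m` act with eigenvalues of a single modulus. -/
structure WeightSystem (T : H →* Module.End ℂ V) (g b : H) where
  ι : Type
  fintype : Fintype ι
  proj : ι → Module.End ℂ V
  α : ι → ℝ
  β : ι → ℝ
  sum_proj : ∑ i, proj i = 1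
  idem : ∀ i v, proj i (proj i v) = proj i v
  comm : ∀ i h, Commute (proj i) (T h)
  preserves : ∀ i (U : Submodule ℂ V), (∀ h, ∀ v ∈ U, T h v ∈ U) → ∀ v ∈ U, proj i v ∈ U
  eigen : ∀ i (j m : ℤ) (q : ℕ) (μ : ℂ) (v : V), proj i v = v → v ≠ 0 →
    T ((g ^ j * b ^ m) ^ q) v = μ • v → ‖μ‖ = Real.exp (q * (j * α i + m * β i))

attribute [instance] WeightSystem.fintype

variable [FiniteDimensional ℂ V] [Group.IsNilpotent H]

theorem modulusSpace_pow_le (T : H →* Module.End ℂ V) (x : H) (r : ℝ) (n : ℕ) :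
    modulusSpace (T x) r ≤ modulusSpace (T (x ^ n)) (r ^ n) := by
  induction n with
  | zero =>
    have : modulusSpace (T (x ^ 0)) (r ^ 0) = ⊤ := by
      rw [pow_zero, pow_zero, map_one]
      refine top_le_iff.1 (le_modulusSpace (fun _ _ => trivial) fun v _ hv μ hμ => ?_)
      have : (1 - μ) • v = 0 := by
        rw [sub_smul, ← hμ, one_smul]; simp
      have := (smul_eq_zero.1 this).resolve_right hv
      rw [← sub_eq_zero.1 this, norm_one]
    rw [this]; exact le_top
  | succ n ih =>
    intro v hv
    have := (modulusCompatible_of_isNilpotent T x (x ^ n)).2.2 (r ^ n) r ⟨ih hv, hv⟩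
    rwa [← pow_succ, ← pow_succ] at this

theorem modulusSpace_zpow_le (T : H →* Module.End ℂ V) (x : H) (r : ℝ) (n : ℤ) :
    modulusSpace (T x) r ≤ modulusSpace (T (x ^ n)) (r ^ n) := by
  obtain ⟨n, rfl | rfl⟩ := n.eq_nat_or_neg
  · simpa using modulusSpace_pow_le T x r n
  · refine (modulusSpace_pow_le T x r n).trans ?_
    simpa using modulusSpace_inv T (x ^ n) (r ^ n)

/-- The pieces are the intersections of modulus spaces of `g` and of `b`, the weights being
logarithms of moduli. The projections are products of polynomials in `T g` and `T b`, hence preserve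
every invariant subspace, including the orbit spans used later. -/
theorem exists_weightSystem (T : H →* Module.End ℂ V) (g b : H) :
    Nonempty (WeightSystem T g b) := by
  classical
  set s := (finite_modulus (T g)).toFinset
  set t := (finite_modulus (T b)).toFinset
  have hc := modulusCompatible_of_isNilpotent T
  have hcg : ∀ r h, Commute (modulusProj (T g) r) (T h) := fun r h =>
    modulusProj_commute (fun r v hv => (hc g h).2.1 r v hv) r
  have hcb : ∀ r h, Commute (modulusProj (T b) r) (T h) := fun r h =>
    modulusProj_commute (fun r v hv => (hc b h).2.1 r v hv) r
  have hmem : ∀ (r s : ℝ) v, modulusProj (T g) r (modulusProj (T b) s v) ∈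
      modulusSpace (T g) r ⊓ modulusSpace (T b) s := fun r s v =>
    ⟨modulusProj_mem _ _ _, aeval_mem_of_invariant (fun v hv => (hc b g).2.1 s v hv) _ _
      (modulusProj_mem _ _ _)⟩
  refine ⟨{
    ι := s × t
    fintype := inferInstance
    proj := fun i => modulusProj (T g) i.1 * modulusProj (T b) i.2
    α := fun i => Real.log i.1
    β := fun i => Real.log i.2
    sum_proj := ?_
    idem := ?_
    comm := ?_
    preserves := ?_
    eigen := ?_ }⟩
  · rw [Fintype.sum_prod_type]
    have h1 := Finset.sum_coe_sort s fun r => modulusProj (T g) r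
    have h2 := Finset.sum_coe_sort t fun r => modulusProj (T b) r
    rw [sum_modulusProj] at h1 h2
    simp only [← Finset.mul_sum, h2, mul_one, h1]
  · intro i v
    have h := hmem i.1 i.2 v
    rw [Module.End.mul_apply, Module.End.mul_apply, modulusProj_of_mem _ h.2,
      modulusProj_of_mem _ h.1]
  · exact fun i h => (hcg _ h).mul_left (hcb _ h)
  · intro i U hU v hv
    exact aeval_mem_of_invariant (hU g) _ _ (aeval_mem_of_invariant (hU b) _ _ hv)
  · intro i j m q μ v hv hv0 hμ
    have h := hmem i.1 i.2 v
    rw [← Module.End.mul_apply, hv] at h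
    have h1 := (hc (b ^ m) (g ^ j)).2.2 _ _
      ⟨modulusSpace_zpow_le T g _ j h.1, modulusSpace_zpow_le T b _ m h.2⟩
    have h2 := norm_eq_of_mem_modulusSpace hv0 (modulusSpace_pow_le T _ _ q h1) hμ
    have p1 : (0 : ℝ) < i.1 := modulus_pos T g fun hb => hv0 (by
      have := h.1; rw [hb] at this; simpa using this)
    have p2 : (0 : ℝ) < i.2 := modulus_pos T b fun hb => hv0 (by
      have := h.2; rw [hb] at this; simpa using this)
    rw [h2, Real.exp_nat_mul, Real.exp_add, mul_comm (j : ℝ), mul_comm (m : ℝ), Real.exp_mul,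
      Real.exp_mul, Real.exp_log p1, Real.exp_log p2, Real.rpow_intCast, Real.rpow_intCast]

end WeightSystems

/-! ### Exponential growth from the spectral radius. -/

section Growth

variable {V : Type*} [NormedAddCommGroup V] [NormedSpace ℂ V] [FiniteDimensional ℂ V]

theorem exists_bound_of_eventually_le {u v : ℕ → ℝ} (hv : ∀ n, 0 < v n)
    (h : ∀ᶠ n in Filter.atTop, u n ≤ v n) : ∃ C : ℝ, 1 ≤ C ∧ ∀ n, u n ≤ C * v n := by
  obtain ⟨n₀, hn₀⟩ := Filter.eventually_atTop.1 h
  refine ⟨1 + ∑ n ∈ Finset.range n₀, |u n| / v n, ?_, fun n => ?_⟩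
  · have : 0 ≤ ∑ n ∈ Finset.range n₀, |u n| / v n :=
      Finset.sum_nonneg fun n _ => div_nonneg (abs_nonneg _) (hv n).le
    linarith
  · have hs : ∀ n ∈ Finset.range n₀, 0 ≤ |u n| / v n := fun n _ =>
      div_nonneg (abs_nonneg _) (hv n).le
    by_cases hn : n₀ ≤ n
    · refine (hn₀ n hn).trans ?_
      have := Finset.sum_nonneg hs
      nlinarith [hv n, mul_nonneg this (hv n).le]
    · have h1 := Finset.single_le_sum hs (Finset.mem_range.2 (not_le.1 hn))
      have h2 : |u n| = |u n| / v n * v n := by field_simp [(hv n).ne']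
      have := mul_le_mul_of_nonneg_right h1 (hv n).le
      rw [← h2] at this
      nlinarith [le_abs_self (u n), hv n]

/-- Growth of the powers of an endomorphism on the range of a commuting idempotent, in terms of
the moduli of the eigenvalues there. -/
theorem exists_pow_bound {f p : Module.End ℂ V} (hfp : Commute p f) (hp : p * p = p) {a ε : ℝ}
    (hε : 0 < ε)
    (h : ∀ (μ : ℂ) (v : V), p v = v → v ≠ 0 → f v = μ • v → ‖μ‖ ≤ Real.exp a) :
    ∃ C : ℝ, 1 ≤ C ∧ ∀ (n : ℕ) (v : V), ‖(f ^ n) (p v)‖ ≤ C * Real.exp ((a + ε) * n) * ‖p v‖ := by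
  set A : V →L[ℂ] V := Module.End.toContinuousLinearMap V (f * p) with hA
  have hpow : ∀ n v, (A ^ n) (p v) = (f ^ n) (p v) := by
    intro n v
    induction n with
    | zero => simp
    | succ n ih =>
      rw [pow_succ', pow_succ', mul_apply_eq_comp, ih, Module.End.mul_apply, hA]
      change f (p ((f ^ n) (p v))) = _
      congr 1
      have h1 := congrArg (fun T : Module.End ℂ V => T (p v)) (hfp.pow_right n).eq
      simp only [Module.End.mul_apply] at h1
      rw [h1, ← Module.End.mul_apply p p, hp]
  -- An eigenvector of `f * p` with nonzero eigenvalue lies in the range of `p`, where the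
  -- hypothesis applies. Gelfand's formula then bounds the powers at the cost of `ε`.
  have hrad : spectralRadius ℂ A ≤ ENNReal.ofReal (Real.exp a) := by
    refine iSup₂_le fun μ hμ => ?_
    rw [hA, AlgEquiv.spectrum_eq, ← Module.End.hasEigenvalue_iff_mem_spectrum] at hμ
    by_cases hμ0 : μ = 0
    · simp [hμ0]
    obtain ⟨v, hv⟩ := hμ.exists_hasEigenvector
    have h1 := hv.apply_eq_smul
    have h2 : p v = v := by
      have h3 : p ((f * p) v) = (f * p) v := by
        rw [← Module.End.mul_apply, ← mul_assoc, hfp.eq, mul_assoc, hp]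
      rw [h1, map_smul] at h3
      exact smul_right_injective V hμ0 h3
    rw [Module.End.mul_apply, h2] at h1
    have h4 := h μ v h2 hv.2 h1
    rw [← ENNReal.ofReal_coe_nnreal, coe_nnnorm]
    exact ENNReal.ofReal_le_ofReal h4
  have hlim := spectrum.pow_norm_pow_one_div_tendsto_nhds_spectralRadius A
  have hlt : spectralRadius ℂ A < ENNReal.ofReal (Real.exp (a + ε)) :=
    hrad.trans_lt ((ENNReal.ofReal_lt_ofReal_iff (Real.exp_pos _)).2 (by
      rw [Real.exp_lt_exp]; linarith))
  have hev : ∀ᶠ n : ℕ in Filter.atTop, ‖A ^ n‖ ≤ Real.exp ((a + ε) * n) := by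
    filter_upwards [hlim.eventually_lt_const hlt, Filter.eventually_gt_atTop 0] with n hn hn0
    have h1 := (ENNReal.ofReal_lt_ofReal_iff (Real.exp_pos _)).1 hn
    have h2 := Real.rpow_le_rpow (by positivity) h1.le (Nat.cast_nonneg n)
    rw [← Real.rpow_mul (norm_nonneg _), one_div_mul_cancel (by positivity), Real.rpow_one,
      ← Real.exp_mul] at h2
    exact h2
  obtain ⟨C, hC1, hC⟩ := exists_bound_of_eventually_le (fun n => Real.exp_pos _) hev
  refine ⟨C, hC1, fun n v => ?_⟩
  rw [← hpow]
  exact ((A ^ n).le_opNorm _).trans (mul_le_mul_of_nonneg_right (hC n) (norm_nonneg _))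

end Growth

/-! ### The actions on integer and complex vectors. -/

section IntegerRepresentation

variable {N : ℕ} {H : Type*} [Group H]

/-- The action on `ℂ^N` of a homomorphism to `GL(N, ℤ)`. -/
def complexRep (σ : H →* GL (Fin N) ℤ) : H →* Module.End ℂ (Fin N → ℂ) where
  toFun h := Matrix.toLin' ((σ h).val.map (Int.cast : ℤ → ℂ))
  map_one' := by
    rw [map_one, Units.val_one]
    have : (1 : Matrix (Fin N) (Fin N) ℤ).map (Int.cast : ℤ → ℂ) = 1 := by
      simp
    rw [this, Matrix.toLin'_one]; rfl
  map_mul' x y := by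
    rw [map_mul, Units.val_mul]
    have : ((σ x).val * (σ y).val).map (Int.cast : ℤ → ℂ) =
      (σ x).val.map (Int.cast : ℤ → ℂ) * (σ y).val.map (Int.cast : ℤ → ℂ) :=
      Matrix.map_mul (f := Int.castRingHom ℂ)
    rw [this, Matrix.toLin'_mul]; rfl

/-- The action on `ℤ^N` of a homomorphism to `GL(N, ℤ)`. -/
def latticeAct (σ : H →* GL (Fin N) ℤ) (h : H) (k : Fin N → ℤ) : Fin N → ℤ :=
  (σ h).val.mulVec k

/-- An integer vector seen as a complex vector. -/
def intVec (k : Fin N → ℤ) : Fin N → ℂ := fun i => (k i : ℂ)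

theorem norm_intVec (k : Fin N → ℤ) : ‖intVec k‖ = ‖k‖ := by
  simp only [Pi.norm_def, intVec]
  congr 1
  refine Finset.sup_congr rfl fun i _ => ?_
  ext
  simp [Int.norm_eq_abs]

theorem complexRep_intVec (σ : H →* GL (Fin N) ℤ) (h : H) (k : Fin N → ℤ) :
    complexRep σ h (intVec k) = intVec (latticeAct σ h k) := by
  ext i
  simp [complexRep, intVec, latticeAct, Matrix.mulVec, dotProduct]

theorem latticeAct_one (σ : H →* GL (Fin N) ℤ) (k : Fin N → ℤ) : latticeAct σ 1 k = k := by
  simp [latticeAct]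

theorem latticeAct_mul (σ : H →* GL (Fin N) ℤ) (x y : H) (k : Fin N → ℤ) :
    latticeAct σ (x * y) k = latticeAct σ x (latticeAct σ y k) := by
  simp [latticeAct]

theorem latticeAct_ne_zero (σ : H →* GL (Fin N) ℤ) (x : H) {k : Fin N → ℤ} (hk : k ≠ 0) :
    latticeAct σ x k ≠ 0 := by
  intro h
  apply hk
  rw [← latticeAct_one σ k, ← inv_mul_cancel x, latticeAct_mul, h]
  simp [latticeAct]

theorem intVec_injective : Function.Injective (intVec : (Fin N → ℤ) → Fin N → ℂ) := by
  intro k l h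
  ext i
  have := congrFun h i
  simpa [intVec] using this

theorem intVec_ne_zero {k : Fin N → ℤ} (hk : k ≠ 0) : intVec k ≠ 0 := fun h =>
  hk (intVec_injective (by rw [h]; ext; simp [intVec]))

theorem one_le_norm_of_ne_zero {k : Fin N → ℤ} (hk : k ≠ 0) : 1 ≤ ‖k‖ := by
  obtain ⟨i, hi⟩ := Function.ne_iff.1 hk
  refine le_trans ?_ (norm_le_pi_norm k i)
  rw [Int.norm_eq_abs]
  exact_mod_cast Int.one_le_abs hi

end IntegerRepresentation

/-! ### Growth of the weight components under powers of `g` and `b`. -/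

section WeightGrowth

variable {N : ℕ} {H : Type*} [Group H] {σ : H →* GL (Fin N) ℤ} {g b : H}

namespace WeightSystem

variable (S : WeightSystem (complexRep σ) g b)

theorem proj_comm (i : S.ι) (h : H) (v : Fin N → ℂ) :
    S.proj i (complexRep σ h v) = complexRep σ h (S.proj i v) :=
  congrArg (fun T : Module.End ℂ (Fin N → ℂ) => T v) (S.comm i h).eq

/-- Makes constants uniform over a finite index set: one plus the sum of the individual constants
serves for all. -/
theorem exists_bound_finite {ι : Type*} [Fintype ι] {P : ι → ℝ → Prop}
    (hmono : ∀ i C D, C ≤ D → P i C → P i D) (h : ∀ i, ∃ C : ℝ, 1 ≤ C ∧ P i C) :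
    ∃ C : ℝ, 1 ≤ C ∧ ∀ i, P i C := by
  choose C hC hP using h
  refine ⟨1 + ∑ i, C i, ?_, fun i => hmono i _ _ ?_ (hP i)⟩
  · have : 0 ≤ ∑ i, C i := Finset.sum_nonneg fun i _ => zero_le_one.trans (hC i)
    linarith
  · have := Finset.single_le_sum (f := C) (fun i _ => zero_le_one.trans (hC i)) (Finset.mem_univ i)
    linarith

theorem exists_zpow_bound (x : H) (a : S.ι → ℝ)
    (hx : ∀ i (n : ℤ) (μ : ℂ) (v : Fin N → ℂ), S.proj i v = v → v ≠ 0 →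
      complexRep σ (x ^ n) v = μ • v → ‖μ‖ = Real.exp (n * a i)) {ε : ℝ} (hε : 0 < ε) :
    ∃ C : ℝ, 1 ≤ C ∧ ∀ i (n : ℤ) (v : Fin N → ℂ), ‖S.proj i (complexRep σ (x ^ n) v)‖ ≤
      C * Real.exp (n * a i + ε * |(n : ℝ)|) * ‖S.proj i v‖ := by
  refine exists_bound_finite (P := fun i C => ∀ (n : ℤ) (v : Fin N → ℂ),
    ‖S.proj i (complexRep σ (x ^ n) v)‖ ≤
      C * Real.exp (n * a i + ε * |(n : ℝ)|) * ‖S.proj i v‖) ?_ ?_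
  · intro i C D hCD h n v
    refine (h n v).trans ?_
    gcongr
  · intro i
    have hidem : S.proj i * S.proj i = S.proj i := LinearMap.ext fun v => S.idem i v
    obtain ⟨C₁, hC₁, h₁⟩ := exists_pow_bound (a := a i) (S.comm i x) hidem hε
      (fun μ v hv hv0 h => by
        have := hx i 1 μ v hv hv0 (by simpa using h)
        rw [this]; simp)
    obtain ⟨C₂, hC₂, h₂⟩ := exists_pow_bound (a := - a i) (S.comm i x⁻¹) hidem hε
      (fun μ v hv hv0 h => by
        have := hx i (-1) μ v hv hv0 (by simpa using h)
        rw [this]; simp)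
    refine ⟨max C₁ C₂, le_max_of_le_left hC₁, fun n v => ?_⟩
    obtain ⟨n, rfl | rfl⟩ := n.eq_nat_or_neg
    · have := h₁ n v
      rw [← map_pow, ← S.proj_comm] at this
      rw [zpow_natCast]
      refine this.trans ?_
      have e : (((n : ℤ) : ℝ) * a i + ε * |((n : ℤ) : ℝ)|) = (a i + ε) * n := by
        simp; ring
      rw [e]
      gcongr
      exact le_max_left _ _
    · have := h₂ n v
      rw [← map_pow, ← S.proj_comm, inv_pow] at this
      rw [_root_.zpow_neg, zpow_natCast]
      refine this.trans ?_
      have e : (((-(n : ℤ) : ℤ) : ℝ) * a i + ε * |((-(n : ℤ) : ℤ) : ℝ)|) = (-a i + ε) * n := by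
        simp; ring
      rw [e]
      gcongr
      exact le_max_right _ _

theorem exists_growth_left {ε : ℝ} (hε : 0 < ε) :
    ∃ C : ℝ, 1 ≤ C ∧ ∀ i (n : ℤ) (v : Fin N → ℂ), ‖S.proj i (complexRep σ (g ^ n) v)‖ ≤
      C * Real.exp (n * S.α i + ε * |(n : ℝ)|) * ‖S.proj i v‖ :=
  S.exists_zpow_bound g S.α (fun i n μ v hv hv0 h => by
    have := S.eigen i n 0 1 μ v hv hv0 (by simpa using h)
    simpa using this) hε

theorem exists_growth_right {ε : ℝ} (hε : 0 < ε) :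
    ∃ C : ℝ, 1 ≤ C ∧ ∀ i (n : ℤ) (v : Fin N → ℂ), ‖S.proj i (complexRep σ (b ^ n) v)‖ ≤
      C * Real.exp (n * S.β i + ε * |(n : ℝ)|) * ‖S.proj i v‖ :=
  S.exists_zpow_bound b S.β (fun i n μ v hv hv0 h => by
    have := S.eigen i 0 n 1 μ v hv hv0 (by simpa using h)
    simpa using this) hε

end WeightSystem

end WeightGrowth

/-! ### Lower bounds for the weight components of integer vectors. -/

section Diophantine

variable {N : ℕ} {H : Type*} [Group H]

/-- The span of the orbit of an integer vector. -/
def orbitSpan (σ : H →* GL (Fin N) ℤ) (k : Fin N → ℤ) : Submodule ℂ (Fin N → ℂ) :=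
  Submodule.span ℂ (Set.range fun h => complexRep σ h (intVec k))

theorem intVec_mem_orbitSpan (σ : H →* GL (Fin N) ℤ) (k : Fin N → ℤ) :
    intVec k ∈ orbitSpan σ k :=
  Submodule.subset_span ⟨1, by simp⟩

theorem orbitSpan_invariant (σ : H →* GL (Fin N) ℤ) (k : Fin N → ℤ) (h : H) :
    ∀ v ∈ orbitSpan σ k, complexRep σ h v ∈ orbitSpan σ k := by
  intro v hv
  have : orbitSpan σ k ≤ (orbitSpan σ k).comap (complexRep σ h) := by
    refine Submodule.span_le.2 ?_
    rintro _ ⟨x, rfl⟩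
    refine Submodule.subset_span ⟨h * x, ?_⟩
    simp
  exact this hv

/-- The endomorphism algebra is finite-dimensional, so finitely many operators span all operators of
the representation; the finite set does not depend on `k`. -/
theorem exists_finite_spanning (σ : H →* GL (Fin N) ℤ) :
    ∃ D : Finset H, ∀ k, orbitSpan σ k =
      Submodule.span ℂ (Set.range fun h : D => complexRep σ h (intVec k)) := by
  classical
  obtain ⟨B, hB, hspan, hli⟩ := exists_linearIndependent ℂ (Set.range (complexRep σ))
  have hfin : B.Finite := hli.setFinite
  have hB' : ∀ t ∈ B, ∃ h, complexRep σ h = t := fun t ht => hB ht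
  choose! f hf using hB'
  refine ⟨hfin.toFinset.image f, fun k => ?_⟩
  set ev : Module.End ℂ (Fin N → ℂ) →ₗ[ℂ] (Fin N → ℂ) := LinearMap.applyₗ (intVec k)
  have h1 : orbitSpan σ k = (Submodule.span ℂ (Set.range (complexRep σ))).map ev := by
    rw [Submodule.map_span, ← Set.range_comp]; rfl
  rw [h1, ← hspan, Submodule.map_span]
  congr 1
  ext v
  constructor
  · rintro ⟨t, ht, rfl⟩
    refine ⟨⟨f t, Finset.mem_image_of_mem f (hfin.mem_toFinset.2 ht)⟩, ?_⟩
    change complexRep σ (f t) (intVec k) = _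
    rw [hf t ht]; rfl
  · rintro ⟨⟨x, hx⟩, rfl⟩
    obtain ⟨t, ht, rfl⟩ := Finset.mem_image.1 hx
    refine ⟨t, hfin.mem_toFinset.1 ht, ?_⟩
    change t (intVec k) = complexRep σ (f t) (intVec k)
    rw [hf t (hfin.mem_toFinset.1 ht)]

/-- The vectors `h u`, for `h` in a finite set, together with the standard basis. -/
def frameFamily (σ : H →* GL (Fin N) ℤ) (D : Finset H) (u : Fin N → ℂ) :
    D ⊕ Fin N → Fin N → ℂ :=
  Sum.elim (fun h => complexRep σ h u) fun j => Pi.single j 1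

/-- Choose a basis among the orbit vectors and complete it by standard vectors. The vector `p k` is
a combination `∑ c_h h k` of the orbit part; applying the same coefficients to `k - p k` gives `p k
- p (p k) = 0`, so the modified family is dependent. -/
theorem exists_frame (σ : H →* GL (Fin N) ℤ) {D : Finset H} {k : Fin N → ℤ}
    (hD : orbitSpan σ k = Submodule.span ℂ (Set.range fun h : D => complexRep σ h (intVec k)))
    {p : Module.End ℂ (Fin N → ℂ)} (hp : ∀ h, Commute p (complexRep σ h))
    (hidem : ∀ v, p (p v) = p v) (hmem : p (intVec k) ∈ orbitSpan σ k)
    (hne : p (intVec k) ≠ 0) :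
    ∃ s : Fin N → D ⊕ Fin N,
      Matrix.det (fun j => frameFamily σ D (intVec k) (s j)) ≠ 0 ∧
      Matrix.det (fun j => frameFamily σ D (intVec k - p (intVec k)) (s j)) = 0 := by
  classical
  set φ := frameFamily σ D (intVec k) with hφ
  obtain ⟨b₁, hb₁, -, hspan₁, hli₁⟩ := exists_linearIndepOn_extension (K := ℂ) (v := φ)
    (linearIndepOn_empty ℂ φ) (Set.empty_subset (Set.range (Sum.inl : D → D ⊕ Fin N)))
  obtain ⟨b₂, -, hb₁₂, hspan₂, hli₂⟩ := exists_linearIndepOn_extension (K := ℂ) (v := φ)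
    hli₁ (Set.subset_univ b₁)
  have htop : ⊤ ≤ Submodule.span ℂ (Set.range fun x : b₂ => φ x) := by
    have h1 : (⊤ : Submodule ℂ (Fin N → ℂ)) =
        Submodule.span ℂ (Set.range fun j : Fin N => Pi.single j (1 : ℂ)) := by
      have := (Pi.basisFun ℂ (Fin N)).span_eq
      rw [← this]
      congr 2
      ext j; simp
    rw [h1, Submodule.span_le]
    rintro _ ⟨j, rfl⟩
    have := hspan₂ ⟨Sum.inr j, trivial, rfl⟩
    rwa [Set.image_eq_range] at this
  let B : Module.Basis b₂ ℂ (Fin N → ℂ) := Module.Basis.mk hli₂ htop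
  let e : Fin N ≃ b₂ := (Pi.basisFun ℂ (Fin N)).indexEquiv B
  refine ⟨fun j => e j, ?_, ?_⟩
  · have h1 : LinearIndependent ℂ fun j => φ (e j) := by
      have : LinearIndependent ℂ ((fun x : b₂ => φ x) ∘ e) := hli₂.comp e e.injective
      exact this
    have h2 := (Matrix.linearIndependent_rows_iff_isUnit
      (A := (fun j => φ (e j) : Matrix (Fin N) (Fin N) ℂ))).1 h1
    exact ((Matrix.isUnit_iff_isUnit_det _).1 h2).ne_zero
  · by_contra hdet
    have h1 : LinearIndependent ℂ
        fun j => frameFamily σ D (intVec k - p (intVec k)) (e j) :=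
      (Matrix.linearIndependent_rows_iff_isUnit (A := (fun j =>
        frameFamily σ D (intVec k - p (intVec k)) (e j) : Matrix (Fin N) (Fin N) ℂ))).2
        ((Matrix.isUnit_iff_isUnit_det _).2 (isUnit_iff_ne_zero.2 hdet))
    have h2 : LinearIndepOn ℂ (frameFamily σ D (intVec k - p (intVec k))) b₂ := by
      have := h1.comp e.symm e.symm.injective
      have e1 : (fun j => frameFamily σ D (intVec k - p (intVec k)) (e j)) ∘ e.symm =
          fun x : b₂ => frameFamily σ D (intVec k - p (intVec k)) x := by
        ext x; simp
      rwa [e1] at this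
    have h3 := h2.mono hb₁₂
    have h4 : p (intVec k) ∈ Submodule.span ℂ (φ '' b₁) := by
      have : orbitSpan σ k ≤ Submodule.span ℂ (φ '' b₁) := by
        rw [hD, Submodule.span_le]
        rintro _ ⟨h, rfl⟩
        exact hspan₁ ⟨Sum.inl h, ⟨h, rfl⟩, rfl⟩
      exact this hmem
    rw [Finsupp.mem_span_image_iff_linearCombination] at h4
    obtain ⟨c, hc, hcp⟩ := h4
    rw [linearIndepOn_iff] at h3
    have h5 : Finsupp.linearCombination ℂ (frameFamily σ D (intVec k - p (intVec k))) c =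
        Finsupp.linearCombination ℂ φ c - p (Finsupp.linearCombination ℂ φ c) := by
      rw [Finsupp.linearCombination_apply, Finsupp.linearCombination_apply, Finsupp.sum,
        Finsupp.sum, map_sum, ← Finset.sum_sub_distrib]
      refine Finset.sum_congr rfl fun x hx => ?_
      obtain ⟨h, rfl⟩ := hb₁ (hc hx)
      have := congrArg (fun T : Module.End ℂ (Fin N → ℂ) => T (intVec k)) (hp h).eq
      simp only [Module.End.mul_apply] at this
      simp only [hφ, frameFamily, Sum.elim_inl, map_sub, map_smul, this, smul_sub]
    have h6 := h3 c hc (by rw [h5, hcp, hidem, sub_self])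
    rw [h6, map_zero] at hcp
    exact hne hcp.symm

/-- All entries are integers, so a nonzero determinant has absolute value at least one. -/
theorem one_le_norm_det_frame (σ : H →* GL (Fin N) ℤ) {D : Finset H} {k : Fin N → ℤ}
    {s : Fin N → D ⊕ Fin N}
    (h : Matrix.det (fun j => frameFamily σ D (intVec k) (s j)) ≠ 0) :
    1 ≤ ‖Matrix.det (fun j => frameFamily σ D (intVec k) (s j))‖ := by
  classical
  set M : Matrix (Fin N) (Fin N) ℤ := fun j =>
    Sum.elim (fun h : D => latticeAct σ h k) (fun j => Pi.single j 1) (s j) with hM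
  have hmap : (fun j => frameFamily σ D (intVec k) (s j) : Matrix (Fin N) (Fin N) ℂ) =
      (Int.castRingHom ℂ).mapMatrix M := by
    ext i j
    change frameFamily σ D (intVec k) (s i) j = ((M i j : ℤ) : ℂ)
    simp only [hM, frameFamily]
    cases s i with
    | inl h => simp [complexRep_intVec, intVec]
    | inr l => by_cases hjl : j = l <;> simp [hjl]
  rw [hmap, ← RingHom.map_det] at h ⊢
  have h1 : M.det ≠ 0 := fun h0 => h (by rw [h0, map_zero])
  rw [eq_intCast, Complex.norm_intCast]
  exact_mod_cast Int.one_le_abs h1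

theorem exists_rep_bound (σ : H →* GL (Fin N) ℤ) (h : H) :
    ∃ C : ℝ, 1 ≤ C ∧ ∀ v, ‖complexRep σ h v‖ ≤ C * ‖v‖ := by
  refine ⟨1 + ‖LinearMap.toContinuousLinearMap (complexRep σ h)‖, ?_, fun v => ?_⟩
  · linarith [norm_nonneg (LinearMap.toContinuousLinearMap (complexRep σ h))]
  · have := (LinearMap.toContinuousLinearMap (complexRep σ h)).le_opNorm v
    rw [LinearMap.coe_toContinuousLinearMap'] at this
    linarith [norm_nonneg v]

theorem exists_end_bound (p : Module.End ℂ (Fin N → ℂ)) :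
    ∃ C : ℝ, 1 ≤ C ∧ ∀ v, ‖p v‖ ≤ C * ‖v‖ := by
  refine ⟨1 + ‖LinearMap.toContinuousLinearMap p‖, ?_, fun v => ?_⟩
  · linarith [norm_nonneg (LinearMap.toContinuousLinearMap p)]
  · have := (LinearMap.toContinuousLinearMap p).le_opNorm v
    rw [LinearMap.coe_toContinuousLinearMap'] at this
    linarith [norm_nonneg v]

/-- A nonzero component of an integer vector along an invariant projection is polynomially bounded
from below. -/
theorem exists_component_lower_bound (σ : H →* GL (Fin N) ℤ) {p : Module.End ℂ (Fin N → ℂ)}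
    (hp : ∀ h, Commute p (complexRep σ h)) (hidem : ∀ v, p (p v) = p v)
    (hmem : ∀ k, p (intVec k) ∈ orbitSpan σ k) :
    ∃ C : ℝ, 1 ≤ C ∧ ∀ k : Fin N → ℤ, p (intVec k) ≠ 0 → 1 ≤ C * ‖k‖ ^ N * ‖p (intVec k)‖ := by
  classical
  obtain ⟨D, hD⟩ := exists_finite_spanning σ
  obtain ⟨A, hA, hdet⟩ := (Matrix.detRowAlternating (n := Fin N) (R := ℂ)).exists_bound_of_continuous
    (Continuous.matrix_det (A := fun M : Matrix (Fin N) (Fin N) ℂ => M) continuous_id)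
  obtain ⟨B, hB, hBD⟩ : ∃ B : ℝ, 1 ≤ B ∧ ∀ h : D, ∀ v, ‖complexRep σ h v‖ ≤ B * ‖v‖ :=
    WeightSystem.exists_bound_finite (P := fun (h : D) B => ∀ v, ‖complexRep σ h v‖ ≤ B * ‖v‖)
      (fun i C D hCD h v => (h v).trans (by gcongr)) fun h => exists_rep_bound σ h
  obtain ⟨E, hE, hpE⟩ := exists_end_bound p
  refine ⟨1 + A * N * (B * (1 + E)) ^ N * B, ?_, fun k hk => ?_⟩
  · have : 0 ≤ A * N * (B * (1 + E)) ^ N * B := by positivity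
    linarith
  obtain ⟨s, hs1, hs2⟩ := exists_frame σ (hD k) hp hidem (hmem k) hk
  have hk0 : k ≠ 0 := by
    rintro rfl
    exact hk (by
      have : intVec (0 : Fin N → ℤ) = 0 := by ext; simp [intVec]
      rw [this, map_zero])
  have hk1 := one_le_norm_of_ne_zero hk0
  have h1 := one_le_norm_det_frame σ hs1
  set m₁ : Fin N → Fin N → ℂ := fun j => frameFamily σ D (intVec k) (s j) with hm₁
  set m₂ : Fin N → Fin N → ℂ := fun j => frameFamily σ D (intVec k - p (intVec k)) (s j) with hm₂
  -- The first determinant is at least one and the second is zero. The Lipschitz estimate for the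
  -- determinant turns this gap into a lower bound for the distance of the two frames, which is at
  -- most a constant times `‖p k‖`.
  have h2 := (Matrix.detRowAlternating (n := Fin N) (R := ℂ)).norm_image_sub_le_of_bound hA.le
    hdet m₁ m₂
  have h3 : ‖(Matrix.detRowAlternating (n := Fin N) (R := ℂ)) m₁ -
      (Matrix.detRowAlternating (n := Fin N) (R := ℂ)) m₂‖ = ‖Matrix.det m₁‖ := by
    change ‖Matrix.det m₁ - Matrix.det m₂‖ = _
    rw [hs2, sub_zero]
  rw [h3] at h2
  have hbound : ∀ u : Fin N → ℂ, ‖u‖ ≤ (1 + E) * ‖k‖ →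
      ‖(fun j => frameFamily σ D u (s j) : Fin N → Fin N → ℂ)‖ ≤ B * (1 + E) * ‖k‖ := by
    intro u hu
    refine (pi_norm_le_iff_of_nonneg (by positivity)).2 fun j => ?_
    simp only [frameFamily]
    cases s j with
    | inl h =>
      simp only [Sum.elim_inl]
      refine (hBD h u).trans ?_
      rw [mul_assoc]
      gcongr
    | inr l =>
      simp only [Sum.elim_inr]
      have h5 : ‖(Pi.single l (1 : ℂ) : Fin N → ℂ)‖ ≤ 1 := by
        refine (pi_norm_le_iff_of_nonneg zero_le_one).2 fun i => ?_
        by_cases hil : i = l <;> simp [hil]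
      refine h5.trans ?_
      have : 1 ≤ B * (1 + E) := by nlinarith
      nlinarith
  have hb1 : ‖m₁‖ ≤ B * (1 + E) * ‖k‖ := hbound _ (by
    rw [norm_intVec]; nlinarith [norm_nonneg k])
  have hb2 : ‖m₂‖ ≤ B * (1 + E) * ‖k‖ := hbound _ (by
    refine (norm_sub_le _ _).trans ?_
    have := hpE (intVec k)
    rw [norm_intVec] at *
    linarith)
  have hb3 : ‖m₁ - m₂‖ ≤ B * ‖p (intVec k)‖ := by
    refine (pi_norm_le_iff_of_nonneg (by positivity)).2 fun j => ?_
    simp only [hm₁, hm₂, Pi.sub_apply, frameFamily]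
    cases s j with
    | inl h =>
      simp only [Sum.elim_inl, map_sub, sub_sub_cancel]
      exact hBD h _
    | inr l => simp; positivity
  have hbk : 1 ≤ B * (1 + E) * ‖k‖ := by
    have : 1 ≤ B * (1 + E) := by nlinarith
    nlinarith
  calc (1 : ℝ) ≤ A * Fintype.card (Fin N) * max ‖m₁‖ ‖m₂‖ ^ (Fintype.card (Fin N) - 1) *
        ‖m₁ - m₂‖ := h1.trans h2
    _ ≤ A * N * (B * (1 + E) * ‖k‖) ^ N * (B * ‖p (intVec k)‖) := by
        rw [Fintype.card_fin]
        gcongr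
        calc max ‖m₁‖ ‖m₂‖ ^ (N - 1) ≤ (B * (1 + E) * ‖k‖) ^ (N - 1) := by
              gcongr; exact max_le hb1 hb2
          _ ≤ (B * (1 + E) * ‖k‖) ^ N := pow_le_pow_right₀ hbk (Nat.sub_le _ _)
    _ = A * N * (B * (1 + E)) ^ N * B * ‖k‖ ^ N * ‖p (intVec k)‖ := by rw [mul_pow]; ring
    _ ≤ (1 + A * N * (B * (1 + E)) ^ N * B) * ‖k‖ ^ N * ‖p (intVec k)‖ := by
        gcongr; linarith

end Diophantine

/-! ### Finiteness of bounded eigenvalue sets, by integrality. -/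

section EigenvalueFiniteness

variable {N : ℕ} {H : Type*} [Group H]

/-- The lattice spanned by the orbit of an integer vector. -/
def orbitLattice (σ : H →* GL (Fin N) ℤ) (k : Fin N → ℤ) : Submodule ℤ (Fin N → ℤ) :=
  Submodule.span ℤ (Set.range fun h => latticeAct σ h k)

theorem orbitLattice_invariant (σ : H →* GL (Fin N) ℤ) (k : Fin N → ℤ) (h : H) :
    ∀ v ∈ orbitLattice σ k, (σ h).val.mulVecLin v ∈ orbitLattice σ k := by
  intro v hv
  have : orbitLattice σ k ≤ (orbitLattice σ k).comap (σ h).val.mulVecLin := by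
    refine Submodule.span_le.2 ?_
    rintro _ ⟨x, rfl⟩
    refine Submodule.subset_span ⟨h * x, ?_⟩
    simp [latticeAct_mul]; rfl
  exact this hv

/-- The action on the lattice spanned by an orbit. -/
noncomputable def orbitLatticeAct (σ : H →* GL (Fin N) ℤ) (k : Fin N → ℤ) (h : H) :
    Module.End ℤ (orbitLattice σ k) :=
  (σ h).val.mulVecLin.restrict (orbitLattice_invariant σ k h)

theorem intVec_add (k l : Fin N → ℤ) : intVec (k + l) = intVec k + intVec l := by
  ext; simp [intVec]

theorem intVec_smul (a : ℤ) (k : Fin N → ℤ) : intVec (a • k) = (a : ℂ) • intVec k := by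
  ext; simp [intVec]

theorem intVec_zero : intVec (0 : Fin N → ℤ) = 0 := by
  ext; simp [intVec]

theorem intVec_sum {ι : Type*} (s : Finset ι) (f : ι → Fin N → ℤ) :
    intVec (∑ i ∈ s, f i) = ∑ i ∈ s, intVec (f i) := by
  ext; simp [intVec]

theorem intVec_lattice_mem_orbitSpan (σ : H →* GL (Fin N) ℤ) (k : Fin N → ℤ)
    {v : Fin N → ℤ} (hv : v ∈ orbitLattice σ k) : intVec v ∈ orbitSpan σ k := by
  induction hv using Submodule.span_induction with
  | mem x hx =>
    obtain ⟨h, rfl⟩ := hx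
    exact Submodule.subset_span ⟨h, complexRep_intVec σ h k⟩
  | zero => rw [intVec_zero]; exact Submodule.zero_mem _
  | add x y _ _ hx hy => rw [intVec_add]; exact Submodule.add_mem _ hx hy
  | smul a x _ hx => rw [intVec_smul]; exact Submodule.smul_mem _ _ hx

theorem aeval_orbitLatticeAct (σ : H →* GL (Fin N) ℤ) (k : Fin N → ℤ) (h : H)
    (p : Polynomial ℤ) (v : orbitLattice σ k) :
    intVec (Polynomial.aeval (orbitLatticeAct σ k h) p v : orbitLattice σ k) =
      Polynomial.aeval (complexRep σ h) (p.map (Int.castRingHom ℂ)) (intVec v) := by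
  induction p using Polynomial.induction_on' with
  | add p q hp hq =>
    rw [map_add, Polynomial.map_add, map_add, LinearMap.add_apply, LinearMap.add_apply,
      Submodule.coe_add, intVec_add, hp, hq]
  | monomial n a =>
    rw [Polynomial.map_monomial, Polynomial.aeval_monomial, Polynomial.aeval_monomial,
      Module.End.mul_apply, Module.End.mul_apply, Module.algebraMap_end_apply,
      Module.algebraMap_end_apply, Submodule.coe_smul, intVec_smul, eq_intCast]
    congr 1
    induction n generalizing v with
    | zero => simp
    | succ n ih =>
      rw [pow_succ, pow_succ, Module.End.mul_apply, Module.End.mul_apply, ih]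
      congr 1
      rw [complexRep_intVec]
      rfl

/-- Cayley–Hamilton on the orbit lattice kills the integer orbit vectors, hence their complex span.
-/
theorem isRoot_charpoly_of_eigenvector (σ : H →* GL (Fin N) ℤ) (k : Fin N → ℤ) (h : H) {μ : ℂ}
    {v : Fin N → ℂ} (hv : v ∈ orbitSpan σ k) (hv0 : v ≠ 0) (hμ : complexRep σ h v = μ • v) :
    ((orbitLatticeAct σ k h).charpoly.map (Int.castRingHom ℂ)).IsRoot μ := by
  have hkill : ∀ w ∈ orbitSpan σ k, Polynomial.aeval (complexRep σ h)
      ((orbitLatticeAct σ k h).charpoly.map (Int.castRingHom ℂ)) w = 0 := by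
    intro w hw
    have : orbitSpan σ k ≤ LinearMap.ker (Polynomial.aeval (complexRep σ h)
      ((orbitLatticeAct σ k h).charpoly.map (Int.castRingHom ℂ))) := by
      refine Submodule.span_le.2 ?_
      rintro _ ⟨x, rfl⟩
      have h1 := aeval_orbitLatticeAct σ k h (orbitLatticeAct σ k h).charpoly
        ⟨latticeAct σ x k, Submodule.subset_span ⟨x, rfl⟩⟩
      rw [LinearMap.aeval_self_charpoly] at h1
      simp only [SetLike.mem_coe, LinearMap.mem_ker, complexRep_intVec]
      rw [← h1]
      simp [intVec_zero]
    exact this hw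
  have := hkill v hv
  rw [aeval_apply_eigenvector hμ] at this
  exact (smul_eq_zero.1 this).resolve_right hv0

theorem linearIndependent_intVec {ι : Type*} {f : ι → Fin N → ℤ} (hf : LinearIndependent ℤ f) :
    LinearIndependent ℂ fun i => intVec (f i) := by
  have := (linearIndependent_algebraMap_comp_iff (R := ℤ) (S := ℂ) (v := f)).2 hf
  have e : (fun i => intVec (f i)) = fun i => algebraMap ℤ ℂ ∘ f i := by
    ext i j; simp [intVec]
  rw [e]
  exact this

/-- An integral basis of the orbit lattice stays independent over `ℂ`, so a null vector of the
characteristic matrix gives an eigenvector in the orbit span. Thus a bound on eigenvalues there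
bounds all roots of an integer polynomial. -/
theorem exists_eigenvector_of_isRoot (σ : H →* GL (Fin N) ℤ) (k : Fin N → ℤ) (h : H) {μ : ℂ}
    (hμ : ((orbitLatticeAct σ k h).charpoly.map (Int.castRingHom ℂ)).IsRoot μ) :
    ∃ v ∈ orbitSpan σ k, v ≠ 0 ∧ complexRep σ h v = μ • v := by
  classical
  set f := Module.Free.chooseBasis ℤ (orbitLattice σ k) with hf
  set B := LinearMap.toMatrix f f (orbitLatticeAct σ k h) with hB
  have h1 : (orbitLatticeAct σ k h).charpoly = B.charpoly :=
    (LinearMap.charpoly_toMatrix (orbitLatticeAct σ k h) f).symm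
  rw [h1, ← Matrix.charpoly_map, Polynomial.IsRoot.def, Matrix.eval_charpoly] at hμ
  obtain ⟨y, hy0, hy⟩ := Matrix.exists_mulVec_eq_zero_iff.2 hμ
  have hli : LinearIndependent ℂ fun i => intVec (f i : Fin N → ℤ) := by
    exact linearIndependent_intVec
      (f.linearIndependent.map' (orbitLattice σ k).subtype (Submodule.ker_subtype _))
  have hBf : ∀ i, latticeAct σ h (f i) = ∑ j, B j i • (f j : Fin N → ℤ) := by
    intro i
    have h4 : (orbitLatticeAct σ k h (f i)) = ∑ j, B j i • f j := by
      rw [← f.sum_repr (orbitLatticeAct σ k h (f i))]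
      refine Finset.sum_congr rfl fun j _ => ?_
      rw [hB, LinearMap.toMatrix_apply]
    have h5 : latticeAct σ h (f i) = (orbitLatticeAct σ k h (f i) : orbitLattice σ k) := rfl
    rw [h5, h4]
    simp
  refine ⟨∑ i, y i • intVec (f i : Fin N → ℤ), ?_, ?_, ?_⟩
  · exact Submodule.sum_mem _ fun i _ => Submodule.smul_mem _ _
      (intVec_lattice_mem_orbitSpan σ k (f i).2)
  · intro h0
    exact hy0 (funext (Fintype.linearIndependent_iff.1 hli y h0))
  · have h6 : ∀ j, ∑ i, (B j i : ℂ) * y i = μ * y j := by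
      intro j
      have := congrFun hy j
      rw [Matrix.sub_mulVec, Pi.sub_apply, Pi.zero_apply, sub_eq_zero] at this
      simpa [Matrix.mulVec, dotProduct, Matrix.scalar_apply, Matrix.diagonal_apply] using this.symm
    rw [map_sum, Finset.smul_sum]
    simp only [map_smul, complexRep_intVec, hBf, intVec_sum, intVec_smul, Finset.smul_sum,
      smul_smul]
    rw [Finset.sum_comm]
    refine Finset.sum_congr rfl fun j _ => ?_
    rw [← Finset.sum_smul, ← h6 j]
    congr 1
    exact Finset.sum_congr rfl fun i _ => mul_comm _ _

/-- The eigenvalues on the span of an orbit of those elements whose eigenvalues there are bounded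
by `R` form a finite set. -/
theorem finite_eigenvalues (σ : H →* GL (Fin N) ℤ) (k : Fin N → ℤ) (R : ℝ) :
    {μ : ℂ | ∃ h : H, (∀ (ν : ℂ), ∀ v ∈ orbitSpan σ k, v ≠ 0 → complexRep σ h v = ν • v → ‖ν‖ ≤ R) ∧
      ∃ v ∈ orbitSpan σ k, v ≠ 0 ∧ complexRep σ h v = μ • v}.Finite := by
  classical
  set d := Module.finrank ℤ (orbitLattice σ k) with hd
  -- This bounds the coefficients of a monic polynomial of degree `d` with roots of modulus at most
  -- `R`; only finitely many integer polynomials qualify.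
  set C : ℝ := max R 1 ^ d * ↑(d.choose (d / 2)) with hC
  refine (Polynomial.bUnion_roots_finite (Int.castRingHom ℂ) d
    (Set.finite_Icc (-⌈C⌉) ⌈C⌉)).subset ?_
  rintro μ ⟨h, hR, v, hv, hv0, hμ⟩
  have hmonic := (orbitLatticeAct σ k h).charpoly_monic
  have hdeg : (orbitLatticeAct σ k h).charpoly.natDegree = d :=
    (orbitLatticeAct σ k h).charpoly_natDegree
  refine Set.mem_biUnion (x := (orbitLatticeAct σ k h).charpoly) ⟨hdeg.le, fun i => ?_⟩ ?_
  · have h1 := Polynomial.coeff_bdd_of_roots_le (B := R) (Int.castRingHom ℂ) hmonic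
      (IsAlgClosed.splits _) hdeg.le (fun z hz => by
        obtain ⟨w, hw, hw0, hwz⟩ := exists_eigenvector_of_isRoot σ k h
          (Polynomial.isRoot_of_mem_roots hz)
        exact hR z w hw hw0 hwz) i
    rw [Polynomial.coeff_map, eq_intCast, Complex.norm_intCast] at h1
    have h2 : |(((orbitLatticeAct σ k h).charpoly.coeff i : ℤ) : ℝ)| ≤ ⌈C⌉ :=
      h1.trans (Int.le_ceil C)
    have h3 : |(orbitLatticeAct σ k h).charpoly.coeff i| ≤ ⌈C⌉ := by exact_mod_cast h2
    exact Set.mem_Icc.2 (abs_le.1 h3)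
  · rw [Finset.mem_coe, Multiset.mem_toFinset, Polynomial.mem_roots
      (hmonic.map (Int.castRingHom ℂ)).ne_zero]
    exact isRoot_charpoly_of_eigenvector σ k h hv hv0 hμ

end EigenvalueFiniteness

/-! ### The weights of an integer vector lie in no closed half-plane. -/

section Directions

variable {N : ℕ} {H : Type*} [Group H] {σ : H →* GL (Fin N) ℤ} {g b : H}

namespace WeightSystem

variable (S : WeightSystem (complexRep σ) g b)

theorem sum_proj_apply (v : Fin N → ℂ) : ∑ i, S.proj i v = v := by
  have := congrArg (fun T : Module.End ℂ (Fin N → ℂ) => T v) S.sum_proj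
  simpa [LinearMap.sum_apply] using this

theorem exists_proj_ne_zero {v : Fin N → ℂ} (hv : v ≠ 0) : ∃ i, S.proj i v ≠ 0 := by
  by_contra h
  push Not at h
  exact hv (by rw [← S.sum_proj_apply v]; exact Finset.sum_eq_zero fun i _ => h i)

theorem proj_eq_zero_of_mem_orbitSpan {k : Fin N → ℤ} {i : S.ι} (h : S.proj i (intVec k) = 0)
    {v : Fin N → ℂ} (hv : v ∈ orbitSpan σ k) : S.proj i v = 0 := by
  have : orbitSpan σ k ≤ LinearMap.ker (S.proj i) := by
    refine Submodule.span_le.2 ?_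
    rintro _ ⟨x, rfl⟩
    simp only [SetLike.mem_coe, LinearMap.mem_ker, S.proj_comm, h, map_zero]
  exact this hv

theorem proj_mem_orbitSpan (i : S.ι) {k : Fin N → ℤ} {v : Fin N → ℂ} (hv : v ∈ orbitSpan σ k) :
    S.proj i v ∈ orbitSpan σ k :=
  S.preserves i _ (fun h => orbitSpan_invariant σ k h) v hv

theorem exists_lower_bound : ∃ C : ℝ, 1 ≤ C ∧ ∀ i (k : Fin N → ℤ), S.proj i (intVec k) ≠ 0 →
    1 ≤ C * ‖k‖ ^ N * ‖S.proj i (intVec k)‖ :=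
  exists_bound_finite (P := fun i C => ∀ k : Fin N → ℤ, S.proj i (intVec k) ≠ 0 →
    1 ≤ C * ‖k‖ ^ N * ‖S.proj i (intVec k)‖)
    (fun i C D hCD h k hk => (h k hk).trans (by gcongr)) fun i =>
    exists_component_lower_bound σ (fun h => S.comm i h) (S.idem i)
      fun k => S.proj_mem_orbitSpan i (intVec_mem_orbitSpan σ k)

theorem norm_eigenvalue_orbitSpan {k : Fin N → ℤ} {v : Fin N → ℂ} (hv : v ∈ orbitSpan σ k)
    (hv0 : v ≠ 0) (j m : ℤ) (q : ℕ) {ν : ℂ} (h : complexRep σ ((g ^ j * b ^ m) ^ q) v = ν • v) :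
    ∃ i, S.proj i (intVec k) ≠ 0 ∧ ‖ν‖ = Real.exp (q * (j * S.α i + m * S.β i)) := by
  obtain ⟨i, hi⟩ := S.exists_proj_ne_zero hv0
  refine ⟨i, fun h0 => hi (S.proj_eq_zero_of_mem_orbitSpan h0 hv), ?_⟩
  refine S.eigen i j m q ν (S.proj i v) (S.idem i v) hi ?_
  rw [← S.proj_comm, h, map_smul]

theorem exists_eigenvalue_orbitSpan {k : Fin N → ℤ} {i : S.ι} (hi : S.proj i (intVec k) ≠ 0)
    (j m : ℤ) : ∃ v ∈ orbitSpan σ k, v ≠ 0 ∧ ∃ ν : ℂ, complexRep σ (g ^ j * b ^ m) v = ν • v ∧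
      ‖ν‖ = Real.exp (j * S.α i + m * S.β i) := by
  have hinv : ∀ v ∈ orbitSpan σ k ⊓ LinearMap.eqLocus (S.proj i) LinearMap.id,
      complexRep σ (g ^ j * b ^ m) v ∈
        orbitSpan σ k ⊓ LinearMap.eqLocus (S.proj i) LinearMap.id := by
    rintro v ⟨hv1, hv2⟩
    refine ⟨orbitSpan_invariant σ k _ v hv1, ?_⟩
    simp only [SetLike.mem_coe, LinearMap.mem_eqLocus, LinearMap.id_apply] at hv2 ⊢
    rw [S.proj_comm, hv2]
  have hne : orbitSpan σ k ⊓ LinearMap.eqLocus (S.proj i) LinearMap.id ≠ ⊥ := by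
    intro hb
    have : S.proj i (intVec k) ∈ orbitSpan σ k ⊓ LinearMap.eqLocus (S.proj i) LinearMap.id :=
      ⟨S.proj_mem_orbitSpan i (intVec_mem_orbitSpan σ k), S.idem i _⟩
    rw [hb] at this
    exact hi (by simpa using this)
  obtain ⟨v, hv, hv0, ν, hν⟩ := exists_eigenvector_of_invariant hinv hne
  refine ⟨v, hv.1, hv0, ν, hν, ?_⟩
  have := S.eigen i j m 1 ν v hv.2 hv0 (by simpa using hν)
  simpa using this

/-- Follows the orbit of `k` in a real direction `(s, t)`. Rounding the exponents costs only a
bounded factor. -/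
theorem exists_orbit_growth {k : Fin N → ℤ} (s t : ℝ) {ε : ℝ} (hε : 0 < ε) :
    ∃ K : ℝ, 1 ≤ K ∧ ∀ i (n : ℕ),
      ‖S.proj i (intVec (latticeAct σ (g ^ ⌊n * s⌋ * b ^ ⌊n * t⌋) k))‖ ≤
        K * Real.exp (n * (s * S.α i + t * S.β i) + n * (ε * (|s| + |t|))) *
          ‖S.proj i (intVec k)‖ := by
  obtain ⟨C₁, hC₁, h₁⟩ := S.exists_growth_left hε
  obtain ⟨C₂, hC₂, h₂⟩ := S.exists_growth_right hε
  refine exists_bound_finite (P := fun i K => ∀ n : ℕ,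
      ‖S.proj i (intVec (latticeAct σ (g ^ ⌊n * s⌋ * b ^ ⌊n * t⌋) k))‖ ≤
        K * Real.exp (n * (s * S.α i + t * S.β i) + n * (ε * (|s| + |t|))) *
          ‖S.proj i (intVec k)‖)
    (fun i C D hCD h n => (h n).trans (by gcongr)) fun i => ?_
  refine ⟨C₁ * C₂ * Real.exp (|S.α i| + |S.β i| + 2 * ε), ?_, fun n => ?_⟩
  · have h1 : 1 ≤ C₁ * C₂ := by nlinarith
    have h2 : 1 ≤ Real.exp (|S.α i| + |S.β i| + 2 * ε) := Real.one_le_exp (by positivity)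
    nlinarith
  set j := ⌊n * s⌋ with hj
  set m := ⌊n * t⌋ with hm
  have e1 : S.proj i (intVec (latticeAct σ (g ^ j * b ^ m) k)) =
      S.proj i (complexRep σ (g ^ j) (complexRep σ (b ^ m) (intVec k))) := by
    rw [latticeAct_mul, complexRep_intVec, complexRep_intVec]
  rw [e1]
  have hfl : ∀ (x a : ℝ), (⌊x⌋ : ℝ) * a + ε * |(⌊x⌋ : ℝ)| ≤ x * a + |a| + ε * (|x| + 1) := by
    intro x a
    have f1 := Int.floor_le x
    have f2 := Int.lt_floor_add_one x
    have f3 : |(⌊x⌋ : ℝ)| ≤ |x| + 1 := by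
      have : |(⌊x⌋ : ℝ) - x| ≤ 1 := by rw [abs_le]; constructor <;> linarith
      have := abs_add_le ((⌊x⌋ : ℝ) - x) x
      rw [sub_add_cancel] at this
      linarith
    have f4 : ((⌊x⌋ : ℝ) - x) * a ≤ |a| := by
      refine (le_abs_self _).trans ?_
      rw [abs_mul]
      have : |(⌊x⌋ : ℝ) - x| ≤ 1 := by rw [abs_le]; constructor <;> linarith
      nlinarith [abs_nonneg a]
    nlinarith
  have g1 := hfl (n * s) (S.α i)
  have g2 := hfl (n * t) (S.β i)
  rw [abs_mul, Nat.abs_cast] at g1 g2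
  calc _ ≤ C₁ * Real.exp (j * S.α i + ε * |(j : ℝ)|) * (C₂ * Real.exp (m * S.β i + ε * |(m : ℝ)|) *
        ‖S.proj i (intVec k)‖) := (h₁ i j _).trans (by gcongr; exact h₂ i m _)
    _ = C₁ * C₂ * Real.exp ((j * S.α i + ε * |(j : ℝ)|) + (m * S.β i + ε * |(m : ℝ)|)) *
        ‖S.proj i (intVec k)‖ := by rw [Real.exp_add (j * S.α i + ε * |(j : ℝ)|)]; ring
    _ ≤ C₁ * C₂ * Real.exp ((|S.α i| + |S.β i| + 2 * ε) +
          (n * (s * S.α i + t * S.β i) + n * (ε * (|s| + |t|)))) * ‖S.proj i (intVec k)‖ := by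
        refine mul_le_mul_of_nonneg_right (mul_le_mul_of_nonneg_left (Real.exp_le_exp.2 ?_)
          (by positivity)) (norm_nonneg _)
        rw [← hj] at g1
        rw [← hm] at g2
        linarith
    _ = _ := by rw [Real.exp_add (|S.α i| + |S.β i| + 2 * ε)]; ring

/-- If no component grows in the direction `(s, t)` and one decays exponentially, the integer
vectors along the orbit have almost bounded norm and an exponentially small nonzero component,
against the polynomial lower bound. -/
theorem weights_vanish_of_nonpos {k : Fin N → ℤ} {s t : ℝ}
    (h : ∀ i, S.proj i (intVec k) ≠ 0 → s * S.α i + t * S.β i ≤ 0) :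
    ∀ i, S.proj i (intVec k) ≠ 0 → s * S.α i + t * S.β i = 0 := by
  intro i₀ hi₀
  by_contra hne
  have hneg : s * S.α i₀ + t * S.β i₀ < 0 := lt_of_le_of_ne (h i₀ hi₀) hne
  set η := -(s * S.α i₀ + t * S.β i₀) with hη
  have hηpos : 0 < η := by linarith
  -- The loss `δ = ε (|s| + |t|)` occurs `N` times through the norm and once through the component,
  -- so `(N + 1) δ` must stay below half the decay rate `η`.
  set ε := η / (2 * (N + 1) * (|s| + |t| + 1)) with hε
  have hεpos : 0 < ε := by positivity
  obtain ⟨K, hK, hgr⟩ := S.exists_orbit_growth (k := k) s t hεpos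
  obtain ⟨C, hC, hlow⟩ := S.exists_lower_bound
  set δ := ε * (|s| + |t|) with hδ
  have hδ2 : (N + 1) * δ ≤ η / 2 := by
    rw [hδ, hε]
    have : (0 : ℝ) < N + 1 := by positivity
    have h2 : 0 < |s| + |t| + 1 := by positivity
    rw [show (N + 1 : ℝ) * (η / (2 * (N + 1) * (|s| + |t| + 1)) * (|s| + |t|)) =
      η / 2 * ((|s| + |t|) / (|s| + |t| + 1)) by field_simp]
    have : (|s| + |t|) / (|s| + |t| + 1) ≤ 1 := by rw [div_le_one h2]; linarith
    nlinarith
  set M : ℝ := 1 + ∑ i, K * ‖S.proj i (intVec k)‖ with hM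
  have hMi : ∀ i, K * ‖S.proj i (intVec k)‖ ≤ M := fun i => by
    have := Finset.single_le_sum (f := fun i => K * ‖S.proj i (intVec k)‖)
      (fun i _ => by positivity) (Finset.mem_univ i)
    linarith
  have hM1 : 1 ≤ M := by
    have : 0 ≤ ∑ i, K * ‖S.proj i (intVec k)‖ := Finset.sum_nonneg fun i _ => by positivity
    linarith
  obtain ⟨n, hn⟩ := exists_nat_gt (C * M ^ (N + 1) * (2 / η))
  set w := latticeAct σ (g ^ ⌊n * s⌋ * b ^ ⌊n * t⌋) k with hw
  have hwn : ‖w‖ ≤ M * Real.exp (n * δ) := by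
    rw [← norm_intVec, ← S.sum_proj_apply (intVec w)]
    refine (norm_sum_le _ _).trans ?_
    calc ∑ i, ‖S.proj i (intVec w)‖ ≤ ∑ i, K * ‖S.proj i (intVec k)‖ * Real.exp (n * δ) := by
          refine Finset.sum_le_sum fun i _ => ?_
          refine (hgr i n).trans ?_
          by_cases h0 : S.proj i (intVec k) = 0
          · simp [h0]
          · have := h i h0
            rw [mul_right_comm]
            gcongr
            have : (n : ℝ) * (s * S.α i + t * S.β i) ≤ 0 :=
              mul_nonpos_of_nonneg_of_nonpos (Nat.cast_nonneg n) this
            linarith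
      _ = (∑ i, K * ‖S.proj i (intVec k)‖) * Real.exp (n * δ) := by rw [Finset.sum_mul]
      _ ≤ M * Real.exp (n * δ) := by gcongr; linarith
  have hi₀w : S.proj i₀ (intVec w) ≠ 0 := by
    rw [hw, ← complexRep_intVec, S.proj_comm]
    exact rep_apply_ne_zero _ _ hi₀
  have h1 := hlow i₀ w hi₀w
  have h2 : ‖S.proj i₀ (intVec w)‖ ≤ M * Real.exp (-(n * η) + n * δ) := by
    refine (hgr i₀ n).trans ?_
    rw [mul_right_comm, show (n : ℝ) * (s * S.α i₀ + t * S.β i₀) = -(n * η) by rw [hη]; ring]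
    gcongr
    exact hMi i₀
  have h3 : (1 : ℝ) ≤ C * M ^ (N + 1) * Real.exp (-(n * (η / 2))) := by
    calc (1 : ℝ) ≤ C * ‖w‖ ^ N * ‖S.proj i₀ (intVec w)‖ := h1
      _ ≤ C * (M * Real.exp (n * δ)) ^ N * (M * Real.exp (-(n * η) + n * δ)) := by gcongr
      _ = C * M ^ (N + 1) * Real.exp (N * (n * δ) + (-(n * η) + n * δ)) := by
          rw [mul_pow, ← Real.exp_nat_mul, Real.exp_add (N * (n * δ))]; ring
      _ ≤ C * M ^ (N + 1) * Real.exp (-(n * (η / 2))) := by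
          gcongr
          have : (n : ℝ) * ((N + 1) * δ) ≤ n * (η / 2) := by gcongr
          linarith
  have h4 : C * M ^ (N + 1) < Real.exp (n * (η / 2)) := by
    have h5 := Real.add_one_le_exp (n * (η / 2))
    have h6 : C * M ^ (N + 1) < n * (η / 2) := by
      have := mul_lt_mul_of_pos_right hn (half_pos hηpos)
      rwa [mul_assoc, show 2 / η * (η / 2) = 1 by field_simp, mul_one] at this
    linarith
  rw [Real.exp_neg] at h3
  have h7 := mul_lt_mul_of_pos_right h4 (inv_pos.2 (Real.exp_pos (n * (η / 2))))
  rw [mul_inv_cancel₀ (Real.exp_pos _).ne'] at h7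
  linarith

/-- Weights on a line through the origin vanish at some nontrivial integer pair. -/
theorem exists_vanishing_pair (k : Fin N → ℤ) {s t : ℝ} (hst : (s, t) ≠ (0, 0))
    (h : ∀ i, S.proj i (intVec k) ≠ 0 → s * S.α i + t * S.β i = 0) :
    ∃ j m : ℤ, (j, m) ≠ (0, 0) ∧ ∀ i, S.proj i (intVec k) ≠ 0 → j * S.α i + m * S.β i = 0 := by
  classical
  by_cases hs : s = 0
  · have ht : t ≠ 0 := fun ht => hst (by rw [hs, ht])
    refine ⟨0, 1, by simp, fun i hi => ?_⟩
    have := h i hi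
    rw [hs, zero_mul, zero_add] at this
    simp [(mul_eq_zero.1 this).resolve_left ht]
  -- Integer points within bounded distance of the line spanned by `(s, t)`, on which all weights
  -- vanish. The moduli at these points stay bounded and so take finitely many values; two points
  -- with equal moduli differ by the required pair.
  set m : ℤ → ℤ := fun j => round (j * t / s) with hm
  set R : ℝ := Real.exp (∑ i, |S.β i|) with hR
  have hexp : ∀ (j : ℤ) i, S.proj i (intVec k) ≠ 0 →
      Real.exp (j * S.α i + m j * S.β i) ≤ R := by
    intro j i hi
    rw [hR, Real.exp_le_exp]
    have h1 : S.α i = -(t * S.β i) / s := by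
      rw [eq_div_iff hs]; linarith [h i hi]
    have h2 : (j : ℝ) * S.α i + m j * S.β i = -((j * t / s - m j) * S.β i) := by
      rw [h1]; field_simp; ring
    have h3 := abs_sub_round ((j : ℝ) * t / s)
    rw [h2]
    calc -(((j : ℝ) * t / s - m j) * S.β i) ≤ |(j : ℝ) * t / s - m j| * |S.β i| := by
          rw [← abs_mul]; exact neg_le_abs _
      _ ≤ 1 * |S.β i| := by gcongr; exact h3.trans (by norm_num)
      _ ≤ ∑ i, |S.β i| := by
          rw [one_mul]
          exact Finset.single_le_sum (f := fun i => |S.β i|) (fun i _ => abs_nonneg _)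
            (Finset.mem_univ i)
  have hfin := (finite_eigenvalues σ k R).image fun μ => ‖μ‖
  set F := (fun μ : ℂ => ‖μ‖) '' _ with hF
  have hmem : ∀ (j : ℤ) i, S.proj i (intVec k) ≠ 0 →
      Real.exp (j * S.α i + m j * S.β i) ∈ F := by
    intro j i hi
    obtain ⟨v, hv, hv0, ν, hν, hnorm⟩ := S.exists_eigenvalue_orbitSpan hi j (m j)
    refine ⟨ν, ⟨g ^ j * b ^ m j, fun ν' w hw hw0 hν' => ?_, v, hv, hv0, hν⟩, hnorm⟩
    obtain ⟨i', hi', hn⟩ := S.norm_eigenvalue_orbitSpan hw hw0 j (m j) 1 (by simpa using hν')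
    rw [hn]
    simpa using hexp j i' hi'
  set Φ : ℤ → S.ι → ℝ := fun j i =>
    if S.proj i (intVec k) = 0 then 0 else Real.exp (j * S.α i + m j * S.β i) with hΦ
  have hΦmem : ∀ j, Φ j ∈ Set.univ.pi fun _ : S.ι => insert 0 F := by
    intro j i _
    simp only [hΦ]
    split_ifs with h0
    · exact Set.mem_insert _ _
    · exact Set.mem_insert_of_mem _ (hmem j i h0)
  obtain ⟨j, -, j', -, hjj, hΦj⟩ := Set.Infinite.exists_ne_map_eq_of_mapsTo
    (Set.infinite_univ (α := ℤ)) (fun j _ => hΦmem j) (Set.Finite.pi fun _ => hfin.insert 0)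
  refine ⟨j - j', m j - m j', ?_, fun i hi => ?_⟩
  · intro h0
    exact hjj (sub_eq_zero.1 (Prod.ext_iff.1 h0).1)
  · have := congrFun hΦj i
    simp only [hΦ, if_neg hi] at this
    have := Real.exp_injective this
    push_cast
    linarith

/-- If all weights of an integer vector vanish at `g ^ j * b ^ m`, then a power of this element
fixes a nonzero integer vector. -/
theorem exists_periodic {k : Fin N → ℤ} (hk : k ≠ 0) {j m : ℤ}
    (h : ∀ i, S.proj i (intVec k) ≠ 0 → j * S.α i + m * S.β i = 0) :
    ∃ q : ℕ, 0 < q ∧ ∃ l : Fin N → ℤ, l ≠ 0 ∧ latticeAct σ ((g ^ j * b ^ m) ^ q) l = l := by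
  classical
  set w := g ^ j * b ^ m with hw
  obtain ⟨i, hi⟩ := S.exists_proj_ne_zero (intVec_ne_zero hk)
  obtain ⟨v, hv, hv0, ν, hν, hnorm⟩ := S.exists_eigenvalue_orbitSpan hi j m
  rw [h i hi, Real.exp_zero] at hnorm
  have hpow : ∀ q : ℕ, complexRep σ (w ^ q) v = ν ^ q • v := by
    intro q
    induction q with
    | zero => simp
    | succ q ih =>
      rw [pow_succ, map_mul, Module.End.mul_apply, hν, map_smul, ih, smul_smul, pow_succ, mul_comm]
  -- All eigenvalues of powers of `w` on the orbit span have modulus one, so the powers of `ν` lie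
  -- in a finite set and `ν` is a root of unity.
  have hmem : ∀ q : ℕ, ν ^ q ∈ {μ : ℂ | ∃ h : H, (∀ (ν : ℂ), ∀ v ∈ orbitSpan σ k, v ≠ 0 →
      complexRep σ h v = ν • v → ‖ν‖ ≤ 1) ∧
      ∃ v ∈ orbitSpan σ k, v ≠ 0 ∧ complexRep σ h v = μ • v} := by
    intro q
    refine ⟨w ^ q, fun ν' u hu hu0 hν' => ?_, v, hv, hv0, hpow q⟩
    obtain ⟨i', hi', hn⟩ := S.norm_eigenvalue_orbitSpan hu hu0 j m q hν'
    rw [hn, h i' hi']; simp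
  obtain ⟨q, -, q', -, hqq, hpq⟩ := Set.Infinite.exists_ne_map_eq_of_mapsTo
    (Set.infinite_univ (α := ℕ)) (fun q _ => hmem q) (finite_eigenvalues σ k 1)
  have hν0 : ν ≠ 0 := by
    rintro rfl
    simp at hnorm
  obtain ⟨p, hp, hνp⟩ : ∃ p : ℕ, 0 < p ∧ ν ^ p = 1 := by
    have aux : ∀ a b : ℕ, a < b → ν ^ a = ν ^ b → ∃ p : ℕ, 0 < p ∧ ν ^ p = 1 := by
      intro a b hab he
      refine ⟨b - a, Nat.sub_pos_of_lt hab, ?_⟩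
      have : ν ^ a * ν ^ (b - a) = ν ^ a * 1 := by
        rw [← pow_add, Nat.add_sub_cancel' hab.le, mul_one, he]
      exact mul_left_cancel₀ (pow_ne_zero _ hν0) this
    rcases lt_or_gt_of_ne hqq with hlt | hlt
    · exact aux _ _ hlt hpq
    · exact aux _ _ hlt hpq.symm
  refine ⟨p, hp, ?_⟩
  have hfix : complexRep σ (w ^ p) v = v := by rw [hpow, hνp, one_smul]
  -- Over the integers, a vanishing determinant converts the complex fixed vector into an integer
  -- one.
  have hdet : ((σ (w ^ p)).val - 1).det = 0 := by
    have h1 : (((σ (w ^ p)).val - 1).map (Int.castRingHom ℂ)).det = 0 := by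
      rw [← Matrix.exists_mulVec_eq_zero_iff]
      refine ⟨v, hv0, ?_⟩
      have h2 : ((σ (w ^ p)).val.map (Int.cast : ℤ → ℂ)).mulVec v = v := hfix
      have h3 : ((σ (w ^ p)).val - 1).map (Int.castRingHom ℂ) =
          (σ (w ^ p)).val.map (Int.cast : ℤ → ℂ) - 1 := by
        ext x y
        by_cases hxy : x = y <;> simp [hxy]
      rw [h3, Matrix.sub_mulVec, h2, Matrix.one_mulVec, sub_self]
    have h4 := RingHom.map_det (Int.castRingHom ℂ) ((σ (w ^ p)).val - 1)
    rw [RingHom.mapMatrix_apply, h1, eq_intCast] at h4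
    exact_mod_cast h4
  obtain ⟨l, hl0, hl⟩ := Matrix.exists_mulVec_eq_zero_iff.2 hdet
  refine ⟨l, hl0, ?_⟩
  rw [Matrix.sub_mulVec, Matrix.one_mulVec, sub_eq_zero] at hl
  exact hl

/-- The pair `g, b` has no nontrivial periodic integer vectors. -/
def _root_.NoPeriodicVectors (σ : H →* GL (Fin N) ℤ) (g b : H) : Prop :=
  ∀ j m : ℤ, (j, m) ≠ (0, 0) → ∀ q : ℕ, 0 < q → ∀ l : Fin N → ℤ, l ≠ 0 →
    latticeAct σ ((g ^ j * b ^ m) ^ q) l ≠ l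

theorem exists_positive_weight (hper : NoPeriodicVectors σ g b) {k : Fin N → ℤ} (hk : k ≠ 0)
    {s t : ℝ} (hst : (s, t) ≠ (0, 0)) :
    ∃ i, S.proj i (intVec k) ≠ 0 ∧ 0 < s * S.α i + t * S.β i := by
  by_contra hcon
  push Not at hcon
  obtain ⟨j, m, hjm, h⟩ := S.exists_vanishing_pair k hst (S.weights_vanish_of_nonpos hcon)
  obtain ⟨q, hq, l, hl, hfix⟩ := S.exists_periodic hk h
  exact hper j m hjm q hq l hl hfix

end WeightSystem

end Directions

/-! ### Positive combinations of weights with bounded coefficients. -/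

section ConicCombinations

/-- Planar vectors which are not contained in a closed half-plane positively generate the plane. -/
theorem exists_conic_combination {κ : Type*} [Fintype κ] (α β : κ → ℝ)
    (h : ∀ s t : ℝ, (s, t) ≠ (0, 0) → ∃ i, 0 < s * α i + t * β i) :
    ∃ B : ℝ, 1 ≤ B ∧ ∀ x y : ℝ, |x| ≤ 1 → |y| ≤ 1 → ∃ ν : κ → ℝ, (∀ i, 0 ≤ ν i) ∧
      ∑ i, ν i ≤ B ∧ ∑ i, ν i * α i = x ∧ ∑ i, ν i * β i = y := by
  classical
  -- `M` is continuous, positively homogeneous and positive off the origin, so `M p ≥ l ‖p‖` with `l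
  -- > 0` its minimum on the unit sphere.
  set M : ℝ × ℝ → ℝ := fun p => ∑ i, max 0 (p.1 * α i + p.2 * β i) with hM
  have hMcont : Continuous M := by fun_prop
  have hMpos : ∀ p : ℝ × ℝ, p ≠ 0 → 0 < M p := by
    rintro ⟨s, t⟩ hp
    obtain ⟨i, hi⟩ := h s t hp
    exact Finset.sum_pos' (fun i _ => le_max_left _ _) ⟨i, Finset.mem_univ i, lt_max_of_lt_right hi⟩
  have hne : (Metric.sphere (0 : ℝ × ℝ) 1).Nonempty := ⟨(1, 0), by simp [Prod.norm_def]⟩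
  obtain ⟨p₀, hp₀, hmin⟩ := (isCompact_sphere (0 : ℝ × ℝ) 1).exists_isMinOn hne hMcont.continuousOn
  set l := M p₀ with hl
  have hlpos : 0 < l := hMpos p₀ (by
    rintro rfl
    simp at hp₀)
  have hMl : ∀ p : ℝ × ℝ, l * ‖p‖ ≤ M p := by
    intro p
    by_cases hp : p = 0
    · rw [hp, norm_zero, mul_zero]; exact Finset.sum_nonneg fun i _ => le_max_left _ _
    have hpn : 0 < ‖p‖ := norm_pos_iff.2 hp
    have h1 : l ≤ M (‖p‖⁻¹ • p) := hmin (by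
      rw [mem_sphere_zero_iff_norm, norm_smul, norm_inv, norm_norm, inv_mul_cancel₀ hpn.ne'])
    have h2 : M (‖p‖⁻¹ • p) = ‖p‖⁻¹ * M p := by
      simp only [hM, Finset.mul_sum]
      refine Finset.sum_congr rfl fun i _ => ?_
      rw [mul_max_of_nonneg _ _ (inv_nonneg.2 hpn.le), mul_zero]
      congr 1
      simp only [Prod.smul_fst, Prod.smul_snd, smul_eq_mul]
      ring
    rw [h2, inv_mul_eq_div, le_div_iff₀ hpn] at h1
    exact h1
  set c : ℝ := (Fintype.card κ : ℝ) with hc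
  -- Small enough that `2 c η < l`: a functional separating `(η x, η y)` from the convex hull of the
  -- weights would have `M ≤ 2 c η ‖p‖`. Rescaling by `1 / η` produces the bound `B`.
  set η : ℝ := l / (2 * c + 1 + l) with hη
  have hc0 : 0 ≤ c := Nat.cast_nonneg _
  have hηpos : 0 < η := by positivity
  have hη1 : η ≤ 1 := by rw [hη, div_le_one (by positivity)]; linarith
  have hηl : 2 * c * η < l := by
    rw [hη, mul_div_assoc', div_lt_iff₀ (by positivity)]
    nlinarith
  refine ⟨1 / η, by rw [le_div_iff₀ hηpos]; linarith, fun x y hx hy => ?_⟩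
  let L : (κ → ℝ) →ₗ[ℝ] ℝ × ℝ := LinearMap.prod (∑ i, α i • LinearMap.proj i)
    (∑ i, β i • LinearMap.proj i)
  have hL : ∀ w, L w = (∑ i, w i * α i, ∑ i, w i * β i) := by
    intro w
    simp [L, mul_comm]
  have hLcont : Continuous L := L.continuous_of_finiteDimensional
  set K := L '' stdSimplex ℝ κ with hK
  have hKconv : Convex ℝ K := (convex_stdSimplex ℝ κ).linear_image L
  have hKclosed : IsClosed K := ((isCompact_stdSimplex ℝ κ).image hLcont).isClosed
  have hmem : ((η * x, η * y) : ℝ × ℝ) ∈ K := by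
    by_contra hnot
    obtain ⟨f, u, hfu, huf⟩ := geometric_hahn_banach_closed_point hKconv hKclosed hnot
    set s := f (1, 0) with hs
    set t := f (0, 1) with ht
    have hf : ∀ a b : ℝ, f (a, b) = s * a + t * b := by
      intro a b
      have : ((a, b) : ℝ × ℝ) = a • (1, 0) + b • (0, 1) := by simp
      rw [this, map_add, map_smul, map_smul, smul_eq_mul, smul_eq_mul]
      ring
    have hpi : ∀ i, s * α i + t * β i < s * (η * x) + t * (η * y) := by
      intro i
      have h1 := hfu (L (Pi.single i 1)) ⟨_, single_mem_stdSimplex ℝ i, rfl⟩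
      rw [hL] at h1
      simp only [Pi.single_apply, ite_mul, one_mul, zero_mul, Finset.sum_ite_eq',
        Finset.mem_univ, if_true, hf] at h1
      rw [hf] at huf
      linarith
    by_cases hst : (s, t) = (0, 0)
    · obtain ⟨i, -⟩ := h 1 0 (by simp)
      have := hpi i
      rw [Prod.mk.injEq] at hst
      rw [hst.1, hst.2] at this
      simp at this
    obtain ⟨i, hi⟩ := h s t hst
    set z := s * (η * x) + t * (η * y) with hz
    have hzpos : 0 < z := hi.trans (hpi i)
    have h1 : M (s, t) ≤ c * z := by
      calc M (s, t) ≤ ∑ _i : κ, z := Finset.sum_le_sum fun i _ => max_le hzpos.le (hpi i).le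
        _ = c * z := by rw [Finset.sum_const, Finset.card_univ, nsmul_eq_mul]
    have hnpos : 0 < ‖((s, t) : ℝ × ℝ)‖ := norm_pos_iff.2 hst
    have h2 : z ≤ 2 * η * ‖((s, t) : ℝ × ℝ)‖ := by
      have e1 : |s| ≤ ‖((s, t) : ℝ × ℝ)‖ := norm_fst_le (s, t)
      have e2 : |t| ≤ ‖((s, t) : ℝ × ℝ)‖ := norm_snd_le (s, t)
      have e3 : s * x ≤ |s| := by
        refine (le_abs_self _).trans ?_
        rw [abs_mul]; nlinarith [abs_nonneg s]
      have e4 : t * y ≤ |t| := by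
        refine (le_abs_self _).trans ?_
        rw [abs_mul]; nlinarith [abs_nonneg t]
      have : z = η * (s * x + t * y) := by rw [hz]; ring
      rw [this]
      nlinarith
    have h3 := hMl (s, t)
    nlinarith
  obtain ⟨w, hw, hwz⟩ := hmem
  rw [hL, Prod.mk.injEq] at hwz
  refine ⟨fun i => w i / η, fun i => div_nonneg (hw.1 i) hηpos.le, ?_, ?_, ?_⟩
  · rw [← Finset.sum_div, hw.2]
  · simp only [div_mul_eq_mul_div, ← Finset.sum_div, hwz.1]
    field_simp
  · simp only [div_mul_eq_mul_div, ← Finset.sum_div, hwz.2]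
    field_simp

variable {N : ℕ} {H : Type*} [Group H] {σ : H →* GL (Fin N) ℤ} {g b : H}

/-- Nonnegative exponents supported on the weights of an integer vector, with prescribed drift
along `g` and `b`. -/
theorem WeightSystem.exists_exponents (S : WeightSystem (complexRep σ) g b)
    (hper : NoPeriodicVectors σ g b) :
    ∃ B : ℝ, 1 ≤ B ∧ ∀ k : Fin N → ℤ, k ≠ 0 → ∀ x y : ℝ, |x| ≤ 1 → |y| ≤ 1 →
      ∃ ν : S.ι → ℝ, (∀ i, 0 ≤ ν i) ∧ (∀ i, ν i ≠ 0 → S.proj i (intVec k) ≠ 0) ∧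
        ∑ i, ν i ≤ B ∧ ∑ i, ν i * S.α i = x ∧ ∑ i, ν i * S.β i = y := by
  classical
  -- Only the set of weights present in `k` matters; there are finitely many such sets, so `B` is
  -- uniform in `k`.
  obtain ⟨B, hB, h⟩ := WeightSystem.exists_bound_finite (ι := Finset S.ι) (P := fun X C =>
    (∀ s t : ℝ, (s, t) ≠ (0, 0) → ∃ i : X, 0 < s * S.α i + t * S.β i) →
    ∀ x y : ℝ, |x| ≤ 1 → |y| ≤ 1 → ∃ ν : X → ℝ, (∀ i, 0 ≤ ν i) ∧
      ∑ i, ν i ≤ C ∧ ∑ i, ν i * S.α i = x ∧ ∑ i, ν i * S.β i = y)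
    (fun X C D hCD h hX x y hx hy => by
      obtain ⟨ν, h1, h2, h3⟩ := h hX x y hx hy
      exact ⟨ν, h1, h2.trans hCD, h3⟩)
    (fun X => by
      by_cases hX : ∀ s t : ℝ, (s, t) ≠ (0, 0) → ∃ i : X, 0 < s * S.α i + t * S.β i
      · obtain ⟨B, hB, h⟩ := exists_conic_combination (fun i : X => S.α i) (fun i : X => S.β i) hX
        exact ⟨B, hB, fun _ => h⟩
      · exact ⟨1, le_rfl, fun h => absurd h hX⟩)
  refine ⟨B, hB, fun k hk x y hx hy => ?_⟩
  set X : Finset S.ι := Finset.univ.filter fun i => S.proj i (intVec k) ≠ 0 with hX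
  obtain ⟨ν, h1, h2, h3, h4⟩ := h X (fun s t hst => by
    obtain ⟨i, hi, hpos⟩ := S.exists_positive_weight hper hk hst
    exact ⟨⟨i, by simpa [hX] using hi⟩, hpos⟩) x y hx hy
  have key : ∀ f : S.ι → ℝ, ∑ i, (if hi : i ∈ X then ν ⟨i, hi⟩ else 0) * f i =
      ∑ i : X, ν i * f i := by
    intro f
    have e1 : ∑ i : X, ν i * f i =
        ∑ i ∈ X, (if hi : i ∈ X then ν ⟨i, hi⟩ else 0) * f i := by
      rw [← Finset.sum_coe_sort X]
      refine Finset.sum_congr rfl fun i _ => ?_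
      rw [dif_pos i.2]
    rw [e1]
    refine (Finset.sum_subset (Finset.subset_univ X) fun i _ hi => ?_).symm
    rw [dif_neg hi, zero_mul]
  refine ⟨fun i => if hi : i ∈ X then ν ⟨i, hi⟩ else 0, fun i => ?_, fun i hi => ?_, ?_, ?_, ?_⟩
  · dsimp only
    split_ifs with hi
    · exact h1 _
    · exact le_rfl
  · by_contra h0
    have : i ∉ X := by simp [hX, h0]
    exact hi (dif_neg this)
  · have := key fun _ => 1
    simp only [mul_one] at this
    rw [this]; exact h2
  · rw [key]; exact h3
  · rw [key]; exact h4

end ConicCombinations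

/-! ### Majorants built from weight components, and their decay along orbits. -/

section Majorants

variable {N : ℕ} {H : Type*} [Group H] {σ : H →* GL (Fin N) ℤ} {g b : H}

namespace WeightSystem

variable (S : WeightSystem (complexRep σ) g b)

/-- The product of powers of the weight components of an integer vector. -/
noncomputable def majorant (r : S.ι → ℝ) (k : Fin N → ℤ) : ℝ :=
  ∏ i, ‖S.proj i (intVec k)‖ ^ (-r i)

/-- Nonnegative exponents supported on the nonzero weight components of `k`. -/
def Admissible (r : S.ι → ℝ) (k : Fin N → ℤ) : Prop :=
  ∀ i, 0 ≤ r i ∧ (r i ≠ 0 → S.proj i (intVec k) ≠ 0)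

/-- The element `x` expands the component of weight `i` at the exponential rate `a i`. -/
def HasDrift (x : H) (a : S.ι → ℝ) : Prop :=
  ∀ ε : ℝ, 0 < ε → ∃ C : ℝ, 1 ≤ C ∧ ∀ i (n : ℕ) (v : Fin N → ℂ),
    ‖S.proj i v‖ ≤ C * Real.exp (-(n * a i) + ε * n) * ‖S.proj i (complexRep σ (x ^ n) v)‖

theorem majorant_nonneg (r : S.ι → ℝ) (k : Fin N → ℤ) : 0 ≤ S.majorant r k :=
  Finset.prod_nonneg fun _ _ => Real.rpow_nonneg (norm_nonneg _) _

variable {S}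

theorem proj_latticeAct_ne_zero {i : S.ι} {k : Fin N → ℤ} (h : H)
    (hi : S.proj i (intVec k) ≠ 0) : S.proj i (intVec (latticeAct σ h k)) ≠ 0 := by
  rw [← complexRep_intVec, S.proj_comm]
  exact rep_apply_ne_zero _ _ hi

theorem Admissible.act {r : S.ι → ℝ} {k : Fin N → ℤ} (hr : S.Admissible r k) (h : H) :
    S.Admissible r (latticeAct σ h k) :=
  fun i => ⟨(hr i).1, fun hi => proj_latticeAct_ne_zero h ((hr i).2 hi)⟩

theorem majorant_le_of_comparison {r : S.ι → ℝ} {k k' : Fin N → ℤ} (hr : S.Admissible r k)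
    {D : S.ι → ℝ} (hD : ∀ i, 0 < D i)
    (h : ∀ i, ‖S.proj i (intVec k)‖ ≤ D i * ‖S.proj i (intVec k')‖) :
    S.majorant r k' ≤ (∏ i, D i ^ r i) * S.majorant r k := by
  rw [majorant, majorant, ← Finset.prod_mul_distrib]
  refine Finset.prod_le_prod (fun _ _ => Real.rpow_nonneg (norm_nonneg _) _) fun i _ => ?_
  by_cases hi : r i = 0
  · simp [hi]
  have hpos : 0 < ‖S.proj i (intVec k)‖ := norm_pos_iff.2 ((hr i).2 hi)
  have hpos' : 0 < ‖S.proj i (intVec k')‖ := by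
    rcases (norm_nonneg (S.proj i (intVec k'))).eq_or_lt with h0 | h0
    · have := h i
      rw [← h0, mul_zero] at this
      exact absurd this (not_le.2 hpos)
    · exact h0
  have h1 : ‖S.proj i (intVec k)‖ ^ r i ≤ D i ^ r i * ‖S.proj i (intVec k')‖ ^ r i := by
    rw [← Real.mul_rpow (hD i).le hpos'.le]
    exact Real.rpow_le_rpow hpos.le (h i) (hr i).1
  rw [Real.rpow_neg hpos.le, Real.rpow_neg hpos'.le, ← div_eq_mul_inv, inv_eq_one_div,
    div_le_div_iff₀ (Real.rpow_pos_of_pos hpos' _) (Real.rpow_pos_of_pos hpos _), one_mul]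
  exact h1

theorem prod_const_rpow_le {C R : ℝ} (hC : 1 ≤ C) {r : S.ι → ℝ} (hR : ∑ i, r i ≤ R) :
    ∏ i, C ^ r i ≤ C ^ R := by
  rw [← Real.rpow_sum_of_pos (by linarith)]
  exact Real.rpow_le_rpow_of_exponent_le hC hR

theorem majorant_le_of_const {r : S.ι → ℝ} {k k' : Fin N → ℤ} (hr : S.Admissible r k)
    {D R : ℝ} (hD : 1 ≤ D) (hR : ∑ i, r i ≤ R)
    (h : ∀ i, ‖S.proj i (intVec k)‖ ≤ D * ‖S.proj i (intVec k')‖) :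
    S.majorant r k' ≤ D ^ R * S.majorant r k :=
  (majorant_le_of_comparison hr (fun _ => by linarith) h).trans
    (mul_le_mul_of_nonneg_right (prod_const_rpow_le hD hR) (S.majorant_nonneg r k))

theorem majorant_add {r s : S.ι → ℝ} {k : Fin N → ℤ} (hr : S.Admissible r k)
    (hs : S.Admissible s k) : S.majorant (r + s) k = S.majorant r k * S.majorant s k := by
  rw [majorant, majorant, majorant, ← Finset.prod_mul_distrib]
  refine Finset.prod_congr rfl fun i _ => ?_
  by_cases h : S.proj i (intVec k) = 0
  · have h1 : r i = 0 := by_contra fun h' => (hr i).2 h' h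
    have h2 : s i = 0 := by_contra fun h' => (hs i).2 h' h
    simp [h1, h2]
  · rw [Pi.add_apply, neg_add, Real.rpow_add (norm_pos_iff.2 h)]

variable (S)

theorem exists_proj_bound : ∃ C : ℝ, 1 ≤ C ∧ ∀ i v, ‖S.proj i v‖ ≤ C * ‖v‖ :=
  exists_bound_finite (P := fun i C => ∀ v, ‖S.proj i v‖ ≤ C * ‖v‖)
    (fun _ _ _ hCD h v => (h v).trans (mul_le_mul_of_nonneg_right hCD (norm_nonneg v)))
    (fun i => exists_end_bound (S.proj i))

theorem exists_proj_comparison (h : H) : ∃ C : ℝ, 1 ≤ C ∧ ∀ i v,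
    ‖S.proj i v‖ ≤ C * ‖S.proj i (complexRep σ h v)‖ := by
  obtain ⟨C, hC, hb⟩ := exists_rep_bound σ h⁻¹
  refine ⟨C, hC, fun i v => ?_⟩
  have := hb (S.proj i (complexRep σ h v))
  rwa [← S.proj_comm, rep_inv_apply] at this

theorem exists_majorant_act_le (h : H) (R : ℝ) : ∃ C : ℝ, 1 ≤ C ∧ ∀ (r : S.ι → ℝ) k,
    S.Admissible r k → ∑ i, r i ≤ R → S.majorant r (latticeAct σ h k) ≤ C * S.majorant r k := by
  obtain ⟨D, hD, hb⟩ := S.exists_proj_comparison h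
  refine ⟨D ^ max R 0, Real.one_le_rpow hD (le_max_right _ _), fun r k hr hR => ?_⟩
  refine majorant_le_of_const hr hD (hR.trans (le_max_left _ _)) fun i => ?_
  rw [← complexRep_intVec]
  exact hb i _

/-- The majorants are bounded below by a power of the norm. -/
theorem exists_rpow_le_majorant (R : ℝ) : ∃ C : ℝ, 1 ≤ C ∧ ∀ (r : S.ι → ℝ) k, k ≠ 0 →
    S.Admissible r k → ∑ i, r i ≤ R → ‖k‖ ^ (-R) ≤ C * S.majorant r k := by
  obtain ⟨D, hD, hb⟩ := S.exists_proj_bound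
  refine ⟨D ^ max R 0, Real.one_le_rpow hD (le_max_right _ _), fun r k hk hr hR => ?_⟩
  have hk1 := one_le_norm_of_ne_zero hk
  have hk0 : 0 < ‖k‖ := by linarith
  calc ‖k‖ ^ (-R) ≤ ‖k‖ ^ (∑ i, -r i) := by
        apply Real.rpow_le_rpow_of_exponent_le hk1
        rw [Finset.sum_neg_distrib]
        linarith
    _ = ∏ i, ‖k‖ ^ (-r i) := Real.rpow_sum_of_pos hk0 _ _
    _ ≤ ∏ i, D ^ r i * ‖S.proj i (intVec k)‖ ^ (-r i) := by
        refine Finset.prod_le_prod (fun i _ => by positivity) fun i _ => ?_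
        by_cases hi : r i = 0
        · simp [hi]
        have hpos : 0 < ‖S.proj i (intVec k)‖ := norm_pos_iff.2 ((hr i).2 hi)
        have h1 := hb i (intVec k)
        rw [norm_intVec] at h1
        have h2 := Real.rpow_le_rpow hpos.le h1 (hr i).1
        rw [Real.mul_rpow (by linarith) hk0.le] at h2
        rw [Real.rpow_neg hpos.le, Real.rpow_neg hk0.le, ← div_eq_mul_inv, inv_eq_one_div,
          div_le_div_iff₀ (Real.rpow_pos_of_pos hk0 _) (Real.rpow_pos_of_pos hpos _), one_mul]
        exact h2
    _ = (∏ i, D ^ r i) * S.majorant r k := by rw [Finset.prod_mul_distrib, majorant]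
    _ ≤ _ := mul_le_mul_of_nonneg_right (prod_const_rpow_le hD (hR.trans (le_max_left _ _)))
        (S.majorant_nonneg r k)

/-- The majorants are bounded above by a power of the norm. -/
theorem exists_majorant_le_rpow (R : ℝ) : ∃ C : ℝ, 1 ≤ C ∧ ∀ (r : S.ι → ℝ) k, k ≠ 0 →
    S.Admissible r k → ∑ i, r i ≤ R → S.majorant r k ≤ C * ‖k‖ ^ ((N : ℝ) * R) := by
  obtain ⟨D, hD, hb⟩ := S.exists_lower_bound
  refine ⟨D ^ max R 0, Real.one_le_rpow hD (le_max_right _ _), fun r k hk hr hR => ?_⟩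
  have hk1 := one_le_norm_of_ne_zero hk
  have hk0 : 0 < ‖k‖ := by linarith
  have hDk : 1 ≤ D * ‖k‖ ^ N := one_le_mul_of_one_le_of_one_le hD (one_le_pow₀ hk1)
  calc S.majorant r k ≤ ∏ i, (D * ‖k‖ ^ N) ^ r i := by
        refine Finset.prod_le_prod (fun _ _ => Real.rpow_nonneg (norm_nonneg _) _) fun i _ => ?_
        by_cases hi : r i = 0
        · simp [hi]
        have hne := (hr i).2 hi
        have hpos : 0 < ‖S.proj i (intVec k)‖ := norm_pos_iff.2 hne
        have h1 := hb i k hne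
        rw [Real.rpow_neg hpos.le, inv_eq_one_div, div_le_iff₀ (Real.rpow_pos_of_pos hpos _),
          ← Real.mul_rpow (by positivity) hpos.le]
        exact Real.one_le_rpow h1 (hr i).1
    _ ≤ (D * ‖k‖ ^ N) ^ R := prod_const_rpow_le hDk hR
    _ = D ^ R * ‖k‖ ^ ((N : ℝ) * R) := by
        rw [Real.mul_rpow (by linarith) (by positivity), Real.rpow_mul hk0.le, Real.rpow_natCast]
    _ ≤ _ := by
        gcongr
        exact le_max_left _ _

variable {S}

/-- The product of the component growths is `exp (n ∑ r_i a_i)` up to the loss `ε n ∑ r_i`; taking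
`ε = s / (2 R')` spends half of the drift. Conjugation by `d` costs a factor uniform in `n`. -/
theorem HasDrift.exists_majorant_le {x : H} {a : S.ι → ℝ} (hx : S.HasDrift x a) (d : H) (R : ℝ)
    {s : ℝ} (hs : 0 < s) : ∃ C : ℝ, 1 ≤ C ∧ ∀ (r : S.ι → ℝ) k, S.Admissible r k →
      ∑ i, r i ≤ R → s ≤ ∑ i, r i * a i → ∀ n : ℕ,
      S.majorant r (latticeAct σ (d⁻¹ * x ^ n * d) k) ≤
        C * Real.exp (-(s / 2) * n) * S.majorant r k := by
  set R' := max R 1 with hR'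
  have hR'1 : 1 ≤ R' := le_max_right _ _
  obtain ⟨C₀, hC₀, h₀⟩ := hx (s / (2 * R')) (by positivity)
  obtain ⟨C₁, hC₁, h₁⟩ := S.exists_majorant_act_le d⁻¹ R
  obtain ⟨C₂, hC₂, h₂⟩ := S.exists_majorant_act_le d R
  have hC₀R : 1 ≤ C₀ ^ R' := Real.one_le_rpow hC₀ (by linarith)
  refine ⟨C₁ * (C₀ ^ R' * C₂), one_le_mul_of_one_le_of_one_le hC₁
    (one_le_mul_of_one_le_of_one_le hC₀R hC₂), fun r k hr hR hra n => ?_⟩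
  have hRR : ∑ i, r i ≤ R' := hR.trans (le_max_left _ _)
  set k₁ := latticeAct σ d k with hk₁
  have hr₁ : S.Admissible r k₁ := hr.act d
  have key : S.majorant r (latticeAct σ (x ^ n) k₁) ≤
      C₀ ^ R' * Real.exp (-(s / 2) * n) * S.majorant r k₁ := by
    have := majorant_le_of_comparison hr₁ (k' := latticeAct σ (x ^ n) k₁)
      (D := fun i => C₀ * Real.exp (-(n * a i) + s / (2 * R') * n)) (fun i => by positivity)
      (fun i => by rw [← complexRep_intVec σ (x ^ n)]; exact h₀ i n _)
    refine this.trans (mul_le_mul_of_nonneg_right ?_ (S.majorant_nonneg _ _))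
    have e : ∀ i, (C₀ * Real.exp (-(n * a i) + s / (2 * R') * n)) ^ r i =
        C₀ ^ r i * Real.exp ((-(n * a i) + s / (2 * R') * n) * r i) := fun i => by
      rw [Real.mul_rpow (by linarith) (Real.exp_pos _).le, Real.exp_mul]
    rw [Finset.prod_congr rfl fun i _ => e i, Finset.prod_mul_distrib, ← Real.exp_sum]
    refine mul_le_mul (prod_const_rpow_le hC₀ hRR) ?_ (Real.exp_pos _).le (by positivity)
    apply Real.exp_le_exp.2
    have e2 : ∑ i, (-(n * a i) + s / (2 * R') * n) * r i =
        -(n * ∑ i, r i * a i) + s / (2 * R') * n * ∑ i, r i := by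
      rw [Finset.mul_sum, Finset.mul_sum, ← Finset.sum_neg_distrib, ← Finset.sum_add_distrib]
      exact Finset.sum_congr rfl fun i _ => by ring
    rw [e2]
    have hn : (0 : ℝ) ≤ n := Nat.cast_nonneg n
    have h3 : s / (2 * R') * n * ∑ i, r i ≤ s / (2 * R') * n * R' := by gcongr
    have h4 : s / (2 * R') * n * R' = s / 2 * n := by field_simp
    have h5 : n * s ≤ n * ∑ i, r i * a i := by gcongr
    linarith
  rw [mul_assoc, latticeAct_mul, latticeAct_mul]
  calc _ ≤ C₁ * S.majorant r (latticeAct σ (x ^ n) k₁) := h₁ _ _ (hr₁.act _) hR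
    _ ≤ C₁ * (C₀ ^ R' * Real.exp (-(s / 2) * n) * (C₂ * S.majorant r k)) := by
        gcongr
        exact key.trans (mul_le_mul_of_nonneg_left (h₂ _ _ hr hR) (by positivity))
    _ = _ := by ring

variable (S)

theorem hasDrift_of_zpow_bound {x : H} {a : S.ι → ℝ} (h : ∀ ε : ℝ, 0 < ε → ∃ C : ℝ, 1 ≤ C ∧
      ∀ i (n : ℤ) (v : Fin N → ℂ), ‖S.proj i (complexRep σ (x ^ n) v)‖ ≤
        C * Real.exp (n * a i + ε * |(n : ℝ)|) * ‖S.proj i v‖) :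
    S.HasDrift x a ∧ S.HasDrift x⁻¹ (-a) := by
  refine ⟨fun ε hε => ?_, fun ε hε => ?_⟩ <;> obtain ⟨C, hC, hb⟩ := h ε hε <;>
    refine ⟨C, hC, fun i n v => ?_⟩
  · have := hb i (-n) (complexRep σ (x ^ n) v)
    rw [_root_.zpow_neg, zpow_natCast, rep_inv_apply] at this
    simpa using this
  · have := hb i n (complexRep σ (x⁻¹ ^ n) v)
    rw [inv_pow, zpow_natCast, rep_apply_inv] at this
    simpa using this

theorem hasDrift_left : S.HasDrift g S.α := (S.hasDrift_of_zpow_bound fun _ h =>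
  S.exists_growth_left h).1

theorem hasDrift_left_inv : S.HasDrift g⁻¹ (-S.α) := (S.hasDrift_of_zpow_bound fun _ h =>
  S.exists_growth_left h).2

theorem hasDrift_right : S.HasDrift b S.β := (S.hasDrift_of_zpow_bound fun _ h =>
  S.exists_growth_right h).1

theorem hasDrift_right_inv : S.HasDrift b⁻¹ (-S.β) := (S.hasDrift_of_zpow_bound fun _ h =>
  S.exists_growth_right h).2

/-- Admissible exponents concentrated on the large weight components `θ`, with drift corrected by
`s₀ x` along `g` and `s₀ y` along `b`. The loss `s₁` does not depend on the order `t`. -/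
theorem exists_concentrated_exponents (hper : NoPeriodicVectors σ g b) {s₀ : ℝ} (hs₀ : 0 ≤ s₀) :
    ∃ s₁ : ℝ, 0 ≤ s₁ ∧ ∀ t c : ℝ, 0 ≤ t → 1 ≤ c → ∃ C : ℝ, 1 ≤ C ∧ ∀ k : Fin N → ℤ, k ≠ 0 →
      ∀ θ : S.ι → ℝ, (∀ i, 0 ≤ θ i) → ∑ i, θ i = 1 →
      (∀ i, θ i ≠ 0 → ‖k‖ ≤ c * ‖S.proj i (intVec k)‖) →
      ∀ x y : ℝ, |x| ≤ 1 → |y| ≤ 1 → ∃ r : S.ι → ℝ, S.Admissible r k ∧ ∑ i, r i ≤ t + s₁ ∧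
        (∃ t' : ℝ, 0 ≤ t' ∧ ∑ i, r i * S.α i = t' * (∑ i, θ i * S.α i) + s₀ * x ∧
          ∑ i, r i * S.β i = t' * (∑ i, θ i * S.β i) + s₀ * y) ∧
        S.majorant r k ≤ C * ‖k‖ ^ (-t) := by
  obtain ⟨B, hB, hν⟩ := S.exists_exponents hper
  obtain ⟨C₁, hC₁, h₁⟩ := S.exists_majorant_le_rpow (s₀ * B)
  have hs₀B : 0 ≤ s₀ * B := mul_nonneg hs₀ (by linarith)
  refine ⟨(N + 1) * (s₀ * B), by positivity, fun t₀ c ht₀ hc => ?_⟩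
  -- The correction `s₀ ν` can enlarge the majorant by `‖k‖ ^ (N s₀ B)`, through the lower bound on
  -- components; the order is raised beforehand by that amount.
  set t := t₀ + N * (s₀ * B) with ht'
  have ht : 0 ≤ t := by positivity
  refine ⟨c ^ t * C₁, one_le_mul_of_one_le_of_one_le (Real.one_le_rpow hc ht) hC₁,
    fun k hk θ hθ hθ1 hθc x y hx hy => ?_⟩
  obtain ⟨ν, hν0, hνk, hνB, hνα, hνβ⟩ := hν k hk x y hx hy
  have hk1 := one_le_norm_of_ne_zero hk
  have hk0 : 0 < ‖k‖ := by linarith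
  have hadm₁ : S.Admissible (t • θ) k := fun i => ⟨mul_nonneg ht (hθ i), fun hi h0 => by
    have := hθc i fun h => hi (by simp [h])
    rw [h0, norm_zero, mul_zero] at this
    linarith⟩
  have hadm₂ : S.Admissible (s₀ • ν) k := fun i => ⟨mul_nonneg hs₀ (hν0 i), fun hi =>
    hνk i fun h => hi (by simp [h])⟩
  refine ⟨t • θ + s₀ • ν, fun i => ⟨add_nonneg (hadm₁ i).1 (hadm₂ i).1, fun hi => ?_⟩, ?_,
    ⟨t, ht, ?_, ?_⟩, ?_⟩
  · by_cases h : (t • θ) i = 0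
    · exact (hadm₂ i).2 fun h' => hi (by simp only [Pi.add_apply, h, h', add_zero])
    · exact (hadm₁ i).2 h
  · simp only [Pi.add_apply, Pi.smul_apply, smul_eq_mul, Finset.sum_add_distrib, ← Finset.mul_sum,
      hθ1]
    have : s₀ * ∑ i, ν i ≤ s₀ * B := by gcongr
    linarith
  · simp only [Pi.add_apply, Pi.smul_apply, smul_eq_mul, add_mul, Finset.sum_add_distrib, mul_assoc,
      ← Finset.mul_sum, hνα]
  · simp only [Pi.add_apply, Pi.smul_apply, smul_eq_mul, add_mul, Finset.sum_add_distrib, mul_assoc,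
      ← Finset.mul_sum, hνβ]
  · rw [majorant_add hadm₁ hadm₂]
    have h2 : S.majorant (t • θ) k ≤ c ^ t * ‖k‖ ^ (-t) := by
      calc S.majorant (t • θ) k ≤ ∏ i, (c / ‖k‖) ^ (t * θ i) := by
            refine Finset.prod_le_prod (fun _ _ => Real.rpow_nonneg (norm_nonneg _) _)
              fun i _ => ?_
            by_cases hi : θ i = 0
            · simp [hi]
            have h3 := hθc i hi
            have hpos : 0 < ‖S.proj i (intVec k)‖ := by
              rcases (norm_nonneg (S.proj i (intVec k))).eq_or_lt with h0 | h0
              · rw [← h0] at h3; linarith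
              · exact h0
            rw [Pi.smul_apply, smul_eq_mul, Real.rpow_neg hpos.le, ← Real.inv_rpow hpos.le]
            refine Real.rpow_le_rpow (by positivity) ?_ (mul_nonneg ht (hθ i))
            rw [inv_eq_one_div, div_le_div_iff₀ hpos hk0, one_mul]
            exact h3
        _ = (c / ‖k‖) ^ t := by
            rw [← Real.rpow_sum_of_pos (by positivity), ← Finset.mul_sum, hθ1, mul_one]
        _ = _ := by rw [Real.div_rpow (by linarith) hk0.le, Real.rpow_neg hk0.le, div_eq_mul_inv]
    have h3 : S.majorant (s₀ • ν) k ≤ C₁ * ‖k‖ ^ ((N : ℝ) * (s₀ * B)) := by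
      refine h₁ _ k hk hadm₂ ?_
      simp only [Pi.smul_apply, smul_eq_mul, ← Finset.mul_sum]
      gcongr
    calc _ ≤ c ^ t * ‖k‖ ^ (-t) * (C₁ * ‖k‖ ^ ((N : ℝ) * (s₀ * B))) :=
          mul_le_mul h2 h3 (S.majorant_nonneg _ _) (by positivity)
      _ = c ^ t * C₁ * ‖k‖ ^ (-t + (N : ℝ) * (s₀ * B)) := by
          rw [Real.rpow_add hk0]; ring
      _ = _ := by rw [ht']; congr 2; ring

end WeightSystem

end Majorants

/-! ### Backward recursions and orbit sums. -/

section Recursion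

/-- The operator may expand by `Λ` at each step, but `c j` decays like `(2 Λ) ^ (-j)`, so the term
`Λ ^ j ‖c j‖` tends to zero. The rough constant `Z` therefore disappears from the conclusion. -/
theorem norm_le_of_backward_recursion {E : Type*} [SeminormedAddCommGroup E] {A : E → E}
    {Λ X Z : ℝ} (hΛ : 1 ≤ Λ) (hA : ∀ v, ‖A v‖ ≤ Λ * ‖v‖) {c n : ℕ → E}
    (h : ∀ j, c j = A (c (j + 1)) + n j) (hn : ∀ j, ‖n j‖ ≤ X * ((2 * Λ)⁻¹) ^ j)
    (hc : ∀ j, ‖c j‖ ≤ Z * ((2 * Λ)⁻¹) ^ j) : ‖c 0‖ ≤ 2 * X := by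
  have hΛ0 : 0 < Λ := by linarith
  have e : ∀ j : ℕ, Λ ^ j * ((2 * Λ)⁻¹) ^ j = (1 / 2) ^ j := fun j => by
    rw [← mul_pow]
    congr 1
    field_simp
  have key : ∀ j : ℕ, ‖c 0‖ ≤ 2 * X * (1 - (1 / 2) ^ j) + Λ ^ j * ‖c j‖ := by
    intro j
    induction j with
    | zero => simp
    | succ j ih =>
      have h1 : ‖c j‖ ≤ Λ * ‖c (j + 1)‖ + X * ((2 * Λ)⁻¹) ^ j := by
        rw [h j]
        exact (norm_add_le _ _).trans (add_le_add (hA _) (hn j))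
      have h2 := mul_le_mul_of_nonneg_left h1 (pow_pos hΛ0 j).le
      have h3 : Λ ^ j * (Λ * ‖c (j + 1)‖ + X * ((2 * Λ)⁻¹) ^ j) =
          Λ ^ (j + 1) * ‖c (j + 1)‖ + X * (1 / 2) ^ j := by rw [← e j]; ring
      have h4 : (1 / 2 : ℝ) ^ (j + 1) = (1 / 2) ^ j * (1 / 2) := pow_succ _ _
      rw [h4]
      linarith
  have hlim : Filter.Tendsto (fun j : ℕ => 2 * X * (1 - (1 / 2 : ℝ) ^ j) + Z * (1 / 2) ^ j)
      Filter.atTop (nhds (2 * X * (1 - 0) + Z * 0)) := by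
    have := tendsto_pow_atTop_nhds_zero_of_lt_one (r := (1 / 2 : ℝ)) (by norm_num) (by norm_num)
    exact ((this.const_sub 1).const_mul _).add (this.const_mul _)
  rw [sub_zero, mul_one, mul_zero, add_zero] at hlim
  refine ge_of_tendsto' hlim fun j => (key j).trans (add_le_add_right ?_ _)
  calc Λ ^ j * ‖c j‖ ≤ Λ ^ j * (Z * ((2 * Λ)⁻¹) ^ j) := by gcongr; exact hc j
    _ = Z * (1 / 2) ^ j := by rw [← e j]; ring

variable {N : ℕ} {H : Type*} [Group H]

/-- The sum `∑ j, A ^ j n(x ^ j k)` along a forward orbit. -/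
noncomputable def orbitSum (σ : H →* GL (Fin N) ℤ) (A : Module.End ℂ (Fin N → ℂ)) (x : H)
    (n : (Fin N → ℤ) → Fin N → ℂ) (k : Fin N → ℤ) : Fin N → ℂ :=
  ∑' j : ℕ, (A ^ j) (n (latticeAct σ (x ^ j) k))

theorem orbitSum_bound {σ : H →* GL (Fin N) ℤ} {A : Module.End ℂ (Fin N → ℂ)} {x : H}
    {n : (Fin N → ℤ) → Fin N → ℂ} {k : Fin N → ℤ} {Λ Y : ℝ} (hΛ : 1 ≤ Λ)
    (hA : ∀ v, ‖A v‖ ≤ Λ * ‖v‖)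
    (hn : ∀ j : ℕ, ‖n (latticeAct σ (x ^ j) k)‖ ≤ Y * ((2 * Λ)⁻¹) ^ j) :
    ‖orbitSum σ A x n k‖ ≤ 2 * Y ∧
      orbitSum σ A x n k = n k + A (orbitSum σ A x n (latticeAct σ x k)) := by
  have hΛ0 : 0 < Λ := by linarith
  have hpow : ∀ (j : ℕ) v, ‖(A ^ j) v‖ ≤ Λ ^ j * ‖v‖ := by
    intro j v
    induction j with
    | zero => simp
    | succ j ih =>
      rw [pow_succ', Module.End.mul_apply]
      refine (hA _).trans ?_
      rw [pow_succ', mul_assoc]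
      gcongr
  have hb : ∀ j : ℕ, ‖(A ^ j) (n (latticeAct σ (x ^ j) k))‖ ≤ Y * (1 / 2) ^ j := fun j => by
    refine (hpow j _).trans ((mul_le_mul_of_nonneg_left (hn j) (by positivity)).trans_eq ?_)
    rw [mul_left_comm, ← mul_pow]
    congr 2
    field_simp
  have hgeom : HasSum (fun j : ℕ => Y * (1 / 2 : ℝ) ^ j) (Y * 2) := hasSum_geometric_two.mul_left Y
  have hsum := Summable.of_norm_bounded hgeom.summable hb
  refine ⟨(tsum_of_norm_bounded hgeom hb).trans_eq (mul_comm _ _), ?_⟩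
  rw [orbitSum, hsum.tsum_eq_zero_add]
  congr 1
  · simp [latticeAct_one]
  · rw [orbitSum]
    have e : ∀ j : ℕ, (A ^ (j + 1)) (n (latticeAct σ (x ^ (j + 1)) k)) =
        LinearMap.toContinuousLinearMap (𝕜 := ℂ) (E := Fin N → ℂ) A ((A ^ j) (n (latticeAct σ (x ^ j) (latticeAct σ x k)))) :=
      fun j => by
        rw [← latticeAct_mul, ← pow_succ, pow_succ' A]
        rfl
    rw [tsum_congr e, ← ContinuousLinearMap.map_tsum]
    · rfl
    · refine Summable.of_norm_bounded (g := fun j : ℕ => Y * (2 * Λ)⁻¹ * (1 / 2 : ℝ) ^ j)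
        (summable_geometric_two.mul_left _) fun j => ?_
      rw [← latticeAct_mul, ← pow_succ]
      refine (hpow j _).trans ((mul_le_mul_of_nonneg_left (hn (j + 1)) (by positivity)).trans_eq ?_)
      have e1 : (1 / 2 : ℝ) ^ j = Λ ^ j * ((2 * Λ)⁻¹) ^ j := by
        rw [← mul_pow]
        congr 1
        field_simp
      rw [e1]
      ring

end Recursion

/-! ### A priori bounds and solution operators for one twisted equation. -/

section Solvability

variable {N : ℕ} {H : Type*} [Group H] {ρ σ : H →* GL (Fin N) ℤ} {g b : H}

/-- The twisted coboundary of a family of Fourier coefficients. -/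
noncomputable def coefDelta (ρ σ : H →* GL (Fin N) ℤ) (x : H) (W : (Fin N → ℤ) → Fin N → ℂ)
    (k : Fin N → ℤ) : Fin N → ℂ :=
  complexRep ρ x (W k) - W (latticeAct σ x k)

namespace WeightSystem

variable (S : WeightSystem (complexRep σ) g b)

/-- Exponents admissible at `k` of total order at most `R`, with drift at least `s` for `a`. -/
structure Decaying (a : S.ι → ℝ) (s R : ℝ) (r : S.ι → ℝ) (k : Fin N → ℤ) : Prop where
  admissible : S.Admissible r k
  sum_le : ∑ i, r i ≤ R
  drift : s ≤ ∑ i, r i * a i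

/-- Twisted cohomological equations over the conjugates of `x` have a priori bounds in terms of
majorants with drift `s` for `a`. -/
def HasAPrioriBounds (ρ : H →* GL (Fin N) ℤ) (x : H) (a : S.ι → ℝ) (s : ℝ) : Prop :=
  ∀ (d : H) (R : ℝ), ∃ C : ℝ, 1 ≤ C ∧ ∀ r r' k, S.Decaying a s R r k → S.Decaying a s R r' k →
    ∀ (c M : (Fin N → ℤ) → Fin N → ℂ) (X Z : ℝ), 0 ≤ X → 0 ≤ Z →
      (∀ h, complexRep ρ x (c (latticeAct σ h k)) -
        c (latticeAct σ (d⁻¹ * x * d) (latticeAct σ h k)) = M (latticeAct σ h k)) →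
      (∀ h, ‖c (latticeAct σ h k)‖ ≤
        Z * (S.majorant r (latticeAct σ h k) + S.majorant r' (latticeAct σ h k))) →
      (∀ h, ‖M (latticeAct σ h k)‖ ≤
        X * (S.majorant r (latticeAct σ h k) + S.majorant r' (latticeAct σ h k))) →
      ‖c k‖ ≤ C * X * (S.majorant r k + S.majorant r' k)

/-- The operator `𝒲` solves the twisted cohomological equation over `x`, with bounds in terms of
majorants with drift `s` for `a`. -/
def IsSolutionOperator (ρ : H →* GL (Fin N) ℤ) (x : H) (a : S.ι → ℝ) (s : ℝ)
    (𝒲 : ((Fin N → ℤ) → Fin N → ℂ) → (Fin N → ℤ) → Fin N → ℂ) : Prop :=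
  ∀ R : ℝ, ∃ C : ℝ, 1 ≤ C ∧ ∀ r k, k ≠ 0 → S.Decaying a s R r k →
    ∀ (f : (Fin N → ℤ) → Fin N → ℂ) (X : ℝ), 0 ≤ X → (∀ l ≠ 0, ‖f l‖ ≤ X * ‖l‖ ^ (-R)) →
      ‖𝒲 f k‖ ≤ C * X * S.majorant r k ∧ coefDelta ρ σ x (𝒲 f) k = f k

variable {S}

theorem Decaying.act {a : S.ι → ℝ} {s R : ℝ} {r : S.ι → ℝ} {k : Fin N → ℤ}
    (hr : S.Decaying a s R r k) (h : H) : S.Decaying a s R r (latticeAct σ h k) :=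
  ⟨hr.admissible.act h, hr.sum_le, hr.drift⟩

/-- Half of the drift `2 log (2 Λ)` survives, giving decay `(2 Λ) ^ (-n)`. Against a twist of norm
at most `Λ` this leaves a summable `2 ^ (-n)`. -/
theorem HasDrift.exists_majorant_le_pow {x : H} {a : S.ι → ℝ} (hx : S.HasDrift x a) (d : H)
    (R : ℝ) {Λ : ℝ} (hΛ : 1 ≤ Λ) : ∃ C : ℝ, 1 ≤ C ∧ ∀ r k,
      S.Decaying a (2 * Real.log (2 * Λ)) R r k → ∀ n : ℕ,
      S.majorant r (latticeAct σ (d⁻¹ * x ^ n * d) k) ≤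
        C * ((2 * Λ)⁻¹) ^ n * S.majorant r k := by
  obtain ⟨C, hC, h⟩ := hx.exists_majorant_le d R (s := 2 * Real.log (2 * Λ))
    (by have := Real.log_pos (x := 2 * Λ) (by linarith); linarith)
  refine ⟨C, hC, fun r k hr n => ?_⟩
  have := h r k hr.admissible hr.sum_le hr.drift n
  have e : Real.exp (-(2 * Real.log (2 * Λ) / 2) * n) = ((2 * Λ)⁻¹) ^ n := by
    rw [mul_comm, Real.exp_nat_mul, mul_div_cancel_left₀ _ two_ne_zero, Real.exp_neg,
      Real.exp_log (by linarith)]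
  rwa [e] at this

theorem HasDrift.exists_recursion_bound {x : H} {a : S.ι → ℝ} (hx : S.HasDrift x a) (d : H)
    (R : ℝ) {Λ : ℝ} (hΛ : 1 ≤ Λ) {A : (Fin N → ℂ) → Fin N → ℂ} (hA : ∀ v, ‖A v‖ ≤ Λ * ‖v‖) :
    ∃ C : ℝ, 1 ≤ C ∧ ∀ r r' k, S.Decaying a (2 * Real.log (2 * Λ)) R r k →
      S.Decaying a (2 * Real.log (2 * Λ)) R r' k →
      ∀ (c n : (Fin N → ℤ) → Fin N → ℂ) (X Z : ℝ), 0 ≤ X → 0 ≤ Z →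
      (∀ h, c (latticeAct σ h k) =
        A (c (latticeAct σ (d⁻¹ * x * d) (latticeAct σ h k))) + n (latticeAct σ h k)) →
      (∀ h, ‖c (latticeAct σ h k)‖ ≤
        Z * (S.majorant r (latticeAct σ h k) + S.majorant r' (latticeAct σ h k))) →
      (∀ h, ‖n (latticeAct σ h k)‖ ≤
        X * (S.majorant r (latticeAct σ h k) + S.majorant r' (latticeAct σ h k))) →
      ‖c k‖ ≤ C * X * (S.majorant r k + S.majorant r' k) := by
  obtain ⟨C, hC, hm⟩ := hx.exists_majorant_le_pow d R hΛ
  refine ⟨2 * C, by linarith, fun r r' k hr hr' c n X Z hX hZ heq hc hn => ?_⟩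
  have hq : ∀ j : ℕ, S.majorant r (latticeAct σ (d⁻¹ * x ^ j * d) k) +
      S.majorant r' (latticeAct σ (d⁻¹ * x ^ j * d) k) ≤
        C * (S.majorant r k + S.majorant r' k) * ((2 * Λ)⁻¹) ^ j := fun j =>
    (add_le_add (hm r k hr j) (hm r' k hr' j)).trans_eq (by ring)
  have := norm_le_of_backward_recursion (X := X * (C * (S.majorant r k + S.majorant r' k)))
    (Z := Z * (C * (S.majorant r k + S.majorant r' k))) hΛ hA
    (c := fun j => c (latticeAct σ (d⁻¹ * x ^ j * d) k))
    (n := fun j => n (latticeAct σ (d⁻¹ * x ^ j * d) k)) (fun j => by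
      have := heq (d⁻¹ * x ^ j * d)
      rw [← latticeAct_mul] at this
      rwa [show d⁻¹ * x ^ (j + 1) * d = d⁻¹ * x * d * (d⁻¹ * x ^ j * d) by rw [pow_succ']; group])
    (fun j => (hn _).trans (by
      rw [mul_assoc X]; exact mul_le_mul_of_nonneg_left (hq j) hX))
    (fun j => (hc _).trans (by
      rw [mul_assoc Z]; exact mul_le_mul_of_nonneg_left (hq j) hZ))
  rw [pow_zero, mul_one, inv_mul_cancel, latticeAct_one] at this
  exact this.trans_eq (by ring)

/-- Solve the equation for `c = ρ(x)⁻¹ (c ∘ d⁻¹ x d + M)` and iterate along the forward orbit. -/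
theorem HasDrift.hasAPrioriBounds {x : H} {a : S.ι → ℝ} (hx : S.HasDrift x a) {Λ : ℝ}
    (hΛ : 1 ≤ Λ) (hA : ∀ v, ‖complexRep ρ x⁻¹ v‖ ≤ Λ * ‖v‖) :
    S.HasAPrioriBounds ρ x a (2 * Real.log (2 * Λ)) := by
  intro d R
  obtain ⟨C, hC, hb⟩ := hx.exists_recursion_bound d R hΛ hA
  refine ⟨C * Λ, one_le_mul_of_one_le_of_one_le hC hΛ,
    fun r r' k hr hr' c M X Z hX hZ heq hc hM => ?_⟩
  refine (hb r r' k hr hr' c (fun l => complexRep ρ x⁻¹ (M l)) (Λ * X) Z (by positivity) hZ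
    (fun h => ?_) hc fun h => ?_).trans_eq (by ring)
  · rw [← heq h, map_sub, rep_inv_apply]
    abel
  · refine (hA _).trans ?_
    rw [mul_assoc]
    exact mul_le_mul_of_nonneg_left (hM h) (by linarith)

/-- The same equation read backwards: at `l = d⁻¹ x d l'` it gives `c l = ρ(x) c l' - M l'`. -/
theorem HasDrift.hasAPrioriBounds_of_inv {x : H} {a : S.ι → ℝ} (hx : S.HasDrift x⁻¹ a) {Λ : ℝ}
    (hΛ : 1 ≤ Λ) (hA : ∀ v, ‖complexRep ρ x v‖ ≤ Λ * ‖v‖) :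
    S.HasAPrioriBounds ρ x a (2 * Real.log (2 * Λ)) := by
  intro d R
  obtain ⟨C, hC, hb⟩ := hx.exists_recursion_bound d R hΛ hA
  obtain ⟨C₁, hC₁, h₁⟩ := S.exists_majorant_act_le (d⁻¹ * x⁻¹ * d) R
  refine ⟨C * C₁, one_le_mul_of_one_le_of_one_le hC hC₁,
    fun r r' k hr hr' c M X Z hX hZ heq hc hM => ?_⟩
  refine (hb r r' k hr hr' c (fun l => - M (latticeAct σ (d⁻¹ * x⁻¹ * d) l)) (C₁ * X) Z
    (by positivity) hZ (fun h => ?_) hc fun h => ?_).trans_eq (by ring)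
  · have := heq (d⁻¹ * x⁻¹ * d * h)
    rw [← latticeAct_mul, show d⁻¹ * x * d * (d⁻¹ * x⁻¹ * d * h) = h by group] at this
    rw [← latticeAct_mul, ← this]
    abel
  · rw [norm_neg, ← latticeAct_mul]
    refine (hM _).trans ?_
    rw [latticeAct_mul σ (d⁻¹ * x⁻¹ * d) h k]
    exact (mul_le_mul_of_nonneg_left (add_le_add (h₁ _ _ (hr.act h).admissible hr.sum_le)
      (h₁ _ _ (hr'.act h).admissible hr'.sum_le)) hX).trans_eq (by ring)

theorem HasDrift.exists_orbitSum_bound {x : H} {a : S.ι → ℝ} (hx : S.HasDrift x a) {Λ : ℝ}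
    (hΛ : 1 ≤ Λ) {A : Module.End ℂ (Fin N → ℂ)} (hA : ∀ v, ‖A v‖ ≤ Λ * ‖v‖) (R : ℝ) :
    ∃ C : ℝ, 1 ≤ C ∧ ∀ r k, k ≠ 0 → S.Decaying a (2 * Real.log (2 * Λ)) R r k →
      ∀ (n : (Fin N → ℤ) → Fin N → ℂ) (X : ℝ), 0 ≤ X →
      (∀ h, ‖n (latticeAct σ h k)‖ ≤ X * S.majorant r (latticeAct σ h k)) →
      ‖orbitSum σ A x n k‖ ≤ C * X * S.majorant r k ∧
      orbitSum σ A x n k = n k + A (orbitSum σ A x n (latticeAct σ x k)) := by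
  obtain ⟨C, hC, hm⟩ := hx.exists_majorant_le_pow 1 R hΛ
  refine ⟨2 * C, by linarith, fun r k hk hr n X hX hn => ?_⟩
  have := orbitSum_bound (σ := σ) (x := x) (n := n) (k := k) (Y := C * X * S.majorant r k) hΛ hA
    (fun j => (hn _).trans (by
      have := hm r k hr j
      rw [inv_one, one_mul, mul_one] at this
      exact (mul_le_mul_of_nonneg_left this hX).trans_eq (by ring)))
  exact ⟨this.1.trans_eq (by ring), this.2⟩

/-- The forward sum `∑ ρ(x) ^ (-j-1) f(x ^ j k)`. The operator does not depend on the exponents or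
the order; these enter only where convergence is estimated. -/
theorem HasDrift.exists_solutionOperator {x : H} {a : S.ι → ℝ} (hx : S.HasDrift x a) {Λ : ℝ}
    (hΛ : 1 ≤ Λ) (hA : ∀ v, ‖complexRep ρ x⁻¹ v‖ ≤ Λ * ‖v‖) :
    ∃ 𝒲, S.IsSolutionOperator ρ x a (2 * Real.log (2 * Λ)) 𝒲 := by
  refine ⟨fun f => orbitSum σ (complexRep ρ x⁻¹) x fun l => complexRep ρ x⁻¹ (f l), fun R => ?_⟩
  obtain ⟨C, hC, hb⟩ := hx.exists_orbitSum_bound hΛ hA R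
  obtain ⟨C₁, hC₁, h₁⟩ := S.exists_rpow_le_majorant R
  refine ⟨C * (Λ * C₁), one_le_mul_of_one_le_of_one_le hC (one_le_mul_of_one_le_of_one_le hΛ hC₁),
    fun r k hk hr f X hX hf => ?_⟩
  obtain ⟨h2, h3⟩ := hb r k hk hr (fun l => complexRep ρ x⁻¹ (f l)) (Λ * (C₁ * X)) (by positivity)
    fun h => by
      refine (hA _).trans ?_
      rw [mul_assoc]
      refine mul_le_mul_of_nonneg_left ((hf _ (latticeAct_ne_zero σ h hk)).trans ?_) (by linarith)
      rw [mul_comm C₁, mul_assoc]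
      exact mul_le_mul_of_nonneg_left (h₁ _ _ (latticeAct_ne_zero σ h hk) (hr.act h).admissible
        hr.sum_le) hX
  refine ⟨h2.trans_eq (by ring), ?_⟩
  simp only [coefDelta]
  rw [h3, map_add, rep_apply_inv, rep_apply_inv, add_sub_cancel_right]

/-- The backward sum `-∑ ρ(x) ^ j f(x ^ (-j-1) k)`. -/
theorem HasDrift.exists_solutionOperator_of_inv {x : H} {a : S.ι → ℝ} (hx : S.HasDrift x⁻¹ a)
    {Λ : ℝ} (hΛ : 1 ≤ Λ) (hA : ∀ v, ‖complexRep ρ x v‖ ≤ Λ * ‖v‖) :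
    ∃ 𝒲, S.IsSolutionOperator ρ x a (2 * Real.log (2 * Λ)) 𝒲 := by
  refine ⟨fun f => orbitSum σ (complexRep ρ x) x⁻¹ fun l => - f (latticeAct σ x⁻¹ l), fun R => ?_⟩
  obtain ⟨C, hC, hb⟩ := hx.exists_orbitSum_bound hΛ hA R
  obtain ⟨C₁, hC₁, h₁⟩ := S.exists_rpow_le_majorant R
  obtain ⟨C₂, hC₂, h₂⟩ := S.exists_majorant_act_le x⁻¹ R
  refine ⟨C * (C₁ * C₂), one_le_mul_of_one_le_of_one_le hC
    (one_le_mul_of_one_le_of_one_le hC₁ hC₂), fun r k hk hr f X hX hf => ?_⟩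
  have hn : ∀ h, ‖- f (latticeAct σ x⁻¹ (latticeAct σ h k))‖ ≤
      C₁ * C₂ * X * S.majorant r (latticeAct σ h k) := fun h => by
    have h0 := latticeAct_ne_zero σ x⁻¹ (latticeAct_ne_zero σ h hk)
    rw [norm_neg]
    calc _ ≤ X * (C₁ * (C₂ * S.majorant r (latticeAct σ h k))) := by
          refine (hf _ h0).trans (mul_le_mul_of_nonneg_left ?_ hX)
          refine (h₁ _ _ h0 ((hr.act h).act x⁻¹).admissible hr.sum_le).trans ?_
          gcongr
          exact h₂ _ _ (hr.act h).admissible hr.sum_le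
      _ = _ := by ring
  have h4 := (hb r k hk hr (fun l => - f (latticeAct σ x⁻¹ l)) (C₁ * C₂ * X) (by positivity) hn).1
  refine ⟨by linarith, ?_⟩
  have h3 := (hb r (latticeAct σ x k) (latticeAct_ne_zero σ x hk) (hr.act x)
    (fun l => - f (latticeAct σ x⁻¹ l)) (C₁ * C₂ * X) (by positivity) (fun h => by
      have := hn (h * x)
      rwa [latticeAct_mul σ h x k] at this)).2
  simp only [coefDelta]
  rw [h3, ← latticeAct_mul, inv_mul_cancel, latticeAct_one]
  abel

end WeightSystem

end Solvability

/-! ### Cocycle differences, residuals and the comparison of the two solutions. -/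

section CocycleCoefficients

variable {N : ℕ} {H : Type*} [Group H] {ρ σ : H →* GL (Fin N) ℤ} {g b : H}

/-- The Fourier coefficients of the cocycle difference. -/
noncomputable def coefCocycle (ρ σ : H →* GL (Fin N) ℤ) (R : H → (Fin N → ℤ) → Fin N → ℂ) (x y : H)
    (k : Fin N → ℤ) : Fin N → ℂ :=
  R x (latticeAct σ y k) + complexRep ρ x (R y k)
    - R y (latticeAct σ (x * (x⁻¹ * y⁻¹ * x * y)) k)
    - complexRep ρ y (R x (latticeAct σ (x⁻¹ * y⁻¹ * x * y) k))
    - complexRep ρ (y * x) (R (x⁻¹ * y⁻¹ * x * y) k)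

/-- The residual of a family after subtracting a coboundary. -/
noncomputable def coefResidual (ρ σ : H →* GL (Fin N) ℤ) (R : H → (Fin N → ℤ) → Fin N → ℂ)
    (W : (Fin N → ℤ) → Fin N → ℂ) (h : H) (k : Fin N → ℤ) : Fin N → ℂ :=
  R h k - coefDelta ρ σ h W k

/-- Coboundaries are exact cocycles: they cancel because `x y = y x z` for `z = x⁻¹ y⁻¹ x y`.
Residuals therefore have the same cocycle differences as the original family. -/
theorem coefCocycle_residual (R : H → (Fin N → ℤ) → Fin N → ℂ) (W : (Fin N → ℤ) → Fin N → ℂ)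
    (x y : H) (k : Fin N → ℤ) :
    coefCocycle ρ σ (coefResidual ρ σ R W) x y k = coefCocycle ρ σ R x y k := by
  simp only [coefCocycle, coefResidual, coefDelta, map_sub, ← latticeAct_mul,
    ← Module.End.mul_apply, ← map_mul]
  rw [show y * (x * (x⁻¹ * y⁻¹ * x * y)) = x * y by group,
    show y * x * (x⁻¹ * y⁻¹ * x * y) = x * y by group]
  abel

/-- The engine of the descent: an equation for `R y` over the conjugate `y⁻¹ g y` of `g`, with the
next commutator on the right. -/
theorem coefCocycle_eq (R : H → (Fin N → ℤ) → Fin N → ℂ) (y : H) (k : Fin N → ℤ) :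
    complexRep ρ g (R y k) - R y (latticeAct σ (y⁻¹ * g * y) k) = coefCocycle ρ σ R g y k
      - R g (latticeAct σ y k) + complexRep ρ y (R g (latticeAct σ (g⁻¹ * y⁻¹ * g * y) k))
      + complexRep ρ (y * g) (R (g⁻¹ * y⁻¹ * g * y) k) := by
  rw [coefCocycle, show g * (g⁻¹ * y⁻¹ * g * y) = y⁻¹ * g * y by group]
  abel

/-- Starting point of the descent: at the trivial commutator the cocycle difference determines `R
1`. -/
theorem coefCocycle_one (R : H → (Fin N → ℤ) → Fin N → ℂ) (k : Fin N → ℤ) :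
    coefCocycle ρ σ R g 1 k = - R 1 (latticeAct σ g k) := by
  simp [coefCocycle, latticeAct_one]
  abel

theorem coefResidual_one (R : H → (Fin N → ℤ) → Fin N → ℂ) (W : (Fin N → ℤ) → Fin N → ℂ) :
    coefResidual ρ σ R W 1 = R 1 := by
  ext1 k
  simp [coefResidual, coefDelta, latticeAct_one]

/-- Polynomial decay of order `t`, with constant `X`, off the origin. -/
def HasDecay (t X : ℝ) (f : (Fin N → ℤ) → Fin N → ℂ) : Prop :=
  ∀ l ≠ 0, ‖f l‖ ≤ X * ‖l‖ ^ (-t)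

theorem HasDecay.mono {t t' X X' : ℝ} {f : (Fin N → ℤ) → Fin N → ℂ} (hf : HasDecay t X f)
    (ht : t' ≤ t) (hX : X ≤ X') (hX' : 0 ≤ X') : HasDecay t' X' f := fun l hl =>
  (hf l hl).trans (mul_le_mul hX (Real.rpow_le_rpow_of_exponent_le (one_le_norm_of_ne_zero hl)
    (by linarith)) (by positivity) hX')

theorem HasDecay.add {t X X' : ℝ} {f f' : (Fin N → ℤ) → Fin N → ℂ} (hf : HasDecay t X f)
    (hf' : HasDecay t X' f') : HasDecay t (X + X') (fun k => f k + f' k) := fun l hl =>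
  (norm_add_le _ _).trans ((add_le_add (hf l hl) (hf' l hl)).trans_eq (add_mul _ _ _).symm)

theorem HasDecay.sub {t X X' : ℝ} {f f' : (Fin N → ℤ) → Fin N → ℂ} (hf : HasDecay t X f)
    (hf' : HasDecay t X' f') : HasDecay t (X + X') (fun k => f k - f' k) := fun l hl =>
  (norm_sub_le _ _).trans ((add_le_add (hf l hl) (hf' l hl)).trans_eq (add_mul _ _ _).symm)

theorem exists_rpow_act_le (σ : H →* GL (Fin N) ℤ) (h : H) {t : ℝ} (ht : 0 ≤ t) :
    ∃ C : ℝ, 1 ≤ C ∧ ∀ l : Fin N → ℤ, l ≠ 0 → ‖latticeAct σ h l‖ ^ (-t) ≤ C * ‖l‖ ^ (-t) := by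
  obtain ⟨C, hC, hb⟩ := exists_rep_bound σ h⁻¹
  refine ⟨C ^ t, Real.one_le_rpow hC ht, fun l hl => ?_⟩
  have h0 := latticeAct_ne_zero σ h hl
  have h1 := hb (intVec (latticeAct σ h l))
  rw [complexRep_intVec, ← latticeAct_mul, inv_mul_cancel, latticeAct_one, norm_intVec,
    norm_intVec] at h1
  have hl0 : 0 < ‖l‖ := by linarith [one_le_norm_of_ne_zero hl]
  have hl1 : 0 < ‖latticeAct σ h l‖ := by linarith [one_le_norm_of_ne_zero h0]
  have h2 := Real.rpow_le_rpow hl0.le h1 ht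
  rw [Real.mul_rpow (by linarith) hl1.le] at h2
  rw [Real.rpow_neg hl0.le, Real.rpow_neg hl1.le, ← div_eq_mul_inv, inv_eq_one_div,
    div_le_div_iff₀ (Real.rpow_pos_of_pos hl1 _) (Real.rpow_pos_of_pos hl0 _), one_mul]
  exact h2

theorem exists_hasDecay_act (σ : H →* GL (Fin N) ℤ) (h : H) {t : ℝ} (ht : 0 ≤ t) :
    ∃ C : ℝ, 1 ≤ C ∧
    ∀ f X, 0 ≤ X → HasDecay t X f → HasDecay t (C * X) (fun k => f (latticeAct σ h k)) := by
  obtain ⟨C, hC, hb⟩ := exists_rpow_act_le σ h ht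
  refine ⟨C, hC, fun f X hX hf l hl => (hf _ (latticeAct_ne_zero σ h hl)).trans ?_⟩
  rw [mul_comm C, mul_assoc]
  exact mul_le_mul_of_nonneg_left (hb l hl) hX

theorem exists_hasDecay_rep (ρ : H →* GL (Fin N) ℤ) (h : H) : ∃ C : ℝ, 1 ≤ C ∧
    ∀ f t X, HasDecay t X f → HasDecay t (C * X) (fun k => complexRep ρ h (f k)) := by
  obtain ⟨C, hC, hb⟩ := exists_rep_bound ρ h
  refine ⟨C, hC, fun f t X hf l hl => (hb _).trans ?_⟩
  rw [mul_assoc]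
  exact mul_le_mul_of_nonneg_left (hf l hl) (by linarith)

theorem exists_hasDecay_coefDelta (ρ σ : H →* GL (Fin N) ℤ) (h : H) {t : ℝ} (ht : 0 ≤ t) :
    ∃ C : ℝ, 1 ≤ C ∧
    ∀ f X, 0 ≤ X → HasDecay t X f → HasDecay t (C * X) (coefDelta ρ σ h f) := by
  obtain ⟨C₁, hC₁, h₁⟩ := exists_hasDecay_rep ρ h
  obtain ⟨C₂, hC₂, h₂⟩ := exists_hasDecay_act σ h ht
  refine ⟨C₁ + C₂, by linarith, fun f X hX hf => ?_⟩
  rw [add_mul]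
  exact (h₁ f t X hf).sub (h₂ f X hX hf)

namespace WeightSystem

variable (S : WeightSystem (complexRep σ) g b)

theorem exists_uniform_rate (ρ : H →* GL (Fin N) ℤ) : ∃ s : ℝ, 0 ≤ s ∧
    S.HasAPrioriBounds ρ g S.α s ∧ S.HasAPrioriBounds ρ g (-S.α) s ∧
    S.HasAPrioriBounds ρ b S.β s ∧ S.HasAPrioriBounds ρ b (-S.β) s ∧
    (∃ 𝒲, S.IsSolutionOperator ρ g S.α s 𝒲) ∧ ∃ 𝒲, S.IsSolutionOperator ρ g (-S.α) s 𝒲 := by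
  obtain ⟨C₁, hC₁, h₁⟩ := exists_rep_bound ρ g
  obtain ⟨C₂, hC₂, h₂⟩ := exists_rep_bound ρ g⁻¹
  obtain ⟨C₃, hC₃, h₃⟩ := exists_rep_bound ρ b
  obtain ⟨C₄, hC₄, h₄⟩ := exists_rep_bound ρ b⁻¹
  set Λ := C₁ + C₂ + C₃ + C₄ with hΛ
  have hΛ1 : 1 ≤ Λ := by linarith
  replace h₁ := fun v => (h₁ v).trans (mul_le_mul_of_nonneg_right (by linarith : C₁ ≤ Λ)
    (norm_nonneg v))
  replace h₂ := fun v => (h₂ v).trans (mul_le_mul_of_nonneg_right (by linarith : C₂ ≤ Λ)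
    (norm_nonneg v))
  replace h₃ := fun v => (h₃ v).trans (mul_le_mul_of_nonneg_right (by linarith : C₃ ≤ Λ)
    (norm_nonneg v))
  replace h₄ := fun v => (h₄ v).trans (mul_le_mul_of_nonneg_right (by linarith : C₄ ≤ Λ)
    (norm_nonneg v))
  refine ⟨2 * Real.log (2 * Λ), ?_, S.hasDrift_left.hasAPrioriBounds hΛ1 h₂,
    S.hasDrift_left_inv.hasAPrioriBounds_of_inv hΛ1 h₁,
    S.hasDrift_right.hasAPrioriBounds hΛ1 h₄, S.hasDrift_right_inv.hasAPrioriBounds_of_inv hΛ1 h₃,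
    S.hasDrift_left.exists_solutionOperator hΛ1 h₂,
    S.hasDrift_left_inv.exists_solutionOperator_of_inv hΛ1 h₁⟩
  have := Real.log_nonneg (x := 2 * Λ) (by linarith)
  linarith

variable {S}

theorem exists_majorant_bound_of_hasDecay (S : WeightSystem (complexRep σ) g b) (a : S.ι → ℝ)
    (s R : ℝ) : ∃ C : ℝ, 1 ≤ C ∧ ∀ r k, k ≠ 0 → S.Decaying a s R r k → ∀ f X, 0 ≤ X →
      HasDecay R X f → ‖f k‖ ≤ C * X * S.majorant r k := by
  obtain ⟨C, hC, h⟩ := S.exists_rpow_le_majorant R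
  refine ⟨C, hC, fun r k hk hr f X hX hf => (hf k hk).trans ?_⟩
  rw [mul_comm C, mul_assoc]
  exact mul_le_mul_of_nonneg_left (h r k hk hr.admissible hr.sum_le) hX

/-- A pointwise bound on the residual of the family after removing the coboundary of a solution
of the first equation. -/
theorem IsSolutionOperator.exists_residual_bound {a : S.ι → ℝ} {s : ℝ}
    {𝒲 : ((Fin N → ℤ) → Fin N → ℂ) → (Fin N → ℤ) → Fin N → ℂ}
    (h𝒲 : S.IsSolutionOperator ρ g a s 𝒲) (hap : S.HasAPrioriBounds ρ g a s) {n : ℕ}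
    (hn : iterComm g b n = 1) (T : ℝ) {i : ℕ} (hi : i ≤ n) :
    ∃ C : ℝ, 1 ≤ C ∧ ∀ r k, k ≠ 0 → S.Decaying a s T r k →
      ∀ (R : H → (Fin N → ℤ) → Fin N → ℂ) (X Z : ℝ), 0 ≤ X → 0 ≤ Z → HasDecay T Z (R g) →
      (∀ j ≤ n, HasDecay T Z (R (iterComm g b j))) →
      (∀ j ≤ n, HasDecay T X (coefCocycle ρ σ R g (iterComm g b j))) →
      ‖coefResidual ρ σ R (𝒲 (R g)) (iterComm g b i) k‖ ≤ C * X * S.majorant r k := by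
  obtain ⟨C₀, hC₀, h₀⟩ := exists_majorant_bound_of_hasDecay S a s T
  induction hi using Nat.decreasingInduction with
  | self =>
    obtain ⟨C₁, hC₁, h₁⟩ := S.exists_majorant_act_le g⁻¹ T
    refine ⟨C₀ * C₁, one_le_mul_of_one_le_of_one_le hC₀ hC₁,
      fun r k hk hr R X Z hX hZ hg hR hL => ?_⟩
    rw [hn, coefResidual_one]
    have h2 := h₀ r _ (latticeAct_ne_zero σ g⁻¹ hk) (hr.act g⁻¹) _ X hX (hL n le_rfl)
    rw [hn, coefCocycle_one, norm_neg, ← latticeAct_mul, mul_inv_cancel, latticeAct_one] at h2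
    refine h2.trans ((mul_le_mul_of_nonneg_left (h₁ r k hr.admissible hr.sum_le)
      (by positivity)).trans_eq (by ring))
  | of_succ i hin ih =>
    obtain ⟨C₁, hC₁, h₁⟩ := ih
    set y := iterComm g b i with hy
    have hz : iterComm g b (i + 1) = g⁻¹ * y⁻¹ * g * y := rfl
    obtain ⟨C₂, hC₂, h₂⟩ := exists_rep_bound ρ (y * g)
    obtain ⟨C₃, hC₃, h₃⟩ := exists_rep_bound ρ y
    obtain ⟨C₄, hC₄, h₄⟩ := S.exists_majorant_act_le y T
    obtain ⟨C₅, hC₅, h₅⟩ := h𝒲 T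
    obtain ⟨C₆, hC₆, h₆⟩ := hap y T
    refine ⟨2 * C₆ * (C₀ + C₂ * C₁), one_le_mul_of_one_le_of_one_le (by linarith) (by nlinarith), fun r k hk hr R X Z hX hZ hg hR hL => ?_⟩
    have hm : ∀ l, 0 ≤ S.majorant r l := S.majorant_nonneg r
    have hrough : ∀ h, ‖coefResidual ρ σ R (𝒲 (R g)) y (latticeAct σ h k)‖ ≤
        (C₀ * Z + (C₃ * (C₅ * Z) + C₅ * Z * C₄)) * S.majorant r (latticeAct σ h k) := by
      intro h
      have hk' := latticeAct_ne_zero σ h hk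
      have hr' := hr.act h
      generalize latticeAct σ h k = l at hk' hr'
      have e1 := h₀ r l hk' hr' _ Z hZ (hR i hin.le)
      have e2 := (h₅ r l hk' hr' _ Z hZ hg).1
      have e3 := (h₅ r _ (latticeAct_ne_zero σ y hk') (hr'.act y) _ Z hZ hg).1
      have e4 := h₃ (𝒲 (R g) l)
      have e5 := h₄ r l hr'.admissible hr'.sum_le
      rw [coefResidual, coefDelta]
      calc _ ≤ ‖R y l‖ + (‖complexRep ρ y (𝒲 (R g) l)‖ + ‖𝒲 (R g) (latticeAct σ y l)‖) :=
            (norm_sub_le _ _).trans (add_le_add_right (norm_sub_le _ _) _)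
        _ ≤ C₀ * Z * S.majorant r l + (C₃ * (C₅ * Z * S.majorant r l) +
            C₅ * Z * (C₄ * S.majorant r l)) := by
            refine add_le_add e1 (add_le_add (e4.trans ?_) (e3.trans ?_))
            · exact mul_le_mul_of_nonneg_left e2 (by linarith)
            · exact mul_le_mul_of_nonneg_left e5 (by positivity)
        _ = _ := by ring
    -- The bound by `Z` serves only to start the a priori estimate. The result depends on `X`, that
    -- is, on the cocycle differences.
    have := h₆ r r k hr hr (coefResidual ρ σ R (𝒲 (R g)) y)
      (fun l => coefCocycle ρ σ R g y l +
        complexRep ρ (y * g) (coefResidual ρ σ R (𝒲 (R g)) (iterComm g b (i + 1)) l))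
      ((C₀ + C₂ * C₁) * X) (C₀ * Z + (C₃ * (C₅ * Z) + C₅ * Z * C₄)) (by positivity) (by positivity)
      (fun h => by
        have hk' := latticeAct_ne_zero σ h hk
        have hr' := hr.act h
        generalize latticeAct σ h k = l at hk' hr'
        -- The first equation is solved exactly on the whole orbit, which removes the residual of
        -- `g` from the right side.
        have hzero : ∀ h', coefResidual ρ σ R (𝒲 (R g)) g (latticeAct σ h' l) = 0 := fun h' => by
          rw [coefResidual, (h₅ r _ (latticeAct_ne_zero σ h' hk') (hr'.act h') _ Z hZ hg).2,
            sub_self]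
        rw [coefCocycle_eq, hzero, hzero, coefCocycle_residual, map_zero, sub_zero, add_zero, hz])
      (fun h => (hrough h).trans (mul_le_mul_of_nonneg_left (le_add_of_nonneg_left (hm _))
        (by positivity)))
      (fun h => by
        have hk' := latticeAct_ne_zero σ h hk
        have hr' := hr.act h
        generalize latticeAct σ h k = l at hk' hr'
        have e1 := h₀ r l hk' hr' _ X hX (hL i hin.le)
        have e2 := h₁ r l hk' hr' R X Z hX hZ hg hR hL
        calc _ ≤ C₀ * X * S.majorant r l + C₂ * (C₁ * X * S.majorant r l) :=
              (norm_add_le _ _).trans (add_le_add e1 ((h₂ _).trans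
                (mul_le_mul_of_nonneg_left e2 (by linarith))))
          _ = (C₀ + C₂ * C₁) * X * S.majorant r l := by ring
          _ ≤ _ := mul_le_mul_of_nonneg_left (le_add_of_nonneg_left (hm _)) (by positivity))
    exact this.trans_eq (by ring)

/-- Where both an expanding and a contracting weight component are large, the difference of the
forward and the backward solution is controlled by the cocycle difference. -/
theorem exists_transition_bound (hper : NoPeriodicVectors σ g b) {s : ℝ} (hs : 0 ≤ s)
    {𝒲₁ 𝒲₂ : ((Fin N → ℤ) → Fin N → ℂ) → (Fin N → ℤ) → Fin N → ℂ}
    (hα₁ : S.HasAPrioriBounds ρ g S.α s) (hα₂ : S.HasAPrioriBounds ρ g (-S.α) s)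
    (hβ₁ : S.HasAPrioriBounds ρ b S.β s) (hβ₂ : S.HasAPrioriBounds ρ b (-S.β) s)
    (h𝒲₁ : S.IsSolutionOperator ρ g S.α s 𝒲₁) (h𝒲₂ : S.IsSolutionOperator ρ g (-S.α) s 𝒲₂) {n : ℕ}
    (hn : iterComm g b n = 1) :
    ∃ s₁ : ℝ, 0 ≤ s₁ ∧ ∀ t c : ℝ, 0 ≤ t → 1 ≤ c → ∃ C : ℝ, 1 ≤ C ∧ ∀ k, k ≠ 0 → ∀ i₁ i₂,
      0 ≤ S.α i₁ → S.α i₂ < 0 → ‖k‖ ≤ c * ‖S.proj i₁ (intVec k)‖ →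
      ‖k‖ ≤ c * ‖S.proj i₂ (intVec k)‖ →
      ∀ (R : H → (Fin N → ℤ) → Fin N → ℂ) (X Z : ℝ), 0 ≤ X → 0 ≤ Z → HasDecay (t + s₁) Z (R g) →
      (∀ j ≤ n, HasDecay (t + s₁) Z (R (iterComm g b j))) →
      (∀ j ≤ n, HasDecay (t + s₁) X (coefCocycle ρ σ R g (iterComm g b j))) →
      ‖𝒲₁ (R g) k - 𝒲₂ (R g) k‖ ≤ C * X * ‖k‖ ^ (-t) := by
  obtain ⟨s₁, hs₁, hexp⟩ := S.exists_concentrated_exponents hper hs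
  refine ⟨s₁, hs₁, fun t c ht hc => ?_⟩
  obtain ⟨C₀, hC₀, h₀⟩ := hexp t c ht hc
  obtain ⟨C₁, hC₁, h₁⟩ := h𝒲₁.exists_residual_bound hα₁ hn (t + s₁) (Nat.zero_le n)
  obtain ⟨C₂, hC₂, h₂⟩ := h𝒲₂.exists_residual_bound hα₂ hn (t + s₁) (Nat.zero_le n)
  obtain ⟨C₃, hC₃, h₃⟩ := hβ₁ 1 (t + s₁)
  obtain ⟨C₄, hC₄, h₄⟩ := hβ₂ 1 (t + s₁)
  obtain ⟨C₅, hC₅, h₅⟩ := h𝒲₁ (t + s₁)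
  obtain ⟨C₆, hC₆, h₆⟩ := h𝒲₂ (t + s₁)
  refine ⟨(C₃ + C₄) * (C₁ + C₂) * (2 * C₀), one_le_mul_of_one_le_of_one_le
    (one_le_mul_of_one_le_of_one_le (by linarith) (by linarith)) (by linarith), fun k hk i₁ i₂ hi₁ hi₂ hk₁ hk₂ R X Z hX hZ hg hR hL => ?_⟩
  classical
  have hne : i₁ ≠ i₂ := fun h => by rw [h] at hi₁; linarith
  set w := S.α i₁ - S.α i₂ with hw
  have hw0 : 0 < w := by linarith
  -- The convex combination of the two large components with zero drift along `g`, so the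
  -- corrections alone decide the sign of that drift.
  set θ : S.ι → ℝ := Pi.single i₁ (-S.α i₂ / w) + Pi.single i₂ (S.α i₁ / w) with hθ
  have hθ0 : ∀ i, 0 ≤ θ i := by
    intro i
    refine add_nonneg ?_ ?_
    · by_cases h : i = i₁
      · rw [h, Pi.single_eq_same]; exact div_nonneg (by linarith) hw0.le
      · rw [Pi.single_eq_of_ne h]
    · by_cases h : i = i₂
      · rw [h, Pi.single_eq_same]; exact div_nonneg (by linarith) hw0.le
      · rw [Pi.single_eq_of_ne h]
  have hθsum : ∀ f : S.ι → ℝ, ∑ i, θ i * f i = -S.α i₂ / w * f i₁ + S.α i₁ / w * f i₂ := by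
    intro f
    simp [hθ, add_mul, Finset.sum_add_distrib, Pi.single_apply]
  have hθ1 : ∑ i, θ i = 1 := by
    have := hθsum fun _ => 1
    simp only [mul_one] at this
    rw [this, ← add_div, div_eq_one_iff_eq hw0.ne']
    ring
  have hθα : ∑ i, θ i * S.α i = 0 := by rw [hθsum]; ring
  have hθc : ∀ i, θ i ≠ 0 → ‖k‖ ≤ c * ‖S.proj i (intVec k)‖ := by
    intro i hi
    by_cases h1 : i = i₁
    · rwa [h1]
    by_cases h2 : i = i₂
    · rwa [h2]
    · exact absurd (by simp [hθ, h1, h2]) hi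
  -- `y` is the sign of the drift of `θ` along `b`. Both exponents below are corrected in that
  -- direction, hence both decay under the same one of `b`, `b⁻¹`, while their `g`-drifts are
  -- opposite.
  obtain ⟨y, hy, hyβ⟩ : ∃ y : ℝ, (y = 1 ∨ y = -1) ∧ 0 ≤ y * ∑ i, θ i * S.β i := by
    rcases le_total 0 (∑ i, θ i * S.β i) with h | h
    · exact ⟨1, Or.inl rfl, by linarith⟩
    · exact ⟨-1, Or.inr rfl, by linarith⟩
  have hy1 : |y| ≤ 1 := by rcases hy with rfl | rfl <;> simp
  obtain ⟨r₁, hadm₁, hsum₁, ⟨t₁, ht₁, hrα₁, hrβ₁⟩, hm₁⟩ := h₀ k hk θ hθ0 hθ1 hθc 1 y (by simp) hy1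
  obtain ⟨r₂, hadm₂, hsum₂, ⟨t₂, ht₂, hrα₂, hrβ₂⟩, hm₂⟩ :=
    h₀ k hk θ hθ0 hθ1 hθc (-1) y (by simp) hy1
  have hd₁ : S.Decaying S.α s (t + s₁) r₁ k := ⟨hadm₁, hsum₁, by rw [hrα₁, hθα]; linarith⟩
  have hd₂ : S.Decaying (-S.α) s (t + s₁) r₂ k := ⟨hadm₂, hsum₂, by
    simp only [Pi.neg_apply, mul_neg, Finset.sum_neg_distrib]
    rw [hrα₂, hθα]; linarith⟩
  have hP₁ : ∀ l, 0 ≤ S.majorant r₁ l := S.majorant_nonneg r₁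
  have hP₂ : ∀ l, 0 ≤ S.majorant r₂ l := S.majorant_nonneg r₂
  have key : ∀ (a : S.ι → ℝ) (C' : ℝ), 1 ≤ C' → S.Decaying a s (t + s₁) r₁ k →
      S.Decaying a s (t + s₁) r₂ k → (∀ r r' k, S.Decaying a s (t + s₁) r k →
      S.Decaying a s (t + s₁) r' k →
      ∀ (c M : (Fin N → ℤ) → Fin N → ℂ) (X Z : ℝ), 0 ≤ X → 0 ≤ Z →
      (∀ h, complexRep ρ b (c (latticeAct σ h k)) -
        c (latticeAct σ (1⁻¹ * b * 1) (latticeAct σ h k)) = M (latticeAct σ h k)) →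
      (∀ h, ‖c (latticeAct σ h k)‖ ≤
        Z * (S.majorant r (latticeAct σ h k) + S.majorant r' (latticeAct σ h k))) →
      (∀ h, ‖M (latticeAct σ h k)‖ ≤
        X * (S.majorant r (latticeAct σ h k) + S.majorant r' (latticeAct σ h k))) →
      ‖c k‖ ≤ C' * X * (S.majorant r k + S.majorant r' k)) →
      ‖𝒲₁ (R g) k - 𝒲₂ (R g) k‖ ≤ C' * ((C₁ + C₂) * X) * (S.majorant r₁ k + S.majorant r₂ k) := by
    intro a C' hC' ha₁ ha₂ hb
    -- The coboundary over `b` of the difference of the two solutions is the difference of their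
    -- residuals. Two majorants are needed because the forward solution is bounded by the one for
    -- `r₁`, the backward solution by the one for `r₂`.
    refine hb r₁ r₂ k ha₁ ha₂ (fun l => 𝒲₁ (R g) l - 𝒲₂ (R g) l)
      (fun l => coefResidual ρ σ R (𝒲₂ (R g)) (iterComm g b 0) l -
        coefResidual ρ σ R (𝒲₁ (R g)) (iterComm g b 0) l)
      ((C₁ + C₂) * X) ((C₅ + C₆) * Z) (by positivity) (by positivity) (fun h => ?_) (fun h => ?_)
      (fun h => ?_)
    · simp only [iterComm, coefResidual, coefDelta, map_sub, inv_one, one_mul, mul_one]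
      abel
    · have e1 := (h₅ r₁ _ (latticeAct_ne_zero σ h hk) (hd₁.act h) _ Z hZ hg).1
      have e2 := (h₆ r₂ _ (latticeAct_ne_zero σ h hk) (hd₂.act h) _ Z hZ hg).1
      refine (norm_sub_le _ _).trans ((add_le_add e1 e2).trans ?_)
      have := mul_nonneg (mul_nonneg (zero_le_one.trans hC₅) hZ) (hP₂ (latticeAct σ h k))
      have := mul_nonneg (mul_nonneg (zero_le_one.trans hC₆) hZ) (hP₁ (latticeAct σ h k))
      linarith
    · have e1 := h₁ r₁ _ (latticeAct_ne_zero σ h hk) (hd₁.act h) R X Z hX hZ hg hR hL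
      have e2 := h₂ r₂ _ (latticeAct_ne_zero σ h hk) (hd₂.act h) R X Z hX hZ hg hR hL
      refine (norm_sub_le _ _).trans ((add_le_add e2 e1).trans ?_)
      have := mul_nonneg (mul_nonneg (zero_le_one.trans hC₁) hX) (hP₂ (latticeAct σ h k))
      have := mul_nonneg (mul_nonneg (zero_le_one.trans hC₂) hX) (hP₁ (latticeAct σ h k))
      linarith
  have hfin : ‖𝒲₁ (R g) k - 𝒲₂ (R g) k‖ ≤
      (C₃ + C₄) * ((C₁ + C₂) * X) * (S.majorant r₁ k + S.majorant r₂ k) := by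
    have hnn : 0 ≤ (C₁ + C₂) * X * (S.majorant r₁ k + S.majorant r₂ k) :=
      mul_nonneg (by positivity) (add_nonneg (hP₁ k) (hP₂ k))
    have hn₃ := mul_nonneg (zero_le_one.trans hC₃) hnn
    have hn₄ := mul_nonneg (zero_le_one.trans hC₄) hnn
    have hb₁ := mul_nonneg ht₁ hyβ
    have hb₂ := mul_nonneg ht₂ hyβ
    rcases hy with rfl | rfl
    · have := key S.β C₃ hC₃ ⟨hadm₁, hsum₁, by rw [hrβ₁]; linarith⟩
        ⟨hadm₂, hsum₂, by rw [hrβ₂]; linarith⟩ h₃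
      linarith
    · have := key (-S.β) C₄ hC₄ ⟨hadm₁, hsum₁, by
          simp only [Pi.neg_apply, mul_neg, Finset.sum_neg_distrib]; rw [hrβ₁]; linarith⟩
        ⟨hadm₂, hsum₂, by
          simp only [Pi.neg_apply, mul_neg, Finset.sum_neg_distrib]; rw [hrβ₂]; linarith⟩ h₄
      linarith
  refine hfin.trans ?_
  have h7 := mul_le_mul_of_nonneg_left (add_le_add hm₁ hm₂)
    (show 0 ≤ (C₃ + C₄) * ((C₁ + C₂) * X) by positivity)
  linarith

end WeightSystem

end CocycleCoefficients

/-! ### Gluing the two solutions and estimating the residuals. -/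

section GlobalSolution

variable {N : ℕ} {H : Type*} [Group H] {ρ σ : H →* GL (Fin N) ℤ} {g b : H}

/-- Decay faster than any power of the norm. -/
def RapidDecay (f : (Fin N → ℤ) → Fin N → ℂ) : Prop :=
  ∀ t : ℝ, 0 ≤ t → ∃ Z : ℝ, 0 ≤ Z ∧ HasDecay t Z f

theorem RapidDecay.residual {R : H → (Fin N → ℤ) → Fin N → ℂ} {W : (Fin N → ℤ) → Fin N → ℂ} {h : H}
    (hR : RapidDecay (R h)) (hW : RapidDecay W) : RapidDecay (coefResidual ρ σ R W h) := by
  intro t ht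
  obtain ⟨Z₁, hZ₁, h₁⟩ := hR t ht
  obtain ⟨Z₂, hZ₂, h₂⟩ := hW t ht
  obtain ⟨C, hC, h₃⟩ := exists_hasDecay_coefDelta ρ σ h ht
  exact ⟨Z₁ + C * Z₂, by positivity, h₁.sub (h₃ W Z₂ hZ₂ h₂)⟩

namespace WeightSystem

variable (S : WeightSystem (complexRep σ) g b)

/-- The weight component `i` of `k` is at least as large as the others. -/
def IsDominant (i : S.ι) (k : Fin N → ℤ) : Prop :=
  ∀ j, ‖S.proj j (intVec k)‖ ≤ ‖S.proj i (intVec k)‖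

theorem exists_isDominant {k : Fin N → ℤ} (hk : k ≠ 0) : ∃ i, S.IsDominant i k := by
  obtain ⟨i₀, -⟩ := S.exists_proj_ne_zero (intVec_ne_zero hk)
  obtain ⟨i, -, hi⟩ := Finset.exists_max_image Finset.univ (fun i => ‖S.proj i (intVec k)‖)
    ⟨i₀, Finset.mem_univ _⟩
  exact ⟨i, fun j => hi j (Finset.mem_univ j)⟩

variable {S}

theorem IsDominant.norm_le {i : S.ι} {k : Fin N → ℤ} (h : S.IsDominant i k) :
    ‖k‖ ≤ Fintype.card S.ι * ‖S.proj i (intVec k)‖ := by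
  rw [← norm_intVec, ← S.sum_proj_apply (intVec k)]
  refine (norm_sum_le _ _).trans ((Finset.sum_le_sum fun j _ => h j).trans_eq ?_)
  rw [Finset.sum_const, Finset.card_univ, nsmul_eq_mul, S.sum_proj_apply]

variable (S)

/-- A fixed order of decay makes both the forward and the backward sum solve the first equation at
every nonzero frequency, with no information on the size of the components. -/
theorem exists_decaying (hper : NoPeriodicVectors σ g b) {s : ℝ} (hs : 0 ≤ s) :
    ∃ T : ℝ, 0 ≤ T ∧ ∀ k : Fin N → ℤ, k ≠ 0 →
      (∃ r, S.Decaying S.α s T r k) ∧ ∃ r, S.Decaying (-S.α) s T r k := by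
  obtain ⟨B, hB, hν⟩ := S.exists_exponents hper
  have key : ∀ k : Fin N → ℤ, k ≠ 0 → ∀ x : ℝ, |x| ≤ 1 → ∃ r, S.Admissible r k ∧ ∑ i, r i ≤ s * B ∧
      ∑ i, r i * S.α i = s * x := by
    intro k hk x hx
    obtain ⟨ν, h0, hk', hB', hα, -⟩ := hν k hk x 0 hx (by simp)
    refine ⟨s • ν, fun i => ⟨mul_nonneg hs (h0 i), fun hi => hk' i fun h => hi (by simp [h])⟩, ?_, ?_⟩
    · simp only [Pi.smul_apply, smul_eq_mul, ← Finset.mul_sum]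
      exact mul_le_mul_of_nonneg_left hB' hs
    · simp only [Pi.smul_apply, smul_eq_mul, mul_assoc, ← Finset.mul_sum, hα]
  refine ⟨s * B, by positivity, fun k hk => ⟨?_, ?_⟩⟩
  · obtain ⟨r, h1, h2, h3⟩ := key k hk 1 (by simp)
    exact ⟨r, h1, h2, by rw [h3]; linarith⟩
  · obtain ⟨r, h1, h2, h3⟩ := key k hk (-1) (by simp)
    exact ⟨r, h1, h2, by
      simp only [Pi.neg_apply, mul_neg, Finset.sum_neg_distrib]; rw [h3]; linarith⟩

/-- Here `θ` is a point mass at a dominant component, whose own drift already has the favourable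
sign. -/
theorem exists_dominant_exponents (hper : NoPeriodicVectors σ g b) {s : ℝ} (hs : 0 ≤ s) :
    ∃ s₁ : ℝ, 0 ≤ s₁ ∧ ∀ t : ℝ, 0 ≤ t → ∃ C : ℝ, 1 ≤ C ∧ ∀ k : Fin N → ℤ, k ≠ 0 → ∀ i,
      S.IsDominant i k →
      (0 ≤ S.α i → ∃ r, S.Decaying S.α s (t + s₁) r k ∧ S.majorant r k ≤ C * ‖k‖ ^ (-t)) ∧
      (S.α i < 0 → ∃ r, S.Decaying (-S.α) s (t + s₁) r k ∧ S.majorant r k ≤ C * ‖k‖ ^ (-t)) := by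
  classical
  obtain ⟨s₁, hs₁, h⟩ := S.exists_concentrated_exponents hper hs
  refine ⟨s₁, hs₁, fun t ht => ?_⟩
  obtain ⟨C, hC, hb⟩ := h t (Fintype.card S.ι + 1) ht (by
    have := Nat.cast_nonneg (α := ℝ) (Fintype.card S.ι); linarith)
  refine ⟨C, hC, fun k hk i hi => ?_⟩
  have hsum : ∀ f : S.ι → ℝ, ∑ j, (Pi.single i 1 : S.ι → ℝ) j * f j = f i := fun f => by
    simp [Pi.single_apply]
  have key := hb k hk (Pi.single i 1)
    (fun j => by by_cases hj : j = i <;> simp [hj])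
    (by simp)
    (fun j hj => by
      have : j = i := by
        by_contra hne
        exact hj (Pi.single_eq_of_ne hne _)
      rw [this]
      refine hi.norm_le.trans (mul_le_mul_of_nonneg_right (by linarith) (norm_nonneg _)))
  simp only [hsum] at key
  refine ⟨fun hα => ?_, fun hα => ?_⟩
  · obtain ⟨r, h1, h2, ⟨t', ht', h3, -⟩, h4⟩ := key 1 0 (by simp) (by simp)
    exact ⟨r, ⟨h1, h2, by rw [h3]; linarith [mul_nonneg ht' hα]⟩, h4⟩
  · obtain ⟨r, h1, h2, ⟨t', ht', h3, -⟩, h4⟩ := key (-1) 0 (by simp) (by simp)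
    refine ⟨r, ⟨h1, h2, ?_⟩, h4⟩
    simp only [Pi.neg_apply, mul_neg, Finset.sum_neg_distrib]
    rw [h3]
    linarith [mul_nonneg ht' (neg_nonneg.2 hα.le)]

/-- A priori decay of rapidly decaying solutions of twisted cohomological equations. -/
theorem exists_decay_of_equation (hper : NoPeriodicVectors σ g b) {s : ℝ} (hs : 0 ≤ s)
    (h₁ : S.HasAPrioriBounds ρ g S.α s) (h₂ : S.HasAPrioriBounds ρ g (-S.α) s) :
    ∃ s₁ : ℝ, 0 ≤ s₁ ∧ ∀ (d : H) (t : ℝ), 0 ≤ t → ∃ C : ℝ, 1 ≤ C ∧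
      ∀ (c M : (Fin N → ℤ) → Fin N → ℂ) (X : ℝ), 0 ≤ X → RapidDecay c →
      (∀ k, complexRep ρ g (c k) - c (latticeAct σ (d⁻¹ * g * d) k) = M k) →
      HasDecay (t + s₁) X M → HasDecay t (C * X) c := by
  obtain ⟨s₁, hs₁, hexp⟩ := S.exists_dominant_exponents hper hs
  refine ⟨s₁, hs₁, fun d t ht => ?_⟩
  obtain ⟨C₀, hC₀, h₀⟩ := hexp t ht
  obtain ⟨C₁, hC₁, h₁⟩ := h₁ d (t + s₁)
  obtain ⟨C₂, hC₂, h₂⟩ := h₂ d (t + s₁)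
  obtain ⟨C₃, hC₃, h₃⟩ := S.exists_rpow_le_majorant (t + s₁)
  refine ⟨(C₁ + C₂) * C₃ * (2 * C₀), one_le_mul_of_one_le_of_one_le
    (one_le_mul_of_one_le_of_one_le (by linarith) hC₃) (by linarith),
    fun c M X hX hc heq hM k hk => ?_⟩
  obtain ⟨Z, hZ, hcZ⟩ := hc (t + s₁) (by linarith)
  have hbd : ∀ {f : (Fin N → ℤ) → Fin N → ℂ} {Y : ℝ} {r : S.ι → ℝ} {a : S.ι → ℝ}, 0 ≤ Y →
      HasDecay (t + s₁) Y f → S.Decaying a s (t + s₁) r k → ∀ h, ‖f (latticeAct σ h k)‖ ≤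
        C₃ * Y * (S.majorant r (latticeAct σ h k) + S.majorant r (latticeAct σ h k)) := by
    intro f Y r a hY hf hr h
    have h0 := latticeAct_ne_zero σ h hk
    have e1 := mul_le_mul_of_nonneg_left (h₃ r _ h0 (hr.act h).admissible hr.sum_le) hY
    have e2 := mul_nonneg (mul_nonneg (zero_le_one.trans hC₃) hY)
      (S.majorant_nonneg r (latticeAct σ h k))
    exact (hf _ h0).trans (by linarith)
  have hfin : ∀ {r : S.ι → ℝ} {C' : ℝ}, C' ≤ C₁ + C₂ → S.majorant r k ≤ C₀ * ‖k‖ ^ (-t) →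
      ‖c k‖ ≤ C' * (C₃ * X) * (S.majorant r k + S.majorant r k) →
      ‖c k‖ ≤ (C₁ + C₂) * C₃ * (2 * C₀) * X * ‖k‖ ^ (-t) := by
    intro r C' hC' hr h
    have hm := S.majorant_nonneg r k
    calc _ ≤ _ := h
      _ ≤ (C₁ + C₂) * (C₃ * X) * (C₀ * ‖k‖ ^ (-t) + C₀ * ‖k‖ ^ (-t)) := by
          refine mul_le_mul (mul_le_mul_of_nonneg_right hC' (by positivity)) (add_le_add hr hr)
            (add_nonneg hm hm) (by positivity)
      _ = _ := by ring
  obtain ⟨i, hi⟩ := S.exists_isDominant hk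
  rcases le_or_gt 0 (S.α i) with hα | hα
  · obtain ⟨r, hr, hrm⟩ := (h₀ k hk i hi).1 hα
    exact hfin (by linarith) hrm (h₁ r r k hr hr c M (C₃ * X) (C₃ * Z) (by positivity)
      (by positivity) (fun h => heq _) (hbd hZ hcZ hr) (hbd hX hM hr))
  · obtain ⟨r, hr, hrm⟩ := (h₀ k hk i hi).2 hα
    exact hfin (by linarith) hrm (h₂ r r k hr hr c M (C₃ * X) (C₃ * Z) (by positivity)
      (by positivity) (fun h => heq _) (hbd hZ hcZ hr) (hbd hX hM hr))

/-- The solution of the first twisted equation, with losses of decay that do not depend on the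
order, and with residual controlled by the cocycle difference. -/
theorem exists_solution_first (S : WeightSystem (complexRep σ) g b)
    (ρ : H →* GL (Fin N) ℤ) (hper : NoPeriodicVectors σ g b) {n : ℕ}
    (hn : iterComm g b n = 1) : ∃ s₁ : ℝ, 0 ≤ s₁ ∧
    ∃ 𝒮 : ((Fin N → ℤ) → Fin N → ℂ) → (Fin N → ℤ) → Fin N → ℂ,
      (∀ t : ℝ, 0 ≤ t → ∃ C : ℝ, 1 ≤ C ∧ ∀ f X, 0 ≤ X → HasDecay (t + s₁) X f →
        HasDecay t (C * X) (𝒮 f)) ∧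
      ∀ t : ℝ, 0 ≤ t → ∃ C : ℝ, 1 ≤ C ∧ ∀ (R : H → (Fin N → ℤ) → Fin N → ℂ)
        (W : (Fin N → ℤ) → Fin N → ℂ) (X : ℝ), 0 ≤ X → RapidDecay (R g) →
        (∀ j ≤ n, RapidDecay (R (iterComm g b j))) → (∀ k ≠ 0, W k = 𝒮 (R g) k) →
        (∀ j ≤ n, HasDecay (t + s₁) X (coefCocycle ρ σ R g (iterComm g b j))) →
        HasDecay t (C * X) (coefResidual ρ σ R W g) := by
  classical
  obtain ⟨s, hs, hα₁, hα₂, hβ₁, hβ₂, ⟨𝒲₁, h𝒲₁⟩, 𝒲₂, h𝒲₂⟩ := S.exists_uniform_rate ρ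
  obtain ⟨s₁, hs₁, hdom⟩ := S.exists_dominant_exponents hper hs
  obtain ⟨s₂, hs₂, htr⟩ := exists_transition_bound hper hs hα₁ hα₂ hβ₁ hβ₂ h𝒲₁ h𝒲₂ hn
  obtain ⟨T, hT, hdec⟩ := S.exists_decaying hper hs
  -- The region where the forward sum is used; off it some dominant component has negative weight
  -- along `g` and the backward sum is used.
  set P : (Fin N → ℤ) → Prop := fun k => ∃ i, 0 ≤ S.α i ∧ S.IsDominant i k with hP
  have hnP : ∀ k, k ≠ 0 → ¬ P k → ∃ i, S.α i < 0 ∧ S.IsDominant i k := fun k hk h => by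
    obtain ⟨i, hi⟩ := S.exists_isDominant hk
    exact ⟨i, lt_of_not_ge fun h' => h ⟨i, h', hi⟩, hi⟩
  refine ⟨s₁ + s₂, by linarith, fun f k => if P k then 𝒲₁ f k else 𝒲₂ f k, fun t ht => ?_,
    fun t ht => ?_⟩
  · obtain ⟨C₀, hC₀, h₀⟩ := hdom t ht
    obtain ⟨C₁, hC₁, h₁⟩ := h𝒲₁ (t + s₁)
    obtain ⟨C₂, hC₂, h₂⟩ := h𝒲₂ (t + s₁)
    refine ⟨(C₁ + C₂) * C₀, one_le_mul_of_one_le_of_one_le (by linarith) hC₀,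
      fun f X hX hf k hk => ?_⟩
    replace hf := hf.mono (t' := t + s₁) (by linarith) le_rfl hX
    have hfin : ∀ {r : S.ι → ℝ} {C' : ℝ} {v : Fin N → ℂ}, C' ≤ C₁ + C₂ →
        S.majorant r k ≤ C₀ * ‖k‖ ^ (-t) →
        ‖v‖ ≤ C' * X * S.majorant r k → ‖v‖ ≤ (C₁ + C₂) * C₀ * X * ‖k‖ ^ (-t) := by
      intro r C' v hC' hr h
      calc _ ≤ _ := h
        _ ≤ (C₁ + C₂) * X * (C₀ * ‖k‖ ^ (-t)) :=
            mul_le_mul (mul_le_mul_of_nonneg_right hC' hX) hr (S.majorant_nonneg r k)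
              (by positivity)
        _ = _ := by ring
    by_cases hk' : P k
    · simp only [if_pos hk']
      obtain ⟨i, hα, hi⟩ := hk'
      obtain ⟨r, hr, hrm⟩ := (h₀ k hk i hi).1 hα
      exact hfin (by linarith) hrm (h₁ r k hk hr f X hX hf).1
    · simp only [if_neg hk']
      obtain ⟨i, hα, hi⟩ := hnP k hk hk'
      obtain ⟨r, hr, hrm⟩ := (h₀ k hk i hi).2 hα
      exact hfin (by linarith) hrm (h₂ r k hk hr f X hX hf).1
  · obtain ⟨D₁, hD₁, hd₁⟩ := exists_rep_bound σ g
    obtain ⟨D₂, hD₂, hd₂⟩ := S.exists_proj_comparison g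
    set m : ℝ := Fintype.card S.ι + 1 with hm
    have hm1 : 1 ≤ m := by have := Nat.cast_nonneg (α := ℝ) (Fintype.card S.ι); linarith
    set c := D₁ * (m * D₂) with hc
    have hc1 : 1 ≤ c := one_le_mul_of_one_le_of_one_le hD₁ (one_le_mul_of_one_le_of_one_le hm1 hD₂)
    obtain ⟨C, hC, h⟩ := htr t c ht hc1
    obtain ⟨C', hC', h'⟩ := exists_rpow_act_le σ g ht
    refine ⟨C * C', one_le_mul_of_one_le_of_one_le hC hC', fun R W X hX hRg hR hW hL k hk => ?_⟩
    have hk' := latticeAct_ne_zero σ g hk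
    set k' := latticeAct σ g k with hk'def
    -- A component dominant at `k` stays comparable with the norm after one application of `g`, so
    -- at a change of region both kinds of component are large at `k'`.
    have hbig : ∀ i, S.IsDominant i k → ‖k'‖ ≤ c * ‖S.proj i (intVec k')‖ := by
      intro i hi
      have e1 := hd₁ (intVec k)
      rw [complexRep_intVec, norm_intVec, norm_intVec] at e1
      have e2 := hd₂ i (intVec k)
      rw [complexRep_intVec] at e2
      calc ‖k'‖ ≤ D₁ * ‖k‖ := e1
        _ ≤ D₁ * (m * ‖S.proj i (intVec k)‖) := by
            refine mul_le_mul_of_nonneg_left (hi.norm_le.trans ?_) (by linarith)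
            exact mul_le_mul_of_nonneg_right (by linarith) (norm_nonneg _)
        _ ≤ D₁ * (m * (D₂ * ‖S.proj i (intVec k')‖)) := by gcongr
        _ = _ := by rw [hc]; ring
    have hbig' : ∀ i, S.IsDominant i k' → ‖k'‖ ≤ c * ‖S.proj i (intVec k')‖ := by
      intro i hi
      refine hi.norm_le.trans (mul_le_mul_of_nonneg_right ?_ (norm_nonneg _))
      calc (Fintype.card S.ι : ℝ) ≤ 1 * (m * 1) := by rw [hm]; linarith
        _ ≤ c := by rw [hc]; gcongr
    obtain ⟨Z, hZ, hgZ, hRZ⟩ : ∃ Z, 0 ≤ Z ∧ HasDecay (t + s₂) Z (R g) ∧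
        ∀ j ≤ n, HasDecay (t + s₂) Z (R (iterComm g b j)) := by
      obtain ⟨Z₀, hZ₀, h₀⟩ := hRg (t + s₂) (by linarith)
      choose! Z hZ h using fun j hj => hR j hj (t + s₂) (by linarith)
      have hsum : 0 ≤ ∑ j ∈ Finset.range (n + 1), Z j :=
        Finset.sum_nonneg fun j hj => hZ j (Nat.lt_succ_iff.1 (Finset.mem_range.1 hj))
      refine ⟨Z₀ + ∑ j ∈ Finset.range (n + 1), Z j, by positivity,
        h₀.mono le_rfl (by linarith) (by positivity), fun j hj =>
        (h j hj).mono le_rfl ?_ (by positivity)⟩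
      have := Finset.single_le_sum (f := Z) (s := Finset.range (n + 1))
        (fun j hj => hZ j (Nat.lt_succ_iff.1 (Finset.mem_range.1 hj)))
        (Finset.mem_range.2 (Nat.lt_succ_of_le hj))
      linarith
    obtain ⟨Y, hY, hgY⟩ := hRg T hT
    have hsol₁ : coefDelta ρ σ g (𝒲₁ (R g)) k = R g k := by
      obtain ⟨r, hr⟩ := (hdec k hk).1
      obtain ⟨_, -, h₁⟩ := h𝒲₁ T
      exact (h₁ r k hk hr (R g) Y hY hgY).2
    have hsol₂ : coefDelta ρ σ g (𝒲₂ (R g)) k = R g k := by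
      obtain ⟨r, hr⟩ := (hdec k hk).2
      obtain ⟨_, -, h₁⟩ := h𝒲₂ T
      exact (h₁ r k hk hr (R g) Y hY hgY).2
    have hbound : ∀ i₁ i₂, 0 ≤ S.α i₁ → S.α i₂ < 0 → ‖k'‖ ≤ c * ‖S.proj i₁ (intVec k')‖ →
        ‖k'‖ ≤ c * ‖S.proj i₂ (intVec k')‖ →
        ‖𝒲₁ (R g) k' - 𝒲₂ (R g) k'‖ ≤ C * C' * X * ‖k‖ ^ (-t) := by
      intro i₁ i₂ h1 h2 h3 h4
      have h5 := h k' hk' i₁ i₂ h1 h2 h3 h4 R X Z hX hZ hgZ hRZ fun j hj =>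
        (hL j hj).mono (by linarith) le_rfl hX
      have h6 := mul_le_mul_of_nonneg_left (h' k hk) (show 0 ≤ C * X by positivity)
      refine h5.trans (h6.trans_eq (by ring))
    have hzero : 0 ≤ C * C' * X * ‖k‖ ^ (-t) := by positivity
    rw [coefResidual, coefDelta, hW k hk, hW k' hk']
    by_cases h1 : P k <;> by_cases h2 : P k'
    · simp only [if_pos h1, if_pos h2]
      rw [← hsol₁, coefDelta, sub_self, norm_zero]
      exact hzero
    -- As both sums solve the equation exactly at `k`, the residual is the difference of the two
    -- solutions at `k'`, up to sign.
    · simp only [if_pos h1, if_neg h2]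
      rw [← hsol₁, coefDelta]
      obtain ⟨i₁, hα, hi₁⟩ := h1
      obtain ⟨i₂, hα', hi₂⟩ := hnP k' hk' h2
      refine le_trans (le_of_eq ?_) (hbound i₁ i₂ hα hα' (hbig i₁ hi₁) (hbig' i₂ hi₂))
      rw [← norm_neg]
      congr 1
      abel
    · simp only [if_neg h1, if_pos h2]
      rw [← hsol₂, coefDelta]
      obtain ⟨i₁, hα, hi₁⟩ := h2
      obtain ⟨i₂, hα', hi₂⟩ := hnP k hk h1
      refine le_trans (le_of_eq ?_) (hbound i₁ i₂ hα hα' (hbig' i₁ hi₁) (hbig i₂ hi₂))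
      congr 1
      abel
    · simp only [if_neg h1, if_neg h2]
      rw [← hsol₂, coefDelta, sub_self, norm_zero]
      exact hzero

/-- The approximate solution of the family of twisted equations on the Fourier side, off the
origin. -/
theorem exists_solution_family (S : WeightSystem (complexRep σ) g b)
    (ρ : H →* GL (Fin N) ℤ) (hper : NoPeriodicVectors σ g b) {n : ℕ}
    (hn : iterComm g b n = 1) : ∃ s₁ : ℝ, 0 ≤ s₁ ∧
    ∃ 𝒮 : ((Fin N → ℤ) → Fin N → ℂ) → (Fin N → ℤ) → Fin N → ℂ,
      (∀ t : ℝ, 0 ≤ t → ∃ C : ℝ, 1 ≤ C ∧ ∀ f X, 0 ≤ X → HasDecay (t + s₁) X f →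
        HasDecay t (C * X) (𝒮 f)) ∧
      ∀ t : ℝ, 0 ≤ t → ∃ C : ℝ, 1 ≤ C ∧ ∀ (R : H → (Fin N → ℤ) → Fin N → ℂ)
        (W : (Fin N → ℤ) → Fin N → ℂ) (X : ℝ), 0 ≤ X → RapidDecay (R g) →
        (∀ j ≤ n, RapidDecay (R (iterComm g b j))) → (∀ k ≠ 0, W k = 𝒮 (R g) k) →
        (∀ j ≤ n, HasDecay (t + s₁) X (coefCocycle ρ σ R g (iterComm g b j))) →
        HasDecay t (C * X) (coefResidual ρ σ R W g) ∧
        ∀ j ≤ n, HasDecay t (C * X) (coefResidual ρ σ R W (iterComm g b j)) := by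
  obtain ⟨s₁, hs₁, 𝒮, h𝒮, hres⟩ := S.exists_solution_first ρ hper hn
  obtain ⟨s, hs, hα₁, hα₂, -⟩ := S.exists_uniform_rate ρ
  obtain ⟨s₂, hs₂, hsol⟩ := S.exists_decay_of_equation hper hs hα₁ hα₂
  have key : ∀ i, i ≤ n → ∃ s' : ℝ, 0 ≤ s' ∧ ∀ t : ℝ, 0 ≤ t → ∃ C : ℝ, 1 ≤ C ∧
      ∀ (R : H → (Fin N → ℤ) → Fin N → ℂ)
        (W : (Fin N → ℤ) → Fin N → ℂ) (X : ℝ), 0 ≤ X → RapidDecay (R g) →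
        (∀ j ≤ n, RapidDecay (R (iterComm g b j))) → (∀ k ≠ 0, W k = 𝒮 (R g) k) →
        (∀ j ≤ n, HasDecay (t + s') X (coefCocycle ρ σ R g (iterComm g b j))) →
        ∀ j, i ≤ j → j ≤ n → HasDecay t (C * X) (coefResidual ρ σ R W (iterComm g b j)) := by
    intro i hi
    induction hi using Nat.decreasingInduction with
    | self =>
      refine ⟨0, le_rfl, fun t ht => ?_⟩
      obtain ⟨C, hC, h⟩ := exists_hasDecay_act σ g⁻¹ ht
      refine ⟨C, hC, fun R W X hX hRg hR hW hL j hj hj' => ?_⟩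
      obtain rfl := le_antisymm hj hj'
      have h1 := h _ X hX (by simpa only [add_zero] using hL n le_rfl)
      rw [hn, coefResidual_one]
      intro l hl
      have h2 := h1 l hl
      simp only at h2
      rwa [hn, coefCocycle_one, norm_neg, ← latticeAct_mul, mul_inv_cancel, latticeAct_one] at h2
    | of_succ i hin ih =>
      obtain ⟨s', hs', ih⟩ := ih
      refine ⟨s₁ + s₂ + s', by linarith, fun t ht => ?_⟩
      obtain ⟨C₁, hC₁, h₁⟩ := ih (t + s₂) (by linarith)
      set y := iterComm g b i with hy
      have hz : iterComm g b (i + 1) = g⁻¹ * y⁻¹ * g * y := rfl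
      obtain ⟨C₂, hC₂, h₂⟩ := hsol y t ht
      obtain ⟨C₃, hC₃, h₃⟩ := hres (t + s₂) (by linarith)
      obtain ⟨C₄, hC₄, h₄⟩ := exists_hasDecay_act σ y (t := t + s₂) (by linarith)
      obtain ⟨C₅, hC₅, h₅⟩ := exists_hasDecay_act σ (g⁻¹ * y⁻¹ * g * y) (t := t + s₂) (by linarith)
      obtain ⟨C₆, hC₆, h₆⟩ := exists_hasDecay_rep ρ y
      obtain ⟨C₇, hC₇, h₇⟩ := exists_hasDecay_rep ρ (y * g)
      have hK : 0 ≤ 1 + C₄ * C₃ + C₆ * (C₅ * C₃) + C₇ * C₁ := by positivity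
      refine ⟨C₁ + C₂ * (1 + C₄ * C₃ + C₆ * (C₅ * C₃) + C₇ * C₁), by
        have := mul_nonneg (zero_le_one.trans hC₂) hK; linarith,
        fun R W X hX hRg hR hW hL j hj hj' => ?_⟩
      have hpos : 0 ≤ C₂ * (1 + C₄ * C₃ + C₆ * (C₅ * C₃) + C₇ * C₁) * X := by positivity
      have hL' : ∀ {t'}, t' ≤ t + (s₁ + s₂ + s') → ∀ j ≤ n,
          HasDecay t' X (coefCocycle ρ σ R g (iterComm g b j)) := fun ht' j hj =>
        (hL j hj).mono ht' le_rfl hX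
      have hpre := h₁ R W X hX hRg hR hW (hL' (by linarith))
      rcases hj.lt_or_eq with hlt | rfl
      · exact (hpre j hlt hj').mono (by linarith) (by linarith) (by positivity)
      -- Rapid decay of the residual is what the a priori estimate needs; its constants do not enter
      -- the final bound.
      have hWrapid : RapidDecay W := by
        intro t' ht'
        obtain ⟨C', hC', h'⟩ := h𝒮 t' ht'
        obtain ⟨Z, hZ, hRZ⟩ := hRg (t' + s₁) (by linarith)
        refine ⟨C' * Z, by positivity, fun k hk => ?_⟩
        rw [hW k hk]
        exact h' _ Z hZ hRZ k hk
      have hres₁ := h₃ R W X hX hRg hR hW (hL' (by linarith))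
      -- Right side of the equation over `y⁻¹ g y`: unlike in the pointwise estimate, the glued
      -- solution leaves a residual of `g`, already bounded by cocycle differences.
      have hdec : HasDecay (t + s₂) ((1 + C₄ * C₃ + C₆ * (C₅ * C₃) + C₇ * C₁) * X)
          (fun k => coefCocycle ρ σ (coefResidual ρ σ R W) g y k
            - coefResidual ρ σ R W g (latticeAct σ y k)
            + complexRep ρ y (coefResidual ρ σ R W g (latticeAct σ (g⁻¹ * y⁻¹ * g * y) k))
            + complexRep ρ (y * g) (coefResidual ρ σ R W (g⁻¹ * y⁻¹ * g * y) k)) := by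
        have e1 : HasDecay (t + s₂) X (coefCocycle ρ σ (coefResidual ρ σ R W) g y) := by
          intro k hk
          rw [coefCocycle_residual]
          exact hL' (t' := t + s₂) (by linarith) i hin.le k hk
        have e2 := h₄ _ _ (by positivity) hres₁
        have e3 := h₆ _ _ _ (h₅ _ _ (by positivity) hres₁)
        have e4 := h₇ _ _ _ (hpre (i + 1) le_rfl hin)
        refine (((e1.sub e2).add e3).add e4).mono le_rfl (le_of_eq (by ring)) (by positivity)
      have := h₂ (coefResidual ρ σ R W y) _ _ (by positivity)
        (RapidDecay.residual (hR i hin.le) hWrapid) (fun k => coefCocycle_eq _ y k) hdec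
      refine this.mono le_rfl ?_ (by positivity)
      have : 0 ≤ C₁ * X := by positivity
      linarith
  obtain ⟨s', hs', h'⟩ := key 0 (Nat.zero_le n)
  refine ⟨s₁ + s', by linarith, 𝒮, fun t ht => ?_, fun t ht => ?_⟩
  · obtain ⟨C, hC, h⟩ := h𝒮 t ht
    exact ⟨C, hC, fun f X hX hf => h f X hX (hf.mono (by linarith) le_rfl hX)⟩
  · obtain ⟨C₁, hC₁, h₁⟩ := hres t ht
    obtain ⟨C₂, hC₂, h₂⟩ := h' t ht
    refine ⟨C₁ + C₂, by linarith, fun R W X hX hRg hR hW hL => ⟨?_, fun j hj => ?_⟩⟩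
    · exact (h₁ R W X hX hRg hR hW fun j hj => (hL j hj).mono (by linarith) le_rfl hX).mono le_rfl
        (mul_le_mul_of_nonneg_right (by linarith) hX) (by positivity)
    · exact (h₂ R W X hX hRg hR hW (fun j hj => (hL j hj).mono (by linarith) le_rfl hX) j
        (Nat.zero_le j) hj).mono le_rfl (mul_le_mul_of_nonneg_right (by linarith) hX)
        (by positivity)

end WeightSystem

end GlobalSolution

/-! ### Toral automorphisms, characters and the dual action. -/

section TorusAutomorphisms

open UnitAddTorus

variable {N : ℕ}

theorem isOpenQuotientMap_torusProj : IsOpenQuotientMap (torusProj (N := N)) :=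
  IsOpenQuotientMap.piMap fun _ => QuotientAddGroup.isOpenQuotientMap_mk

theorem torusProj_surjective : Function.Surjective (torusProj (N := N)) :=
  isOpenQuotientMap_torusProj.surjective

theorem torusProj_add (x y : Fin N → ℝ) : torusProj (x + y) = torusProj x + torusProj y := rfl

theorem torusProj_intCast (x : Fin N → ℝ) (m : Fin N → ℤ) :
    torusProj (x + fun i => (m i : ℝ)) = torusProj x := by
  funext i
  simp [torusProj]

theorem toralAut_torusProj (M : GL (Fin N) ℤ) (y : Fin N → ℝ) :
    toralAut M (torusProj y) = torusProj (linAct M y) := by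
  funext i
  simp only [toralAut, torusProj, linAct]
  have h : ∀ s : Finset (Fin N), ((∑ j ∈ s, (M.val i j : ℝ) * y j : ℝ) : UnitAddCircle) =
      ∑ j ∈ s, M.val i j • (y j : UnitAddCircle) := by
    intro s
    induction s using Finset.cons_induction with
    | empty => simp
    | cons a s ha ih =>
      rw [Finset.sum_cons, Finset.sum_cons, AddCircle.coe_add, ih, ← zsmul_eq_mul]
      rfl
  exact (h _).symm

theorem linAct_mul (A B : GL (Fin N) ℤ) (y : Fin N → ℝ) :
    linAct (A * B) y = linAct A (linAct B y) := by
  have h : ∀ M : GL (Fin N) ℤ, ∀ v, linAct M v = (M.val.map (Int.castRingHom ℝ)) *ᵥ v :=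
    fun M v => rfl
  rw [h, h, h, Matrix.mulVec_mulVec, ← Matrix.map_mul, Units.val_mul]

theorem linAct_one (y : Fin N → ℝ) : linAct 1 y = y := by
  funext i
  simp [linAct, Matrix.one_apply]

theorem toralAut_mul (A B : GL (Fin N) ℤ) (x : UnitAddTorus (Fin N)) :
    toralAut (A * B) x = toralAut A (toralAut B x) := by
  obtain ⟨y, rfl⟩ := torusProj_surjective x
  rw [toralAut_torusProj, toralAut_torusProj, toralAut_torusProj, linAct_mul]

theorem toralAut_one (x : UnitAddTorus (Fin N)) : toralAut 1 x = x := by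
  obtain ⟨y, rfl⟩ := torusProj_surjective x
  rw [toralAut_torusProj, linAct_one]

theorem continuous_toralAut (M : GL (Fin N) ℤ) : Continuous (toralAut M) := by
  unfold toralAut
  fun_prop

/-- A continuous surjective endomorphism of a compact group preserves Haar measure. -/
theorem measurePreserving_toralAut (M : GL (Fin N) ℤ) :
    MeasurePreserving (toralAut M) (volume : Measure (UnitAddTorus (Fin N))) volume := by
  let f : UnitAddTorus (Fin N) →+ UnitAddTorus (Fin N) :=
    { toFun := toralAut M
      map_zero' := by funext i; simp [toralAut]
      map_add' := fun x y => by funext i; simp [toralAut, Finset.sum_add_distrib] }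
  exact AddMonoidHom.measurePreserving (f := f) (continuous_toralAut M)
    (fun x => ⟨toralAut M⁻¹ x, by
      change toralAut M (toralAut M⁻¹ x) = x
      rw [← toralAut_mul, mul_inv_cancel, toralAut_one]⟩) rfl

theorem mFourier_torusProj (k : Fin N → ℤ) (y : Fin N → ℝ) :
    mFourier k (torusProj y) = Complex.exp (2 * Real.pi * Complex.I * ((∑ i, k i * y i : ℝ) : ℂ)) := by
  simp only [mFourier, ContinuousMap.coe_mk, torusProj, fourier_coe_apply]
  rw [← Complex.exp_sum]
  congr 1
  push_cast
  rw [Finset.mul_sum]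
  exact Finset.sum_congr rfl fun i _ => by rw [div_one]; ring

theorem mFourier_apply_add (k : Fin N → ℤ) (x y : UnitAddTorus (Fin N)) :
    mFourier k (x + y) = mFourier k x * mFourier k y := by
  obtain ⟨x, rfl⟩ := torusProj_surjective x
  obtain ⟨y, rfl⟩ := torusProj_surjective y
  rw [← torusProj_add, mFourier_torusProj, mFourier_torusProj, mFourier_torusProj, ← Complex.exp_add]
  congr 1
  simp only [Pi.add_apply, mul_add, Finset.sum_add_distrib]
  push_cast
  ring

theorem mFourier_toralAut (M : GL (Fin N) ℤ) (k : Fin N → ℤ) (x : UnitAddTorus (Fin N)) :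
    mFourier k (toralAut M x) = mFourier (M.valᵀ *ᵥ k) x := by
  obtain ⟨x, rfl⟩ := torusProj_surjective x
  rw [toralAut_torusProj, mFourier_torusProj, mFourier_torusProj]
  congr 3
  simp only [linAct, Matrix.mulVec, dotProduct, Matrix.transpose_apply, Finset.mul_sum, Int.cast_sum,
    Int.cast_mul, Finset.sum_mul]
  rw [Finset.sum_comm]
  exact Finset.sum_congr rfl fun i _ => Finset.sum_congr rfl fun j _ => by ring

theorem norm_mFourier_apply (k : Fin N → ℤ) (x : UnitAddTorus (Fin N)) : ‖mFourier k x‖ = 1 := by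
  simp only [mFourier, ContinuousMap.coe_mk, fourier_apply, norm_prod]
  exact Finset.prod_eq_one fun i _ => Circle.norm_coe _

/-- The action dual to a homomorphism to `GL(N, ℤ)`. -/
def dualRep {H : Type*} [Group H] (ρ : H →* GL (Fin N) ℤ) : H →* GL (Fin N) ℤ where
  toFun h := ⟨(ρ h⁻¹).valᵀ, (ρ h).valᵀ,
    by rw [← Matrix.transpose_mul, ← Units.val_mul, ← map_mul, mul_inv_cancel, map_one]; simp,
    by rw [← Matrix.transpose_mul, ← Units.val_mul, ← map_mul, inv_mul_cancel, map_one]; simp⟩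
  map_one' := Units.ext (by simp)
  map_mul' x y := Units.ext (by simp [Matrix.transpose_mul])

theorem mFourier_toralAut_inv {H : Type*} [Group H] (ρ : H →* GL (Fin N) ℤ) (h : H) (k : Fin N → ℤ)
    (x : UnitAddTorus (Fin N)) :
    mFourier k (toralAut (ρ h)⁻¹ x) = mFourier (latticeAct (dualRep ρ) h k) x := by
  rw [← map_inv, mFourier_toralAut]
  rfl

end TorusAutomorphisms

/-! ### Fourier coefficients and their behaviour under the operators. -/

section FourierCoefficients

open UnitAddTorus

variable {N : ℕ}

/-- The Fourier coefficients of a real function on the torus. -/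
noncomputable def scalarCoeff (φ : UnitAddTorus (Fin N) → ℝ) (k : Fin N → ℤ) : ℂ :=
  ∫ t, mFourier (-k) t * (φ t : ℂ)

theorem volume_unitAddCircle : (volume : Measure UnitAddCircle) = AddCircle.haarAddCircle := by
  rw [AddCircle.volume_eq_smul_haarAddCircle]
  simp

theorem mFourierCoeff_eq_scalarCoeff (φ : UnitAddTorus (Fin N) → ℝ) (k : Fin N → ℤ) :
    mFourierCoeff (fun x => (φ x : ℂ)) k = scalarCoeff φ k := by
  have h : (volume : Measure (UnitAddTorus (Fin N))) =
      Measure.pi fun _ => (AddCircle.haarAddCircle : Measure UnitAddCircle) := by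
    rw [volume_pi, volume_unitAddCircle]
  rw [scalarCoeff, h]
  rfl

theorem integrable_mFourier_mul {φ : UnitAddTorus (Fin N) → ℝ} (hφ : Continuous φ)
    (k : Fin N → ℤ) : Integrable (fun t => mFourier k t * (φ t : ℂ)) :=
  Continuous.integrable_of_hasCompactSupport (by fun_prop) (HasCompactSupport.of_compactSpace _)

theorem scalarCoeff_add {φ ψ : UnitAddTorus (Fin N) → ℝ} (hφ : Continuous φ) (hψ : Continuous ψ)
    (k : Fin N → ℤ) : scalarCoeff (fun x => φ x + ψ x) k = scalarCoeff φ k + scalarCoeff ψ k := by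
  rw [scalarCoeff, scalarCoeff, scalarCoeff, ← integral_add (integrable_mFourier_mul hφ _)
    (integrable_mFourier_mul hψ _)]
  simp only [Complex.ofReal_add, mul_add]

theorem scalarCoeff_const_mul (φ : UnitAddTorus (Fin N) → ℝ) (c : ℝ) (k : Fin N → ℤ) :
    scalarCoeff (fun x => c * φ x) k = c * scalarCoeff φ k := by
  rw [scalarCoeff, scalarCoeff, ← integral_const_mul]
  simp only [Complex.ofReal_mul, mul_left_comm]

theorem scalarCoeff_sub {φ ψ : UnitAddTorus (Fin N) → ℝ} (hφ : Continuous φ) (hψ : Continuous ψ)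
    (k : Fin N → ℤ) : scalarCoeff (fun x => φ x - ψ x) k = scalarCoeff φ k - scalarCoeff ψ k := by
  rw [scalarCoeff, scalarCoeff, scalarCoeff, ← integral_sub (integrable_mFourier_mul hφ _)
    (integrable_mFourier_mul hψ _)]
  simp only [Complex.ofReal_sub, mul_sub]

theorem scalarCoeff_sum {ι : Type*} (s : Finset ι) {φ : ι → UnitAddTorus (Fin N) → ℝ}
    (hφ : ∀ i, Continuous (φ i)) (k : Fin N → ℤ) :
    scalarCoeff (fun x => ∑ i ∈ s, φ i x) k = ∑ i ∈ s, scalarCoeff (φ i) k := by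
  simp only [scalarCoeff]
  rw [← integral_finsetSum s fun i _ => integrable_mFourier_mul (hφ i) _]
  simp only [Complex.ofReal_sum, Finset.mul_sum]

theorem scalarCoeff_translate (φ : UnitAddTorus (Fin N) → ℝ) (τ : UnitAddTorus (Fin N))
    (k : Fin N → ℤ) : scalarCoeff (fun x => φ (x + τ)) k = mFourier k τ * scalarCoeff φ k := by
  have h : ∀ t, mFourier (-k) t * (φ (t + τ) : ℂ) =
      mFourier k τ * (mFourier (-k) (t + τ) * (φ (t + τ) : ℂ)) := by
    intro t
    have h1 : mFourier k τ * mFourier (-k) τ = 1 := by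
      rw [← mFourier_add, add_neg_cancel, mFourier_zero, ContinuousMap.one_apply]
    rw [mFourier_apply_add]
    linear_combination (-(mFourier (-k) t * (φ (t + τ) : ℂ))) * h1
  rw [scalarCoeff, scalarCoeff]
  simp only [h]
  rw [integral_const_mul, integral_add_right_eq_self (fun t => mFourier (-k) t * (φ t : ℂ)) τ]

theorem scalarCoeff_comp_toralAut {H : Type*} [Group H] (ρ : H →* GL (Fin N) ℤ) (h : H)
    {φ : UnitAddTorus (Fin N) → ℝ} (hφ : Continuous φ) (k : Fin N → ℤ) :
    scalarCoeff (fun x => φ (toralAut (ρ h) x)) k =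
      scalarCoeff φ (latticeAct (dualRep ρ) h k) := by
  have hmp := measurePreserving_toralAut (ρ h)
  have hneg : latticeAct (dualRep ρ) h (-k) = - latticeAct (dualRep ρ) h k := by
    simp [latticeAct, Matrix.mulVec_neg]
  have key := integral_map (μ := (volume : Measure (UnitAddTorus (Fin N))))
    (φ := toralAut (ρ h)) hmp.measurable.aemeasurable
    (f := fun t => mFourier (-latticeAct (dualRep ρ) h k) t * (φ t : ℂ))
    (Continuous.aestronglyMeasurable (by fun_prop))
  rw [hmp.map_eq] at key
  rw [scalarCoeff, scalarCoeff, key]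
  refine integral_congr_ae (Filter.Eventually.of_forall fun t => ?_)
  simp only
  rw [← hneg, ← mFourier_toralAut_inv, ← toralAut_mul, inv_mul_cancel, toralAut_one]

/-- The Fourier coefficients of a torus map. -/
noncomputable def torusCoeff (F : TorusMap N) (k : Fin N → ℤ) : Fin N → ℂ :=
  fun i => scalarCoeff (fun x => F x i) k

theorem IsSmoothTorusMap.continuous {F : TorusMap N} (hF : IsSmoothTorusMap F) : Continuous F :=
  isOpenQuotientMap_torusProj.isQuotientMap.continuous_iff.2 (ContDiff.continuous hF)

theorem IsSmoothTorusMap.continuous_apply {F : TorusMap N} (hF : IsSmoothTorusMap F) (i : Fin N) :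
    Continuous fun x => F x i :=
  (_root_.continuous_apply i).comp hF.continuous

theorem torusCoeff_add {F G : TorusMap N} (hF : Continuous F) (hG : Continuous G)
    (k : Fin N → ℤ) : torusCoeff (fun x => F x + G x) k = torusCoeff F k + torusCoeff G k := by
  funext i
  exact scalarCoeff_add ((_root_.continuous_apply i).comp hF) ((_root_.continuous_apply i).comp hG) k

theorem torusCoeff_sub {F G : TorusMap N} (hF : Continuous F) (hG : Continuous G)
    (k : Fin N → ℤ) : torusCoeff (fun x => F x - G x) k = torusCoeff F k - torusCoeff G k := by
  funext i
  exact scalarCoeff_sub ((_root_.continuous_apply i).comp hF) ((_root_.continuous_apply i).comp hG) k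

theorem torusCoeff_comp {H : Type*} [Group H] (ρ : H →* GL (Fin N) ℤ) (h : H) {F : TorusMap N}
    (hF : Continuous F) (k : Fin N → ℤ) :
    torusCoeff (fun x => F (toralAut (ρ h) x)) k = torusCoeff F (latticeAct (dualRep ρ) h k) := by
  funext i
  exact scalarCoeff_comp_toralAut ρ h ((_root_.continuous_apply i).comp hF) k

theorem complexRep_apply {H : Type*} [Group H] (ρ : H →* GL (Fin N) ℤ) (h : H) (v : Fin N → ℂ)
    (i : Fin N) : complexRep ρ h v i = ∑ j, ((ρ h).val i j : ℂ) * v j := rfl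

theorem torusCoeff_linAct {H : Type*} [Group H] (ρ : H →* GL (Fin N) ℤ) (h : H) {F : TorusMap N}
    (hF : Continuous F) (k : Fin N → ℤ) :
    torusCoeff (fun x => linAct (ρ h) (F x)) k = complexRep ρ h (torusCoeff F k) := by
  funext i
  rw [complexRep_apply]
  refine (scalarCoeff_sum Finset.univ (φ := fun j x => ((ρ h).val i j : ℝ) * F x j)
    (fun j => continuous_const.mul ((_root_.continuous_apply j).comp hF)) k).trans ?_
  refine Finset.sum_congr rfl fun j _ => ?_
  rw [scalarCoeff_const_mul, Complex.ofReal_intCast]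
  rfl

theorem continuous_linAct (M : GL (Fin N) ℤ) : Continuous (linAct M) := by
  unfold linAct
  fun_prop

theorem torusCoeff_cocycleDiff {H : Type*} [Group H] (ρ : H →* GL (Fin N) ℤ) {R : H → TorusMap N}
    {x y : H} (hx : Continuous (R x)) (hy : Continuous (R y))
    (hz : Continuous (R (x⁻¹ * y⁻¹ * x * y))) (k : Fin N → ℤ) :
    torusCoeff (cocycleDiff ρ R x y) k =
      coefCocycle ρ (dualRep ρ) (fun h => torusCoeff (R h)) x y k := by
  have hc := fun h => continuous_toralAut (ρ h)
  have hl := fun h => continuous_linAct (ρ h)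
  have h1 : Continuous fun p => R x (toralAut (ρ y) p) := hx.comp (hc y)
  have h2 : Continuous fun p => linAct (ρ x) (R y p) := (hl x).comp hy
  have h3 : Continuous fun p => R y (toralAut (ρ (x * (x⁻¹ * y⁻¹ * x * y))) p) := hy.comp (hc _)
  have h4' : Continuous fun p => R x (toralAut (ρ (x⁻¹ * y⁻¹ * x * y)) p) := hx.comp (hc _)
  have h4 : Continuous fun p => linAct (ρ y) (R x (toralAut (ρ (x⁻¹ * y⁻¹ * x * y)) p)) :=
    (hl y).comp h4'
  have h5 : Continuous fun p => linAct (ρ (y * x)) (R (x⁻¹ * y⁻¹ * x * y) p) := (hl _).comp hz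
  rw [coefCocycle, ← torusCoeff_comp ρ _ hx, ← torusCoeff_comp ρ _ hx, ← torusCoeff_comp ρ _ hy,
    ← torusCoeff_linAct ρ _ hy, ← torusCoeff_linAct ρ _ h4', ← torusCoeff_linAct ρ _ hz,
    ← torusCoeff_add h1 h2, ← torusCoeff_sub (h1.fun_add h2) h3, ← torusCoeff_sub ((h1.fun_add h2).fun_sub h3) h4,
    ← torusCoeff_sub (((h1.fun_add h2).fun_sub h3).fun_sub h4) h5]
  rfl

end FourierCoefficients

/-! ### From smoothness to decay of coefficients, and bounds for the norms. -/

section CoefficientDecay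

open UnitAddTorus

variable {N : ℕ}

theorem norm_iteratedFDeriv_sub_le {f : (Fin N → ℝ) → ℝ} {n : ℕ} (hf : ContDiff ℝ (n + 1) f) {B : ℝ}
    (hB : ∀ x, ‖iteratedFDeriv ℝ (n + 1) f x‖ ≤ B) (x y : Fin N → ℝ) :
    ‖iteratedFDeriv ℝ n f y - iteratedFDeriv ℝ n f x‖ ≤ B * ‖y - x‖ := by
  refine Convex.norm_image_sub_le_of_norm_fderiv_le (𝕜 := ℝ) (s := Set.univ) (fun z _ => ?_)
    (fun z _ => ?_) convex_univ (Set.mem_univ x) (Set.mem_univ y)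
  · exact (hf.differentiable_iteratedFDeriv (by exact_mod_cast Nat.lt_succ_self n)) z
  · rw [norm_fderiv_iteratedFDeriv]
    exact hB z

theorem volume_univ_unitAddTorus :
    (volume : Measure (UnitAddTorus (Fin N))).real Set.univ = 1 := by
  rw [Measure.real, volume_pi, Measure.pi_univ]
  simp

/-- Decay of the Fourier coefficients by iterated finite differences. -/
theorem norm_scalarCoeff_le {k : Fin N → ℤ} {v : Fin N → ℝ} (hv : mFourier k (torusProj v) = -1)
    (n : ℕ) : ∀ (φ : UnitAddTorus (Fin N) → ℝ) (B : ℝ), ContDiff ℝ ∞ (fun y => φ (torusProj y)) →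
      (∀ x, ‖iteratedFDeriv ℝ n (fun y => φ (torusProj y)) x‖ ≤ B) →
      ‖scalarCoeff φ k‖ ≤ (‖v‖ / 2) ^ n * B := by
  induction n with
  | zero =>
    intro φ B _ hB
    rw [pow_zero, one_mul, scalarCoeff]
    have := norm_integral_le_of_norm_le_const (μ := (volume : Measure (UnitAddTorus (Fin N))))
      (f := fun t => mFourier (-k) t * (φ t : ℂ)) (C := B)
      (Filter.Eventually.of_forall fun t => by
        obtain ⟨y, rfl⟩ := torusProj_surjective t
        have := hB y
        rw [norm_iteratedFDeriv_zero] at this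
        rw [norm_mul, norm_mFourier_apply, one_mul, Complex.norm_real]
        exact this)
    rwa [volume_univ_unitAddTorus, mul_one] at this
  | succ n ih =>
    intro φ B hφ hB
    have hcont : Continuous φ :=
      isOpenQuotientMap_torusProj.isQuotientMap.continuous_iff.2 hφ.continuous
    have hshift : ContDiff ℝ ∞ (fun y => φ (torusProj (y + v))) :=
      hφ.comp (contDiff_id.add contDiff_const)
    -- Translation by the half period `v` changes the sign of the coefficient, so differencing
    -- multiplies it by `-2`, while the mean value inequality trades one derivative for a factor
    -- `‖v‖`.
    have h1 := ih (fun x => φ (x + torusProj v) - φ x) (B * ‖v‖) (hshift.sub hφ) (fun x => by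
      have e : (fun y => φ (torusProj y + torusProj v) - φ (torusProj y)) =
          fun y => φ (torusProj (y + v)) - φ (torusProj y) := rfl
      rw [e, fun_iteratedFDeriv_sub_apply (hshift.contDiffAt.of_le (by exact_mod_cast le_top))
        (hφ.contDiffAt.of_le (by exact_mod_cast le_top)),
        iteratedFDeriv_comp_add_right (f := fun y => φ (torusProj y)) n v x]
      have := norm_iteratedFDeriv_sub_le (hφ.of_le (by exact_mod_cast le_top)) hB x (x + v)
      rwa [add_sub_cancel_left] at this)
    rw [scalarCoeff_sub (by fun_prop) hcont, scalarCoeff_translate, hv] at h1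
    have h2 : ‖-1 * scalarCoeff φ k - scalarCoeff φ k‖ = 2 * ‖scalarCoeff φ k‖ := by
      rw [show -1 * scalarCoeff φ k - scalarCoeff φ k = -2 * scalarCoeff φ k by ring, norm_mul]
      simp
    rw [h2] at h1
    rw [pow_succ]
    linarith

/-- The derivatives of a smooth function on the torus are bounded. -/
theorem exists_iteratedFDeriv_bound {φ : UnitAddTorus (Fin N) → ℝ}
    (hφ : ContDiff ℝ ∞ (fun y => φ (torusProj y))) (n : ℕ) :
    ∃ B : ℝ, ∀ x, ‖iteratedFDeriv ℝ n (fun y => φ (torusProj y)) x‖ ≤ B := by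
  obtain ⟨B, hB⟩ := (isCompact_univ_pi fun _ : Fin N => isCompact_Icc (a := (0 : ℝ)) (b := 1)).exists_bound_of_continuousOn
    (hφ.continuous_iteratedFDeriv (m := n) (by exact_mod_cast le_top)).continuousOn
  refine ⟨B, fun x => ?_⟩
  have hx := hB (x + fun i => ((-⌊x i⌋ : ℤ) : ℝ)) (fun i _ => by
    simp only [Pi.add_apply, Int.cast_neg]
    exact ⟨by linarith [Int.floor_le (x i)], by linarith [Int.lt_floor_add_one (x i)]⟩)
  rw [← iteratedFDeriv_comp_add_right (f := fun y => φ (torusProj y))] at hx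
  simpa only [torusProj_intCast] using hx

/-- Translate in the coordinate of the largest frequency, which gives the displacement the optimal
size `1 / (2 ‖k‖)`. -/
theorem exists_half_period {k : Fin N → ℤ} (hk : k ≠ 0) :
    ∃ v : Fin N → ℝ, ‖v‖ = 1 / (2 * ‖k‖) ∧ mFourier k (torusProj v) = -1 := by
  have hk1 := one_le_norm_of_ne_zero hk
  obtain ⟨j₀, -⟩ := Function.ne_iff.1 hk
  obtain ⟨j, -, hj⟩ := Finset.exists_max_image Finset.univ (fun i => ‖k i‖) ⟨j₀, Finset.mem_univ _⟩
  have hkj : ‖k‖ = ‖k j‖ := le_antisymm ((pi_norm_le_iff_of_nonneg (norm_nonneg _)).2 fun i =>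
    hj i (Finset.mem_univ i)) (norm_le_pi_norm k j)
  have hkj' : ‖k‖ = |(k j : ℝ)| := by rw [hkj, Int.norm_eq_abs]
  have hkj0 : (k j : ℝ) ≠ 0 := by
    rw [← abs_pos, ← hkj']; linarith
  refine ⟨Pi.single j (1 / (2 * k j)), ?_, ?_⟩
  · rw [Pi.norm_single, Real.norm_eq_abs, abs_div, abs_mul, hkj']
    simp
  · rw [mFourier_torusProj]
    have : ∑ i, (k i : ℝ) * (Pi.single j (1 / (2 * k j)) : Fin N → ℝ) i = 1 / 2 := by
      rw [Finset.sum_eq_single j]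
      · rw [Pi.single_eq_same]; field_simp
      · intro i _ hi
        rw [Pi.single_eq_of_ne hi, mul_zero]
      · simp
    rw [this, ← Complex.exp_pi_mul_I]
    congr 1
    push_cast
    ring

theorem hasDecay_torusCoeff {F : TorusMap N} (hF : IsSmoothTorusMap F) {n : ℕ} {B : ℝ}
    (hB : ∀ i x, ‖iteratedFDeriv ℝ n (fun y => F (torusProj y) i) x‖ ≤ B) :
    HasDecay n B (torusCoeff F) := by
  intro k hk
  have hk1 := one_le_norm_of_ne_zero hk
  obtain ⟨j, -⟩ := Function.ne_iff.1 hk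
  obtain ⟨v, hvn, hvF⟩ := exists_half_period hk
  have hB0 : 0 ≤ B := (norm_nonneg _).trans (hB j 0)
  refine (pi_norm_le_iff_of_nonneg (by positivity)).2 fun i => ?_
  have := norm_scalarCoeff_le hvF n (fun x => F x i) B (contDiff_pi.1 hF i) (hB i)
  refine this.trans ?_
  rw [mul_comm]
  refine mul_le_mul_of_nonneg_left ?_ hB0
  rw [Real.rpow_neg (by linarith), Real.rpow_natCast, ← inv_pow]
  refine pow_le_pow_left₀ (by positivity) ?_ n
  rw [hvn, div_div, inv_eq_one_div]
  exact one_div_le_one_div_of_le (by linarith) (by linarith)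

theorem norm_torusCoeff_zero_le {F : TorusMap N} {B : ℝ} (hB0 : 0 ≤ B)
    (hB : ∀ i x, ‖F (torusProj x) i‖ ≤ B) : ‖torusCoeff F 0‖ ≤ B := by
  refine (pi_norm_le_iff_of_nonneg hB0).2 fun i => ?_
  have := norm_integral_le_of_norm_le_const (μ := (volume : Measure (UnitAddTorus (Fin N))))
    (f := fun t => mFourier (-0) t * (F t i : ℂ)) (C := B)
    (Filter.Eventually.of_forall fun t => by
      obtain ⟨y, rfl⟩ := torusProj_surjective t
      rw [norm_mul, norm_mFourier_apply, one_mul, Complex.norm_real]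
      exact hB i y)
  rwa [volume_univ_unitAddTorus, mul_one] at this

theorem IsSmoothTorusMap.rapidDecay {F : TorusMap N} (hF : IsSmoothTorusMap F) :
    RapidDecay (torusCoeff F) := by
  intro t ht
  choose B hB using fun i => exists_iteratedFDeriv_bound (φ := fun x => F x i)
    (contDiff_pi.1 hF i) ⌈t⌉₊
  have hB0 : ∀ i, 0 ≤ B i := fun i => (norm_nonneg _).trans (hB i 0)
  refine ⟨∑ i, B i, Finset.sum_nonneg fun i _ => hB0 i, ?_⟩
  refine (hasDecay_torusCoeff (n := ⌈t⌉₊) hF fun i x => (hB i x).trans ?_).mono (Nat.le_ceil t)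
    le_rfl (Finset.sum_nonneg fun i _ => hB0 i)
  exact Finset.single_le_sum (f := B) (fun i _ => hB0 i) (Finset.mem_univ i)

theorem norm_iteratedFDeriv_le_crNorm {F : TorusMap N} {r : ℝ} (hfin : crNorm r F ≠ ⊤) {n : ℕ}
    (hn : n ≤ ⌊r⌋₊) (i : Fin N) (x : Fin N → ℝ) :
    ‖iteratedFDeriv ℝ n (fun y => F (torusProj y) i) x‖ ≤ (crNorm r F).toReal := by
  have h : ‖iteratedFDeriv ℝ n (fun y => F (torusProj y) i) x‖ₑ ≤ crNorm r F := by
    refine le_trans ?_ (le_iSup (fun i => crNormCover r fun y => F (torusProj y) i) i)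
    refine le_trans ?_ (le_max_left _ _)
    exact le_iSup_of_le n (le_iSup_of_le hn (le_iSup_of_le x le_rfl))
  rw [← toReal_enorm]
  exact ENNReal.toReal_mono hfin h

theorem hasDecay_torusCoeff_crNorm {F : TorusMap N} (hF : IsSmoothTorusMap F) {r : ℝ}
    (hfin : crNorm r F ≠ ⊤) {n : ℕ} (hn : n ≤ ⌊r⌋₊) :
    HasDecay n (crNorm r F).toReal (torusCoeff F) ∧ ‖torusCoeff F 0‖ ≤ (crNorm r F).toReal := by
  refine ⟨hasDecay_torusCoeff hF fun i x => norm_iteratedFDeriv_le_crNorm hfin hn i x,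
    norm_torusCoeff_zero_le ENNReal.toReal_nonneg fun i x => ?_⟩
  have := norm_iteratedFDeriv_le_crNorm hfin (Nat.zero_le _) i x
  rwa [norm_iteratedFDeriv_zero] at this

/-- The `C^r` norm is controlled by bounds on the derivatives of order at most `⌊r⌋ + 1`. -/
theorem crNormCover_le {f : (Fin N → ℝ) → ℝ} {r : ℝ} (hf : ContDiff ℝ ∞ f) {B : ℝ} (hB0 : 0 ≤ B)
    (hB : ∀ n ≤ ⌊r⌋₊ + 1, ∀ x, ‖iteratedFDeriv ℝ n f x‖ ≤ B) :
    crNormCover r f ≤ ENNReal.ofReal (2 * B) := by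
  have hBB : ENNReal.ofReal B ≤ ENNReal.ofReal (2 * B) := ENNReal.ofReal_le_ofReal (by linarith)
  refine max_le (iSup_le fun n => iSup_le fun hn => iSup_le fun x => ?_)
    (iSup_le fun hr => iSup_le fun x => iSup_le fun y => iSup_le fun hxy => ?_)
  · refine le_trans ?_ hBB
    rw [← ofReal_norm]
    exact ENNReal.ofReal_le_ofReal (hB n (by omega) x)
  · have hlip := norm_iteratedFDeriv_sub_le (n := ⌊r⌋₊) (hf.of_le (by exact_mod_cast le_top))
      (hB _ le_rfl) y x
    have hbdd : ‖iteratedFDeriv ℝ ⌊r⌋₊ f x - iteratedFDeriv ℝ ⌊r⌋₊ f y‖ ≤ 2 * B :=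
      (norm_sub_le _ _).trans (by linarith [hB _ (Nat.le_succ _) x, hB _ (Nat.le_succ _) y])
    have hd : 0 < ‖x - y‖ := norm_pos_iff.2 (sub_ne_zero.2 hxy)
    have hθ0 := Int.fract_nonneg r
    have hθ1 := (Int.fract_lt_one r).le
    have key : ‖iteratedFDeriv ℝ ⌊r⌋₊ f x - iteratedFDeriv ℝ ⌊r⌋₊ f y‖ ≤
        2 * B * ‖x - y‖ ^ Int.fract r := by
      -- Nearby points use the Lipschitz bound from one extra derivative, distant points the sup
      -- bound.
      rcases le_total ‖x - y‖ 1 with h | h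
      · have h1 : ‖x - y‖ ≤ ‖x - y‖ ^ Int.fract r := by
          conv_lhs => rw [← Real.rpow_one ‖x - y‖]
          exact Real.rpow_le_rpow_of_exponent_ge hd h hθ1
        have := mul_le_mul_of_nonneg_left h1 hB0
        have := mul_nonneg hB0 (Real.rpow_nonneg hd.le (Int.fract r))
        linarith
      · have h1 := Real.one_le_rpow h hθ0
        have := mul_le_mul_of_nonneg_left h1 (show 0 ≤ 2 * B by linarith)
        linarith
    refine ENNReal.div_le_of_le_mul ?_
    rw [edist_eq_enorm_sub, ← ofReal_norm, ← ofReal_norm,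
      ENNReal.ofReal_rpow_of_pos hd, ← ENNReal.ofReal_mul (by linarith)]
    exact ENNReal.ofReal_le_ofReal key

end CoefficientDecay

/-! ### From decaying coefficients back to smooth torus maps. -/

section FourierSynthesis

open UnitAddTorus

variable {N : ℕ}

/-- The linear form `y ↦ k · y`. -/
noncomputable def modeForm (k : Fin N → ℤ) : (Fin N → ℝ) →L[ℝ] ℝ :=
  ∑ i, (k i : ℝ) • ContinuousLinearMap.proj (R := ℝ) (φ := fun _ : Fin N => ℝ) i

theorem modeForm_apply (k : Fin N → ℤ) (y : Fin N → ℝ) : modeForm k y = ∑ i, k i * y i := by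
  simp [modeForm]

theorem norm_modeForm_le (k : Fin N → ℤ) : ‖modeForm k‖ ≤ N * ‖k‖ := by
  refine ContinuousLinearMap.opNorm_le_bound _ (by positivity) fun y => ?_
  rw [modeForm_apply]
  refine (norm_sum_le _ _).trans ?_
  calc ∑ i, ‖(k i : ℝ) * y i‖ ≤ ∑ _i : Fin N, ‖k‖ * ‖y‖ := by
        refine Finset.sum_le_sum fun i _ => ?_
        rw [norm_mul]
        refine mul_le_mul ?_ (norm_le_pi_norm y i) (norm_nonneg _) (norm_nonneg _)
        rw [Int.norm_cast_real]
        exact norm_le_pi_norm k i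
    _ = N * ‖k‖ * ‖y‖ := by
        rw [Finset.sum_const, Finset.card_univ, Fintype.card_fin, nsmul_eq_mul, mul_assoc]

theorem norm_iteratedFDeriv_cexp (n : ℕ) (t : ℝ) :
    ‖iteratedFDeriv ℝ n (fun t : ℝ => Complex.exp (2 * Real.pi * Complex.I * (t : ℂ))) t‖ =
      (2 * Real.pi) ^ n := by
  have h : ∀ n : ℕ, iteratedDeriv n (fun t : ℝ => Complex.exp (2 * Real.pi * Complex.I * (t : ℂ))) =
      fun t : ℝ => (2 * Real.pi * Complex.I) ^ n * Complex.exp (2 * Real.pi * Complex.I * (t : ℂ)) := by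
    intro n
    induction n with
    | zero => simp
    | succ n ih =>
      rw [iteratedDeriv_succ, ih]
      funext s
      have h1 : HasDerivAt (fun t : ℝ => 2 * Real.pi * Complex.I * (t : ℂ))
          (2 * Real.pi * Complex.I * 1) s := (Complex.ofRealCLM.hasDerivAt (x := s)).const_mul _
      rw [((h1.cexp).const_mul _).deriv]
      ring
  rw [norm_iteratedFDeriv_eq_norm_iteratedDeriv, h]
  have h2 : ‖Complex.exp (2 * Real.pi * Complex.I * (t : ℂ))‖ = 1 := by
    rw [show 2 * Real.pi * Complex.I * (t : ℂ) = ((2 * Real.pi * t : ℝ) : ℂ) * Complex.I by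
      push_cast; ring]
    exact Complex.norm_exp_ofReal_mul_I _
  rw [norm_mul, h2, norm_pow, norm_mul, norm_mul, Complex.norm_I, Complex.norm_real,
    Real.norm_of_nonneg Real.pi_pos.le]
  simp

/-- The real part of a Fourier mode, on the universal cover. -/
noncomputable def realMode (c : ℂ) (k : Fin N → ℤ) (y : Fin N → ℝ) : ℝ :=
  (c * mFourier k (torusProj y)).re

theorem realMode_eq (c : ℂ) (k : Fin N → ℤ) : realMode c k =
    (Complex.reCLM ∘L ContinuousLinearMap.mul ℝ ℂ c) ∘
      ((fun t : ℝ => Complex.exp (2 * Real.pi * Complex.I * (t : ℂ))) ∘ modeForm k) := by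
  funext y
  simp only [realMode, mFourier_torusProj, Function.comp_apply, modeForm_apply,
    ContinuousLinearMap.comp_apply, ContinuousLinearMap.mul_apply', Complex.reCLM_apply]

theorem contDiff_cexp_mode :
    ContDiff ℝ ∞ (fun t : ℝ => Complex.exp (2 * Real.pi * Complex.I * (t : ℂ))) :=
  (contDiff_const.mul Complex.ofRealCLM.contDiff).cexp

theorem contDiff_realMode (c : ℂ) (k : Fin N → ℤ) : ContDiff ℝ ∞ (realMode c k) := by
  rw [realMode_eq]
  exact (ContinuousLinearMap.contDiff _).comp (contDiff_cexp_mode.comp (modeForm k).contDiff)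

theorem norm_iteratedFDeriv_realMode_le (c : ℂ) (k : Fin N → ℤ) (n : ℕ) (y : Fin N → ℝ) :
    ‖iteratedFDeriv ℝ n (realMode c k) y‖ ≤ ‖c‖ * (2 * Real.pi * (N * ‖k‖)) ^ n := by
  rw [realMode_eq]
  refine (ContinuousLinearMap.norm_iteratedFDeriv_comp_left _
    (contDiff_cexp_mode.comp (modeForm k).contDiff).contDiffAt (by exact_mod_cast le_top)).trans ?_
  refine mul_le_mul ?_ ?_ (norm_nonneg _) (norm_nonneg _)
  · refine ContinuousLinearMap.opNorm_le_bound _ (norm_nonneg _) fun z => ?_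
    exact (Complex.abs_re_le_norm _).trans (norm_mul _ _).le
  · rw [ContinuousLinearMap.iteratedFDeriv_comp_right (modeForm k) contDiff_cexp_mode y
      (by exact_mod_cast le_top)]
    refine (ContinuousMultilinearMap.norm_compContinuousLinearMap_le _ _).trans ?_
    rw [norm_iteratedFDeriv_cexp, Finset.prod_const, Finset.card_univ, Fintype.card_fin, ← mul_pow]
    exact pow_le_pow_left₀ (by positivity)
      (mul_le_mul_of_nonneg_left (norm_modeForm_le k) (by positivity)) n

theorem summable_norm_rpow_int {s : ℝ} (hs : s < -N) :
    Summable fun k : Fin N → ℤ => ‖k‖ ^ s := by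
  set L := Submodule.span ℤ (Set.range (Pi.basisFun ℝ (Fin N))) with hL
  have hrank : (Module.finrank ℤ L : ℝ) = N := by
    rw [ZLattice.rank ℝ L]
    simp
  have h := ZLattice.summable_norm_rpow L s (by rw [hrank]; exact hs)
  have hmem : ∀ k : Fin N → ℤ, (fun i => (k i : ℝ)) ∈ L := fun k => by
    rw [hL, Module.Basis.mem_span_iff_repr_mem]
    intro i
    exact ⟨k i, by simp⟩
  have hinj : Function.Injective fun k : Fin N → ℤ => (⟨fun i => (k i : ℝ), hmem k⟩ : L) := by
    intro k l hkl
    funext i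
    have : (k i : ℝ) = l i := congrFun (Subtype.ext_iff.1 hkl) i
    exact_mod_cast this
  refine (h.comp_injective hinj).congr fun k => ?_
  have : ‖(fun i => (k i : ℝ))‖ = ‖k‖ := by
    simp only [Pi.norm_def]
    rfl
  simp only [Function.comp_apply, Submodule.coe_norm, this]

/-- Weighted sums of decaying coefficients. -/
theorem exists_weighted_sum_bound (N n : ℕ) : ∃ K : ℝ, 0 ≤ K ∧
    ∀ (c : (Fin N → ℤ) → Fin N → ℂ) (X : ℝ), 0 ≤ X → HasDecay (n + N + 1) X c →
      Summable (fun k => ‖c k‖ * (2 * Real.pi * (N * ‖k‖)) ^ n) ∧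
      ∑' k, ‖c k‖ * (2 * Real.pi * (N * ‖k‖)) ^ n ≤ K * (‖c 0‖ + X) := by
  classical
  have hsum : Summable fun k : Fin N → ℤ => ‖k‖ ^ (-(N + 1 : ℝ)) :=
    summable_norm_rpow_int (by linarith)
  set K₁ := ∑' k : Fin N → ℤ, ‖k‖ ^ (-(N + 1 : ℝ)) with hK₁
  have hK₁0 : 0 ≤ K₁ := tsum_nonneg fun k => by positivity
  set A := (2 * Real.pi * N) ^ n with hA
  have hA0 : 0 ≤ A := by positivity
  refine ⟨1 + A * K₁, by positivity, fun c X hX hc => ?_⟩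
  have hle : ∀ k, ‖c k‖ * (2 * Real.pi * (N * ‖k‖)) ^ n ≤
      (if k = 0 then ‖c 0‖ else 0) + A * X * ‖k‖ ^ (-(N + 1 : ℝ)) := by
    intro k
    by_cases hk : k = 0
    · rw [if_pos hk, hk]
      have h1 : (2 * Real.pi * (N * ‖(0 : Fin N → ℤ)‖)) ^ n ≤ 1 :=
        pow_le_one₀ (by positivity) (by simp)
      have h2 := mul_le_mul_of_nonneg_left h1 (norm_nonneg (c 0))
      have h3 : 0 ≤ A * X * ‖(0 : Fin N → ℤ)‖ ^ (-(N + 1 : ℝ)) := by positivity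
      linarith
    · rw [if_neg hk, zero_add]
      have hk0 : 0 < ‖k‖ := by linarith [one_le_norm_of_ne_zero hk]
      calc _ ≤ X * ‖k‖ ^ (-(n + N + 1 : ℝ)) * (2 * Real.pi * (N * ‖k‖)) ^ n :=
            mul_le_mul_of_nonneg_right (hc k hk) (by positivity)
        _ = A * X * (‖k‖ ^ (-(n + N + 1 : ℝ)) * ‖k‖ ^ (n : ℝ)) := by
            rw [Real.rpow_natCast, hA, ← mul_assoc (2 * Real.pi), mul_pow _ ‖k‖]
            ring
        _ = _ := by
            rw [← Real.rpow_add hk0]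
            congr 2
            ring
  have hfin : HasSum (fun k : Fin N → ℤ => if k = 0 then ‖c 0‖ else 0) ‖c 0‖ := hasSum_ite_eq 0 _
  have htot := hfin.add (hsum.hasSum.mul_left (A * X))
  have hs : Summable (fun k => ‖c k‖ * (2 * Real.pi * (N * ‖k‖)) ^ n) :=
    Summable.of_nonneg_of_le (fun k => by positivity) hle htot.summable
  refine ⟨hs, (hs.tsum_le_tsum hle htot.summable).trans ?_⟩
  rw [htot.tsum_eq, ← hK₁]
  have := mul_nonneg (mul_nonneg hA0 hK₁0) (norm_nonneg (c 0))
  linarith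

/-- The real torus map with prescribed Fourier coefficients. -/
noncomputable def torusSynth (c : (Fin N → ℤ) → Fin N → ℂ) : TorusMap N :=
  fun x i => ∑' k, (c k i * mFourier k x).re

theorem torusSynth_torusProj (c : (Fin N → ℤ) → Fin N → ℂ) (i : Fin N) :
    (fun y => torusSynth c (torusProj y) i) = fun y => ∑' k, realMode (c k i) k y := rfl

theorem RapidDecay.summable_norm {c : (Fin N → ℤ) → Fin N → ℂ} (hc : RapidDecay c) :
    Summable fun k => ‖c k‖ := by
  obtain ⟨K, -, h⟩ := exists_weighted_sum_bound N 0
  obtain ⟨X, hX, hcX⟩ := hc ((0 : ℕ) + N + 1) (by positivity)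
  simpa using (h c X hX hcX).1

theorem summable_mode {c : (Fin N → ℤ) → Fin N → ℂ} (hc : Summable fun k => ‖c k‖)
    (x : UnitAddTorus (Fin N)) (i : Fin N) : Summable fun k => (c k i * mFourier k x).re := by
  refine Summable.of_norm_bounded hc fun k => (Complex.abs_re_le_norm _).trans ?_
  rw [norm_mul, norm_mFourier_apply, mul_one]
  exact norm_le_pi_norm (c k) i

theorem norm_iteratedFDeriv_mode_le (c : (Fin N → ℤ) → Fin N → ℂ) (i : Fin N) (n : ℕ)
    (k : Fin N → ℤ) (y : Fin N → ℝ) :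
    ‖iteratedFDeriv ℝ n (realMode (c k i) k) y‖ ≤ ‖c k‖ * (2 * Real.pi * (N * ‖k‖)) ^ n :=
  (norm_iteratedFDeriv_realMode_le _ _ _ _).trans
    (mul_le_mul_of_nonneg_right (norm_le_pi_norm (c k) i) (by positivity))

theorem RapidDecay.summable_weighted {c : (Fin N → ℤ) → Fin N → ℂ} (hc : RapidDecay c) (n : ℕ) :
    Summable (fun k => ‖c k‖ * (2 * Real.pi * (N * ‖k‖)) ^ n) := by
  obtain ⟨K, -, h⟩ := exists_weighted_sum_bound N n
  obtain ⟨X, hX, hcX⟩ := hc (n + N + 1) (by positivity)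
  exact (h c X hX hcX).1

theorem isSmoothTorusMap_torusSynth {c : (Fin N → ℤ) → Fin N → ℂ} (hc : RapidDecay c) :
    IsSmoothTorusMap (torusSynth c) := by
  refine contDiff_pi.2 fun i => ?_
  rw [torusSynth_torusProj]
  exact contDiff_tsum (N := (⊤ : ℕ∞)) (fun k => contDiff_realMode _ _)
    (fun n _ => hc.summable_weighted n) fun n k y _ => norm_iteratedFDeriv_mode_le c i n k y

/-- The `C^r` norm of a torus map in terms of the decay of its Fourier coefficients. -/
theorem exists_crNorm_torusSynth_le (N : ℕ) (r : ℝ) : ∃ K : ℝ, 0 ≤ K ∧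
    ∀ (c : (Fin N → ℤ) → Fin N → ℂ) (X : ℝ), 0 ≤ X → RapidDecay c →
      HasDecay (⌊r⌋₊ + N + 2) X c →
      crNorm r (torusSynth c) ≤ ENNReal.ofReal (K * (‖c 0‖ + X)) := by
  choose K hK h using exists_weighted_sum_bound N
  set K₀ := ∑ n ∈ Finset.range (⌊r⌋₊ + 2), K n with hK₀
  have hK₀0 : 0 ≤ K₀ := Finset.sum_nonneg fun n _ => hK n
  refine ⟨2 * K₀, by positivity, fun c X hX hc hcX => iSup_le fun i => ?_⟩
  rw [mul_assoc]
  refine crNormCover_le (contDiff_pi.1 (isSmoothTorusMap_torusSynth hc) i) (by positivity)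
    fun n hn y => ?_
  -- The order `⌊r⌋ + N + 2` consists of `⌊r⌋ + 1` derivatives, the last for the Hölder seminorm,
  -- and `N + 1` for summability over `ℤ^N`.
  have hn' : (n : ℝ) ≤ ⌊r⌋₊ + 1 := by exact_mod_cast hn
  obtain ⟨-, hb⟩ := h n c X hX (hcX.mono (by linarith) le_rfl hX)
  have e : iteratedFDeriv ℝ n (fun y => torusSynth c (torusProj y) i) y =
      ∑' k, iteratedFDeriv ℝ n (realMode (c k i) k) y := by
    rw [torusSynth_torusProj]
    exact iteratedFDeriv_tsum_apply (N := (⊤ : ℕ∞)) (fun k => contDiff_realMode _ _)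
      (fun n _ => hc.summable_weighted n)
      (fun n k y _ => norm_iteratedFDeriv_mode_le c i n k y) le_top y
  rw [e]
  refine (tsum_of_norm_bounded (hc.summable_weighted n).hasSum
    fun k => norm_iteratedFDeriv_mode_le c i n k y).trans (hb.trans ?_)
  refine mul_le_mul_of_nonneg_right ?_ (by positivity)
  exact Finset.single_le_sum (f := K) (fun n _ => hK n) (Finset.mem_range.2 (by omega))

theorem torusSynth_torusCoeff {F : TorusMap N} (hF : IsSmoothTorusMap F) :
    torusSynth (torusCoeff F) = F := by
  funext x i
  let f : C(UnitAddTorus (Fin N), ℂ) :=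
    ⟨fun x => (F x i : ℂ), Complex.continuous_ofReal.comp (hF.continuous_apply i)⟩
  have hf : ∀ k, mFourierCoeff f k = torusCoeff F k i := fun k =>
    mFourierCoeff_eq_scalarCoeff (fun x => F x i) k
  have hs : Summable (mFourierCoeff f) := by
    refine Summable.of_norm_bounded hF.rapidDecay.summable_norm fun k => ?_
    rw [hf]
    exact norm_le_pi_norm (torusCoeff F k) i
  have h := Complex.hasSum_re (hasSum_mFourier_series_apply_of_summable hs x)
  simp only [hf, smul_eq_mul] at h
  exact h.tsum_eq

theorem torusSynth_sub {c c' : (Fin N → ℤ) → Fin N → ℂ} (hc : Summable fun k => ‖c k‖)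
    (hc' : Summable fun k => ‖c' k‖) :
    torusSynth (fun k => c k - c' k) = torusSynth c - torusSynth c' := by
  funext x i
  simp only [torusSynth, Pi.sub_apply, sub_mul, Complex.sub_re]
  exact (summable_mode hc x i).tsum_sub (summable_mode hc' x i)

/-- The permutation of the frequencies induced by a group element. -/
def latticeEquiv {H : Type*} [Group H] (σ : H →* GL (Fin N) ℤ) (h : H) :
    (Fin N → ℤ) ≃ (Fin N → ℤ) where
  toFun := latticeAct σ h
  invFun := latticeAct σ h⁻¹
  left_inv k := by rw [← latticeAct_mul, inv_mul_cancel, latticeAct_one]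
  right_inv k := by rw [← latticeAct_mul, mul_inv_cancel, latticeAct_one]

theorem torusSynth_toralAut {H : Type*} [Group H] (ρ : H →* GL (Fin N) ℤ) (h : H)
    (c : (Fin N → ℤ) → Fin N → ℂ) (x : UnitAddTorus (Fin N)) :
    torusSynth c (toralAut (ρ h) x) = torusSynth (fun k => c (latticeAct (dualRep ρ) h k)) x := by
  funext i
  simp only [torusSynth]
  rw [← (latticeEquiv (dualRep ρ) h).tsum_eq]
  refine tsum_congr fun k => ?_
  have : mFourier (latticeAct (dualRep ρ) h k) (toralAut (ρ h) x) = mFourier k x := by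
    rw [← mFourier_toralAut_inv, ← toralAut_mul, inv_mul_cancel, toralAut_one]
  rw [← this]
  rfl

/-- Integer matrices commute with real parts. Consequently equations between complex coefficients
pass to real torus maps without any conjugation symmetry of the coefficients. -/
theorem linAct_torusSynth {H : Type*} [Group H] (ρ : H →* GL (Fin N) ℤ) (h : H)
    {c : (Fin N → ℤ) → Fin N → ℂ} (hc : Summable fun k => ‖c k‖) (x : UnitAddTorus (Fin N)) :
    linAct (ρ h) (torusSynth c x) = torusSynth (fun k => complexRep ρ h (c k)) x := by
  funext i
  simp only [linAct, torusSynth, complexRep_apply]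
  have e : ∀ k, ((∑ j, ((ρ h).val i j : ℂ) * c k j) * mFourier k x).re =
      ∑ j, ((ρ h).val i j : ℝ) * (c k j * mFourier k x).re := fun k => by
    rw [Finset.sum_mul, Complex.re_sum]
    refine Finset.sum_congr rfl fun j _ => ?_
    rw [mul_assoc, ← Complex.ofReal_intCast, Complex.re_ofReal_mul]
  rw [tsum_congr e, Summable.tsum_finsetSum fun j _ => (summable_mode hc x j).mul_left _]
  exact Finset.sum_congr rfl fun j _ => tsum_mul_left.symm

theorem twistedDelta_torusSynth {H : Type*} [Group H] (ρ : H →* GL (Fin N) ℤ) (h : H)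
    {c : (Fin N → ℤ) → Fin N → ℂ} (hc : RapidDecay c) :
    twistedDelta (ρ h) (torusSynth c) = torusSynth (coefDelta ρ (dualRep ρ) h c) := by
  have h1 : Summable fun k => ‖complexRep ρ h (c k)‖ := by
    obtain ⟨C, hC, hb⟩ := exists_rep_bound ρ h
    exact Summable.of_nonneg_of_le (fun _ => norm_nonneg _) (fun k => hb (c k))
      (hc.summable_norm.mul_left C)
  have h2 : Summable fun k => ‖c (latticeAct (dualRep ρ) h k)‖ :=
    (latticeEquiv (dualRep ρ) h).summable_iff.2 hc.summable_norm
  have h3 := torusSynth_sub h1 h2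
  change torusSynth (coefDelta ρ (dualRep ρ) h c) = _ at h3
  rw [h3]
  funext x
  rw [twistedDelta, linAct_torusSynth ρ h hc.summable_norm, torusSynth_toralAut]
  rfl

theorem IsSmoothTorusMap.sub_twistedDelta {H : Type*} [Group H] (ρ : H →* GL (Fin N) ℤ)
    {R : H → TorusMap N} {h : H} (hR : IsSmoothTorusMap (R h)) {c : (Fin N → ℤ) → Fin N → ℂ}
    (hc : RapidDecay c) : R h - twistedDelta (ρ h) (torusSynth c) =
      torusSynth (coefResidual ρ (dualRep ρ) (fun h => torusCoeff (R h)) c h) := by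
  have h1 : RapidDecay (coefDelta ρ (dualRep ρ) h c) := fun t ht => by
    obtain ⟨Z, hZ, h2⟩ := hc t ht
    obtain ⟨C, hC, h3⟩ := exists_hasDecay_coefDelta ρ (dualRep ρ) h ht
    exact ⟨C * Z, by positivity, h3 c Z hZ h2⟩
  have h2 := torusSynth_sub hR.rapidDecay.summable_norm h1.summable_norm
  rw [torusSynth_torusCoeff hR, ← twistedDelta_torusSynth ρ h hc] at h2
  exact h2.symm

end FourierSynthesis

/-! ### Consequences of ergodicity for lattice vectors and for the zero mode. -/

section ErgodicPairs

open UnitAddTorus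

variable {N : ℕ} {H : Type*} [Group H]

theorem integral_mFourier {k : Fin N → ℤ} (hk : k ≠ 0) : ∫ t, mFourier k t = 0 := by
  obtain ⟨v, -, hv⟩ := exists_half_period hk
  have h := integral_add_right_eq_self (μ := volume) (fun t => mFourier k t) (torusProj v)
  simp only [mFourier_apply_add, hv, mul_neg, mul_one, integral_neg] at h
  exact self_eq_neg.1 h.symm

theorem integral_mFourier_mul (k l : Fin N → ℤ) :
    ∫ t, mFourier (-k) t * mFourier l t = if l = k then 1 else 0 := by
  have h : ∀ t, mFourier (-k) t * mFourier l t = mFourier (l - k) t := fun t => by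
    rw [← mFourier_add, neg_add_eq_sub]
  simp only [h]
  split_ifs with hlk
  · rw [hlk, sub_self, mFourier_zero]
    simp [volume_univ_unitAddTorus]
  · exact integral_mFourier (sub_ne_zero.2 hlk)

theorem integrable_mFourier_mul_mFourier (k l : Fin N → ℤ) :
    Integrable (fun t => mFourier k t * mFourier l t) :=
  Continuous.integrable_of_hasCompactSupport (by fun_prop) (HasCompactSupport.of_compactSpace _)

/-- An ergodic automorphism has no nontrivial periodic characters. -/
theorem latticeAct_pow_ne_of_ergodic (ρ : H →* GL (Fin N) ℤ) {x : H}
    (hx : Ergodic (toralAut (ρ x)) (volume : Measure (UnitAddTorus (Fin N)))) {q : ℕ} (hq : 0 < q)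
    {k : Fin N → ℤ} (hk : k ≠ 0) : latticeAct (dualRep ρ) (x ^ q) k ≠ k := by
  intro hper
  set f : UnitAddTorus (Fin N) → ℂ := fun t =>
    ∑ i ∈ Finset.range q, mFourier (latticeAct (dualRep ρ) (x ^ i) k) t with hf
  have hfc : Continuous f := by fun_prop
  have hinv : ∀ t, f (toralAut (ρ x)⁻¹ t) = f t := by
    intro t
    simp only [hf, mFourier_toralAut_inv, ← latticeAct_mul, ← pow_succ']
    have h1 := Finset.sum_range_succ (fun i => mFourier (latticeAct (dualRep ρ) (x ^ i) k) t) q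
    have h2 := Finset.sum_range_succ' (fun i => mFourier (latticeAct (dualRep ρ) (x ^ i) k) t) q
    rw [hper] at h1
    rw [pow_zero, latticeAct_one] at h2
    exact add_right_cancel (h2.symm.trans h1)
  have hcomp : f ∘ toralAut (ρ x) = f := by
    funext t
    rw [Function.comp_apply, ← hinv, ← toralAut_mul, inv_mul_cancel, toralAut_one]
  obtain ⟨c, hc⟩ := hx.toPreErgodic.ae_eq_const_of_ae_eq_comp hfc.measurable hcomp
  -- The sum `f` of the characters along a periodic orbit is invariant, hence constant almost
  -- everywhere with zero coefficient at `k`; but that coefficient counts the returns to `k`,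
  -- including `i = 0`.
  have h1 : ∫ t, mFourier (-k) t * f t = 0 := by
    have : (fun t => mFourier (-k) t * f t) =ᵐ[volume] fun t => mFourier (-k) t * c := by
      filter_upwards [hc] with t ht
      rw [ht, Function.const_apply]
    rw [integral_congr_ae this, integral_mul_const, integral_mFourier (neg_ne_zero.2 hk), zero_mul]
  have h2 : ∫ t, mFourier (-k) t * f t = ((Finset.range q).filter fun i =>
      latticeAct (dualRep ρ) (x ^ i) k = k).card := by
    simp only [hf, Finset.mul_sum]
    rw [integral_finsetSum _ fun i _ => integrable_mFourier_mul_mFourier _ _]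
    simp only [integral_mFourier_mul, Finset.sum_boole]
  rw [h1] at h2
  have h3 : ((Finset.range q).filter fun i => latticeAct (dualRep ρ) (x ^ i) k = k).card = 0 := by
    exact_mod_cast h2.symm
  rw [Finset.card_eq_zero] at h3
  have h4 : 0 ∈ (Finset.range q).filter fun i => latticeAct (dualRep ρ) (x ^ i) k = k := by
    simp [hq, latticeAct_one]
  rw [h3] at h4
  exact absurd h4 (Finset.notMem_empty _)

theorem IsHigherRankErgodicPair.noPeriodicVectors {ρ : H →* GL (Fin N) ℤ} {a b : H}
    (hab : IsHigherRankErgodicPair ρ a b) {l : ℕ} (hl : 1 ≤ l) :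
    NoPeriodicVectors (dualRep ρ) (a ^ l) b := by
  intro j m hjm q hq k hk
  refine latticeAct_pow_ne_of_ergodic ρ ?_ hq hk
  have h := hab (l * j) m fun h => by
    rw [Prod.mk.injEq] at h
    rcases mul_eq_zero.1 h.1 with h1 | h1
    · omega
    · exact hjm (Prod.ext h1 h.2)
  rwa [_root_.zpow_mul, _root_.zpow_natCast, ← map_pow, ← map_zpow, ← map_zpow, ← map_mul] at h

/-- The twisted equation is solvable in the zero mode. -/
theorem NoPeriodicVectors.exists_zero_mode {ρ : H →* GL (Fin N) ℤ} {g b : H}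
    (h : NoPeriodicVectors (dualRep ρ) g b) : (∀ v : Fin N → ℂ, ∃ w, complexRep ρ g w - w = v) ∧
      ∃ C : ℝ, 1 ≤ C ∧ ∀ w : Fin N → ℂ, ‖w‖ ≤ C * ‖complexRep ρ g w - w‖ := by
  have hinj : Function.Injective (complexRep ρ g - 1 : Module.End ℂ (Fin N → ℂ)) := by
    rw [← LinearMap.ker_eq_bot, LinearMap.ker_eq_bot']
    intro v hv
    by_contra hv0
    have hmat : ((ρ g).val - 1).map (Int.castRingHom ℂ) *ᵥ v = 0 := by
      rw [Matrix.map_sub _ (map_sub _), Matrix.map_one _ (map_zero _) (map_one _),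
        Matrix.sub_mulVec, Matrix.one_mulVec]
      exact hv
    have hdet : ((ρ g).val - 1).det = 0 := by
      have h1 := Matrix.exists_mulVec_eq_zero_iff.1 ⟨v, hv0, hmat⟩
      have h2 := RingHom.map_det (Int.castRingHom ℂ) ((ρ g).val - 1)
      rw [RingHom.mapMatrix_apply, h1, eq_intCast] at h2
      exact_mod_cast h2
    -- The dual action involves transposes: an eigenvalue one of `ρ g` yields an integer vector
    -- fixed by the dual action of `g⁻¹`, the case `j = -1`, `m = 0`, `q = 1` of the hypothesis.
    rw [← Matrix.det_transpose] at hdet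
    obtain ⟨l, hl0, hl⟩ := Matrix.exists_mulVec_eq_zero_iff.2 hdet
    rw [Matrix.transpose_sub, Matrix.transpose_one, Matrix.sub_mulVec, Matrix.one_mulVec,
      sub_eq_zero] at hl
    have h1 : latticeAct (dualRep ρ) g⁻¹ l = l := by
      rw [latticeAct, dualRep, MonoidHom.coe_mk, OneHom.coe_mk]
      simpa using hl
    refine h (-1) 0 (by simp) 1 one_pos l hl0 ?_
    simpa using h1
  set e := LinearEquiv.ofInjectiveEndo (complexRep ρ g - 1) hinj
  obtain ⟨C, hC, hb⟩ := exists_end_bound e.symm.toLinearMap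
  refine ⟨fun v => ⟨e.symm v, e.apply_symm_apply v⟩, C, hC, fun w => ?_⟩
  have := hb (e w)
  rwa [LinearEquiv.coe_coe, e.symm_apply_apply] at this

end ErgodicPairs

/-! ### Termination of the iterated commutators. -/

section IteratedCommutators

variable {H : Type*} [Group H]

theorem iterComm_mem_lowerCentralSeries (g b : H) (i : ℕ) :
    iterComm g b i ∈ (⊤ : Subgroup H).lowerCentralSeries i := by
  induction i with
  | zero => simp
  | succ i ih =>
    have h := Subgroup.commutator_mem_commutator (inv_mem ih) (Subgroup.mem_top g⁻¹)
    rw [Subgroup.lowerCentralSeries_succ]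
    have h' := inv_mem h
    rw [commutatorElement_inv] at h'
    simpa [iterComm, commutatorElement_def] using h'

theorem iterComm_nilpotencyClass [Group.IsNilpotent H] (g b : H) :
    iterComm g b (Group.nilpotencyClass H) = 1 := by
  have h := iterComm_mem_lowerCentralSeries g b (Group.nilpotencyClass H)
  rwa [Subgroup.lowerCentralSeries_nilpotencyClass, Subgroup.mem_bot] at h

theorem iterComm_succ_of_eq_one {g b : H} {n : ℕ} (hn : iterComm g b n = 1) :
    iterComm g b (n + 1) = 1 := by
  simp [iterComm, hn]

end IteratedCommutators

/-! ### The descent at the zero frequency. -/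

section ZeroMode

variable {N : ℕ} {H : Type*} [Group H] {ρ σ : H →* GL (Fin N) ℤ}

theorem latticeAct_zero (h : H) : latticeAct σ h 0 = 0 := by
  simp [latticeAct]

/-- The zero modes of the residuals are controlled by those of the cocycle differences. -/
theorem exists_zero_mode_residual_bound (ρ σ : H →* GL (Fin N) ℤ) {g b : H} {n : ℕ}
    (hn : iterComm g b n = 1) {C₀ : ℝ} (hC₀ : 1 ≤ C₀)
    (hinv : ∀ w : Fin N → ℂ, ‖w‖ ≤ C₀ * ‖complexRep ρ g w - w‖) : ∃ C : ℝ, 1 ≤ C ∧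
    ∀ (R : H → (Fin N → ℤ) → Fin N → ℂ) (X : ℝ), R g 0 = 0 → 0 ≤ X →
      (∀ j ≤ n, ‖coefCocycle ρ σ R g (iterComm g b j) 0‖ ≤ X) →
      ∀ j ≤ n, ‖R (iterComm g b j) 0‖ ≤ C * X := by
  have key : ∀ i, i ≤ n → ∃ C : ℝ, 1 ≤ C ∧
      ∀ (R : H → (Fin N → ℤ) → Fin N → ℂ) (X : ℝ), R g 0 = 0 → 0 ≤ X →
      (∀ j ≤ n, ‖coefCocycle ρ σ R g (iterComm g b j) 0‖ ≤ X) →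
      ‖R (iterComm g b i) 0‖ ≤ C * X := by
    intro i hi
    induction hi using Nat.decreasingInduction with
    | self =>
      refine ⟨1, le_rfl, fun R X _ _ hX => ?_⟩
      have := hX n le_rfl
      rw [hn, coefCocycle_one, latticeAct_zero, norm_neg] at this
      rwa [hn, one_mul]
    | of_succ i hin ih =>
      obtain ⟨C, hC, h⟩ := ih
      obtain ⟨B, hB, hrep⟩ := exists_rep_bound ρ (iterComm g b i * g)
      refine ⟨C₀ * (1 + B * C), by nlinarith [mul_nonneg (by linarith : 0 ≤ B) (by linarith : 0 ≤ C)],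
        fun R X hg hX0 hX => ?_⟩
      -- At frequency zero the lattice action is trivial, so the equation is `(ρ(g) - 1) R_y(0) =
      -- ...` and invertibility replaces the orbit estimates.
      have heq := coefCocycle_eq (ρ := ρ) (σ := σ) (g := g) R (iterComm g b i) 0
      simp only [latticeAct_zero, hg, map_zero, sub_zero, add_zero] at heq
      refine (hinv _).trans ?_
      rw [mul_assoc]
      refine mul_le_mul_of_nonneg_left ?_ (by linarith)
      rw [heq]
      refine (norm_add_le _ _).trans ?_
      have h1 := hX i hin.le
      have h2 := (hrep (R (g⁻¹ * (iterComm g b i)⁻¹ * g * iterComm g b i) 0)).trans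
        (mul_le_mul_of_nonneg_left (h R X hg hX0 hX) (by linarith))
      linarith
  choose! C hC h using key
  refine ⟨∑ i ∈ Finset.range (n + 1), C i, ?_, fun R X hg hX0 hX j hj => ?_⟩
  · refine (hC 0 (Nat.zero_le _)).trans (Finset.single_le_sum (f := C) (fun i hi => ?_) (by simp))
    linarith [hC i (by simpa [Nat.lt_succ_iff] using hi)]
  · refine (h j hj R X hg hX0 hX).trans (mul_le_mul_of_nonneg_right ?_ hX0)
    refine Finset.single_le_sum (f := C) (fun i hi => ?_) (by simpa [Nat.lt_succ_iff] using hj)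
    linarith [hC i (by simpa [Nat.lt_succ_iff] using hi)]

end ZeroMode

/-! ### The zero mode joined to the others, and the final estimates. -/

section Assembly

variable {N : ℕ} {H : Type*} [Group H]

/-- The approximate solution of the family of twisted equations on the Fourier side. -/
theorem exists_coefficient_solution [Group.IsNilpotent H] (ρ : H →* GL (Fin N) ℤ) {g b : H}
    (hper : NoPeriodicVectors (dualRep ρ) g b) {n : ℕ} (hn : iterComm g b n = 1) :
    ∃ s : ℝ, 0 ≤ s ∧ ∃ 𝒮 : ((Fin N → ℤ) → Fin N → ℂ) → (Fin N → ℤ) → Fin N → ℂ,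
      (∀ f, RapidDecay f → RapidDecay (𝒮 f)) ∧
      ∀ t : ℝ, 0 ≤ t → ∃ C : ℝ, 1 ≤ C ∧
        (∀ f X, 0 ≤ X → HasDecay (t + s) X f → ‖f 0‖ ≤ X →
          HasDecay t (C * X) (𝒮 f) ∧ ‖𝒮 f 0‖ ≤ C * X) ∧
        ∀ (R : H → (Fin N → ℤ) → Fin N → ℂ) (X : ℝ), 0 ≤ X → RapidDecay (R g) →
          (∀ j ≤ n, RapidDecay (R (iterComm g b j))) →
          (∀ j ≤ n, HasDecay (t + s) X (coefCocycle ρ (dualRep ρ) R g (iterComm g b j)) ∧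
            ‖coefCocycle ρ (dualRep ρ) R g (iterComm g b j) 0‖ ≤ X) →
          ∀ h, (h = g ∨ ∃ j ≤ n, h = iterComm g b j) →
            HasDecay t (C * X) (coefResidual ρ (dualRep ρ) R (𝒮 (R g)) h) ∧
            ‖coefResidual ρ (dualRep ρ) R (𝒮 (R g)) h 0‖ ≤ C * X := by
  obtain ⟨S⟩ := exists_weightSystem (complexRep (dualRep ρ)) g b
  obtain ⟨s, hs, 𝒮, h𝒮, hfam⟩ := S.exists_solution_family ρ hper hn
  obtain ⟨hsurj, C₀, hC₀, hinv⟩ := hper.exists_zero_mode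
  choose Z hZ using hsurj
  obtain ⟨C₁, hC₁, hzero⟩ := exists_zero_mode_residual_bound ρ (dualRep ρ) hn hC₀ hinv
  -- The estimates off the origin leave the zero coefficient free; it is chosen to solve the
  -- equation for `g` exactly.
  let 𝒮' : ((Fin N → ℤ) → Fin N → ℂ) → (Fin N → ℤ) → Fin N → ℂ := fun f =>
    Function.update (𝒮 f) 0 (Z (f 0))
  have h0 : ∀ f, 𝒮' f 0 = Z (f 0) := fun f => Function.update_self _ _ _
  have hne : ∀ f, ∀ k ≠ 0, 𝒮' f k = 𝒮 f k := fun f k hk => Function.update_of_ne hk _ _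
  have hdec : ∀ {f t X}, HasDecay t X (𝒮 f) → HasDecay t X (𝒮' f) := fun h k hk => by
    rw [hne _ k hk]
    exact h k hk
  refine ⟨s, hs, 𝒮', fun f hf t ht => ?_, fun t ht => ?_⟩
  · obtain ⟨C, hC, h⟩ := h𝒮 t ht
    obtain ⟨X, hX, hfX⟩ := hf (t + s) (by linarith)
    exact ⟨C * X, by positivity, hdec (h f X hX hfX)⟩
  obtain ⟨C₂, hC₂, h₂⟩ := h𝒮 t ht
  obtain ⟨C₃, hC₃, h₃⟩ := hfam t ht
  refine ⟨C₀ + C₁ + C₂ + C₃, by linarith, fun f X hX hf hf0 => ⟨?_, ?_⟩,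
    fun R X hX hg hd hL => ?_⟩
  · exact (hdec (h₂ f X hX hf)).mono le_rfl
      (mul_le_mul_of_nonneg_right (by linarith) hX) (by positivity)
  · rw [h0]
    refine (hinv _).trans ?_
    rw [hZ]
    exact mul_le_mul (by linarith) hf0 (norm_nonneg _) (by linarith)
  have hres := h₃ R (𝒮' (R g)) X hX hg hd (hne _) fun j hj => (hL j hj).1
  have hmono : ∀ {h}, HasDecay t (C₃ * X) (coefResidual ρ (dualRep ρ) R (𝒮' (R g)) h) →
      HasDecay t ((C₀ + C₁ + C₂ + C₃) * X) (coefResidual ρ (dualRep ρ) R (𝒮' (R g)) h) :=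
    fun h => h.mono le_rfl (mul_le_mul_of_nonneg_right (by linarith) hX) (by positivity)
  have hg0 : coefResidual ρ (dualRep ρ) R (𝒮' (R g)) g 0 = 0 := by
    rw [coefResidual, coefDelta, latticeAct_zero, h0, hZ, sub_self]
  have hd0 := hzero (coefResidual ρ (dualRep ρ) R (𝒮' (R g))) X hg0 hX fun j hj => by
    rw [coefCocycle_residual]
    exact (hL j hj).2
  rintro h (rfl | ⟨j, hj, rfl⟩)
  · refine ⟨hmono hres.1, ?_⟩
    rw [hg0, norm_zero]
    positivity
  · exact ⟨hmono (hres.2 j hj),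
      (hd0 j hj).trans (mul_le_mul_of_nonneg_right (by linarith) hX)⟩

theorem contDiff_linAct (M : GL (Fin N) ℤ) : ContDiff ℝ ∞ (linAct M) := by
  unfold linAct
  fun_prop

theorem IsSmoothTorusMap.comp_toralAut {F : TorusMap N} (hF : IsSmoothTorusMap F)
    (M : GL (Fin N) ℤ) : IsSmoothTorusMap fun p => F (toralAut M p) := by
  unfold IsSmoothTorusMap
  simp only [toralAut_torusProj]
  have h : ContDiff ℝ ∞ fun x : Fin N → ℝ => F (torusProj x) := hF
  exact h.comp (contDiff_linAct M)

theorem IsSmoothTorusMap.linAct_apply {F : TorusMap N} (hF : IsSmoothTorusMap F)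
    (M : GL (Fin N) ℤ) : IsSmoothTorusMap fun p => linAct M (F p) :=
  ContDiff.comp (contDiff_linAct M) hF

theorem isSmoothTorusMap_cocycleDiff (ρ : H →* GL (Fin N) ℤ) {R : H → TorusMap N} {x y : H}
    (hx : IsSmoothTorusMap (R x)) (hy : IsSmoothTorusMap (R y))
    (hz : IsSmoothTorusMap (R (x⁻¹ * y⁻¹ * x * y))) : IsSmoothTorusMap (cocycleDiff ρ R x y) :=
  ((((hx.comp_toralAut _).add (hy.linAct_apply _)).sub (hy.comp_toralAut _)).sub
    ((hx.comp_toralAut _).linAct_apply _)).sub (hz.linAct_apply _)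

theorem ofReal_mul_toReal_le {C D : ℝ} (hC : 0 ≤ C) (hCD : C ≤ D) {X : ℝ≥0∞} (hX : X ≠ ⊤) :
    ENNReal.ofReal (C * X.toReal) ≤ D.toNNReal * X := by
  rw [ENNReal.ofReal_mul hC, ENNReal.ofReal_toReal hX]
  exact mul_le_mul_left (ENNReal.ofReal_le_ofReal hCD) X

end Assembly

theorem proposition4 {N : ℕ} {H : Type*} [Group H] [Group.FG H] [Group.IsNilpotent H]
    (ρ : H →* GL (Fin N) ℤ) (a b : H) (hab : IsHigherRankErgodicPair ρ a b) :
    ∃ l₀ : ℕ, ∀ l : ℕ, l₀ ≤ l →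
      ∃ κ : ℝ, 0 < κ ∧ ∃ σ' : ℝ, 0 ≤ σ' ∧ ∃ δ : ℝ≥0, 0 < δ ∧ ∃ C : ℝ → ℝ≥0,
        ∀ R : H → TorusMap N,
          IsSmoothTorusMap (R (a ^ l)) →
          (∀ i ≤ Group.nilpotencyClass H, IsSmoothTorusMap (R (iterComm (a ^ l) b i))) →
          familyNorm R (a ^ l) (iterComm (a ^ l) b) (Group.nilpotencyClass H) (N + 3 + κ) < δ →
          ∃ (Ω : TorusMap N) (RR : H → TorusMap N),
            IsSmoothTorusMap Ω ∧
            R (a ^ l) = twistedDelta (ρ (a ^ l)) Ω + RR (a ^ l) ∧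
            (∀ i ≤ Group.nilpotencyClass H,
              R (iterComm (a ^ l) b i) =
                twistedDelta (ρ (iterComm (a ^ l) b i)) Ω + RR (iterComm (a ^ l) b i)) ∧
            ∀ r : ℝ, 0 ≤ r →
              crNorm r Ω ≤
                C r * familyNorm R (a ^ l) (iterComm (a ^ l) b) (Group.nilpotencyClass H)
                  (r + (N + 3 + κ)) ∧
              familyNorm RR (a ^ l) (iterComm (a ^ l) b) (Group.nilpotencyClass H) r ≤
                C r * cocycleDiffNorm ρ R (a ^ l) (iterComm (a ^ l) b) (Group.nilpotencyClass H)
                  (r + (N + 3 + κ) + σ') := by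
  -- With `l ≥ 1` the pair `(l j, m)` is nonzero whenever `(j, m)` is, so ergodicity passes from
  -- `a`, `b` to `a ^ l`, `b`.
  refine ⟨1, fun l hl => ?_⟩
  have hper := hab.noPeriodicVectors hl
  have hn := iterComm_nilpotencyClass (a ^ l) b
  generalize a ^ l = g at hper hn ⊢
  generalize Group.nilpotencyClass H = n at hn ⊢
  obtain ⟨s, hs, 𝒮, hrapid, hbound⟩ := exists_coefficient_solution ρ hper hn
  have ht : ∀ r : ℝ, (0 : ℝ) ≤ ⌊r⌋₊ + N + 2 := fun r => by positivity
  choose K hK hsynth using exists_crNorm_torusSynth_le N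
  choose A hA h𝒮 hres using fun r => hbound _ (ht r)
  have hpos : ∀ r, 0 ≤ K r * (A r + A r) := fun r => by
    have := hA r
    have := hK r
    positivity
  -- The total loss is rounded up to an integer, so that it passes through the floor and whole
  -- derivatives are counted.
  have hfloor : ∀ r : ℝ, 0 ≤ r →
      ⌊r + (N + 3 + ((⌈s⌉₊ : ℝ) + 1))⌋₊ = ⌊r⌋₊ + (N + 3 + (⌈s⌉₊ + 1)) := fun r hr => by
    rw [← Nat.floor_add_natCast hr]
    push_cast
    rfl
  have hdecay : ∀ (r : ℝ), 0 ≤ r → ∀ (F : TorusMap N) (X : ℝ≥0∞), IsSmoothTorusMap F → X ≠ ⊤ →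
      crNorm (r + (N + 3 + ((⌈s⌉₊ : ℝ) + 1))) F ≤ X →
      HasDecay (⌊r⌋₊ + N + 2 + s) X.toReal (torusCoeff F) ∧ ‖torusCoeff F 0‖ ≤ X.toReal := by
    intro r hr F X hF hX hle
    have hmono := ENNReal.toReal_mono hX hle
    obtain ⟨h1, h2⟩ := hasDecay_torusCoeff_crNorm hF (ne_top_of_le_ne_top hX hle) le_rfl
    refine ⟨h1.mono ?_ hmono ENNReal.toReal_nonneg, h2.trans hmono⟩
    rw [hfloor r hr]
    push_cast
    linarith [Nat.le_ceil s]
  have hfinal : ∀ (r : ℝ) (c : (Fin N → ℤ) → Fin N → ℂ) (X : ℝ≥0∞), RapidDecay c →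
      (X ≠ ⊤ → HasDecay (⌊r⌋₊ + N + 2) (A r * X.toReal) c ∧ ‖c 0‖ ≤ A r * X.toReal) →
      crNorm r (torusSynth c) ≤ (K r * (A r + A r) + 1).toNNReal * X := by
    intro r c X hc hcX
    -- The `+ 1` in the constant keeps it positive, so an infinite right side is really infinite
    -- rather than `0 * ⊤ = 0`.
    by_cases hX : X = ⊤
    · have : ((K r * (A r + A r) + 1).toNNReal : ℝ≥0∞) ≠ 0 :=
        ENNReal.coe_ne_zero.2 (Real.toNNReal_pos.2 (by linarith [hpos r])).ne'
      rw [hX, ENNReal.mul_top this]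
      exact le_top
    · have h1 := hA r
      have h2 := ENNReal.toReal_nonneg (a := X)
      refine (hsynth r c _ (by positivity) hc (hcX hX).1).trans
        (le_trans (ENNReal.ofReal_le_ofReal ?_) (ofReal_mul_toReal_le (hpos r) (by linarith) hX))
      rw [mul_assoc, add_mul]
      exact mul_le_mul_of_nonneg_left (by linarith [(hcX hX).2]) (hK r)
  -- `κ = ⌈s⌉ + 1`, with `s` the loss on the Fourier side. The residuals lose no more than the
  -- solution, so `σ' = 0` suffices.
  refine ⟨⌈s⌉₊ + 1, by positivity, 0, le_rfl, 1, one_pos,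
    fun r => (K r * (A r + A r) + 1).toNNReal, fun R hg hd _ => ?_⟩
  set c := 𝒮 (torusCoeff (R g)) with hc
  have hcr : RapidDecay c := hrapid _ hg.rapidDecay
  have hsm : ∀ h, (h = g ∨ ∃ j ≤ n, h = iterComm g b j) → IsSmoothTorusMap (R h) := by
    rintro h (rfl | ⟨j, hj, rfl⟩)
    exacts [hg, hd j hj]
  -- The cocycle difference at `d_n` involves `d_{n+1}`, outside the given family; both elements are
  -- trivial, so they carry the same map.
  have hsucc : ∀ j ≤ n, IsSmoothTorusMap (R (iterComm g b (j + 1))) := fun j hj => by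
    rcases hj.lt_or_eq with hj | rfl
    · exact hd _ hj
    · rw [iterComm_succ_of_eq_one hn, ← hn]
      exact hd j le_rfl
  refine ⟨torusSynth c, fun h => R h - twistedDelta (ρ h) (torusSynth c),
    isSmoothTorusMap_torusSynth hcr, (add_sub_cancel _ _).symm,
    fun i _ => (add_sub_cancel _ _).symm, fun r hr => ⟨?_, ?_⟩⟩
  · refine hfinal r c _ hcr fun hX => ?_
    obtain ⟨h1, h2⟩ := hdecay r hr (R g) _ hg hX (le_max_left _ _)
    exact h𝒮 r _ _ ENNReal.toReal_nonneg h1 h2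
  · rw [add_zero]
    have key : ∀ h, (h = g ∨ ∃ j ≤ n, h = iterComm g b j) →
        crNorm r (R h - twistedDelta (ρ h) (torusSynth c)) ≤ (K r * (A r + A r) + 1).toNNReal *
          cocycleDiffNorm ρ R g (iterComm g b) n (r + (N + 3 + ((⌈s⌉₊ : ℝ) + 1))) := by
      intro h hh
      rw [(hsm h hh).sub_twistedDelta ρ hcr]
      refine hfinal r _ _ (RapidDecay.residual (hsm h hh).rapidDecay hcr) fun hX => ?_
      refine hres r (fun h => torusCoeff (R h)) _ ENNReal.toReal_nonneg hg.rapidDecay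
        (fun j hj => (hd j hj).rapidDecay) (fun j hj => ?_) h hh
      have h1 := hdecay r hr _ _ (isSmoothTorusMap_cocycleDiff ρ hg (hd j hj) (hsucc j hj)) hX
        (le_iSup₂_of_le (f := fun i (_ : i ≤ n) => crNorm _ (cocycleDiff ρ R g (iterComm g b i)))
          j hj le_rfl)
      have h2 : torusCoeff (cocycleDiff ρ R g (iterComm g b j)) =
          coefCocycle ρ (dualRep ρ) (fun h => torusCoeff (R h)) g (iterComm g b j) :=
        funext fun k => torusCoeff_cocycleDiff ρ hg.continuous (hd j hj).continuous
          (hsucc j hj).continuous k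
      rwa [h2] at h1
    exact max_le (key g (Or.inl rfl)) (iSup₂_le fun j hj => key _ (Or.inr ⟨j, hj, rfl⟩))
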